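/- Corollary (Polynomial Identifiability of the Topic Model). In the exchangeable single-topic model with $R$ topics and a dictionary of $n$ words, a document of $\ell$ words is generated by picking a topic $r\in[R]$ with probability $w_r$ and then drawing $\ell$ words independently from a probability distribution $\mu_r$ on $[n]$; let $M$ be the $n\times R$ matrix with columns $\mu_1,\dots,\mu_R$. For $\tau>0$, the $\tau$-robust Kruskal rank $\mathrm{Krank}_\tau(M)$ is the largest $k\le R$ such that every $n\times k$ submatrix of $M$ formed by $k$ of its columns has $k$-th largest singular value at least $1/\tau$. There is an absolute constant $C$ such that the following holds for every constant $\ell\ge 1$ and every constant $c\in\mathbb N$. There is an algorithm that gets $n$, $R$, an accuracy $\eta>0$, and parameters $\gamma>0$, $\tau>0$ (the last three in the form of the integers $\lceil 1/\eta\rceil,\lceil 1/\gamma\rceil,\lceil\tau\rceil$), and access to independent documents of $\ell$ words, such that for every topic model with $w_r>\gamma$ for all $r\in[R]$ and $$\mathrm{Krank}_\tau(M)\ \ge\ \frac{2R}{\ell}+1 ,$$ writing $\eta_1=\min(\eta,1)$: 1. The algorithm always halts, and uses at most $N = O_{\ell,c}(1)\cdot\Big(\frac{Rn}{\gamma\eta_1}\Big)^{C2^{\ell}}\Big(\frac{n\tau}{\gamma}\Big)^{C\ell}$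 documents, which is $\mathrm{poly}_\ell(1/\eta_1,R,n,\tau,1/\gamma)$. 2. With probability at least $1-n^{-c}$ over the documents, it outputs a matrix $M'$ and weights $w'_1,\dots,w'_R$ such that, for some permutation $\pi$ of the topics, with $M'_\pi$ the matrix whose column $r$ is column $\pi(r)$ of $M'$, $$\|M-M'_\pi\|_F\le\eta\quad\text{and}\quad |w_r-w'_{\pi(r)}|<\eta\ \text{ for all } r\in[R].$$ 3. If moreover $\tau$ is polynomially bounded in $n$, say $\tau\le n^d$, its running time is at most $n^{D\,R^2\log(1/(\eta_1\gamma))}\,\big(\frac{n\tau}{\gamma}\big)^{C\ell}$ with $D$ depending only on $\ell$, $c$ and $d$, that is, $n^{O_{\ell}(R^2\log(1/(\eta\gamma)))}\,(n\tau/\gamma)^{O(\ell)}$ for $\eta\le 1$. The running time is the number of steps of a random access machine with unit-cost addition and (truncated) subtraction of natural numbers, indirect addressing, and an instruction that draws a fresh document at cost $\ell+1$. The output is given as rational numbers with a common denominator. -/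

import Mathlib

open MeasureTheory

/-! ### Robust Kruskal rank -/

/-- The `k`-th largest singular value of a real matrix (`k = 1, 2, …`), i.e. of the linear map
between Euclidean spaces that it represents. -/
noncomputable def sigmaK {m ι : Type*} [Fintype m] [Fintype ι] [DecidableEq ι]
    (A : Matrix m ι ℝ) (k : ℕ) : ℝ :=
  (Matrix.toEuclideanLin A).singularValues (k - 1)

/-- The `τ`-robust Kruskal rank of an `n × R` matrix: the largest `k ≤ R` such that every submatrix
formed by `k` of its columns has `k`-th largest singular value at least `1 / τ`
(and `0` if there is no `k ≥ 1` with this property). -/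
noncomputable def robustKruskalRank {n R : ℕ} (τ : ℝ) (A : Matrix (Fin n) (Fin R) ℝ) : ℕ :=
  sSup {k : ℕ | k ≤ R ∧ ∀ S : Finset (Fin R), S.card = k →
    1 / τ ≤ sigmaK (A.submatrix id (fun j : S => (j : Fin R))) k}

/-! ### The exchangeable single-topic model -/

/-- A topic model with `R` topics over a dictionary of `n` words: a distribution on topics, and
for every topic a distribution on words. -/
structure TopicModel (n R : ℕ) where
  topic : PMF (Fin R)
  word : Fin R → PMF (Fin n)

namespace TopicModel

variable {n R : ℕ}

/-- The probability `w r` of topic `r`. -/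
noncomputable def weight (𝓜 : TopicModel n R) (r : Fin R) : ℝ := (𝓜.topic r).toReal

/-- The `n × R` matrix whose column `r` is the word distribution of topic `r`. -/
noncomputable def wordMatrix (𝓜 : TopicModel n R) : Matrix (Fin n) (Fin R) ℝ :=
  Matrix.of fun i r => (𝓜.word r i).toReal

/-- The law of a document of `ℓ` words: draw a topic `r`, then `ℓ` words independently from the
word distribution of `r`. -/
noncomputable def documentLaw (𝓜 : TopicModel n R) (ℓ : ℕ) : Measure (Fin ℓ → Fin n) :=
  ∑ r : Fin R, 𝓜.topic r • Measure.pi fun _ : Fin ℓ => (𝓜.word r).toMeasure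

instance (𝓜 : TopicModel n R) (ℓ : ℕ) : IsProbabilityMeasure (𝓜.documentLaw ℓ) := by
  refine ⟨?_⟩
  have h := 𝓜.topic.tsum_coe
  rw [tsum_fintype] at h
  simp [documentLaw, h]

/-- The law of an infinite sequence of independent documents of `ℓ` words. -/
noncomputable def corpusLaw (𝓜 : TopicModel n R) (ℓ : ℕ) : Measure (ℕ → Fin ℓ → Fin n) :=
  Measure.infinitePi fun _ : ℕ => 𝓜.documentLaw ℓ

end TopicModel

/-! ### Algorithms: a random access machine with access to documents -/

/-- Programs of a random access machine with cells `0, 1, 2, …`, each holding a natural number,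
written as structured programs. The arithmetic is that of the classical uniform-cost machine:
addition and truncated subtraction at unit cost, and indirect addressing. -/
inductive RAMProgram : Type
  /-- `cell i := c` -/
  | const (i c : ℕ)
  /-- `cell i := cell j + cell k` -/
  | add (i j k : ℕ)
  /-- `cell i := cell j - cell k` (zero if negative) -/
  | sub (i j k : ℕ)
  /-- `cell i := cell (cell j)` -/
  | load (i j : ℕ)
  /-- `cell (cell i) := cell j` -/
  | store (i j : ℕ)
  /-- draw a fresh document and write its words to the cells `cell i`, `cell i + 1`, … -/
  | sample (i : ℕ)
  /-- first `p`, then `q` -/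
  | seq (p q : RAMProgram)
  /-- `p` if `cell i ≠ 0`, else `q` -/
  | cond (i : ℕ) (p q : RAMProgram)
  /-- repeat `p` as long as `cell i ≠ 0` -/
  | loop (i : ℕ) (p : RAMProgram)

/-- A state of the machine: the contents of the cells, and the number of documents drawn. -/
structure RAMState where
  mem : ℕ → ℕ
  drawn : ℕ

namespace RAMState

/-- Overwrite the cell `a` with `v`. -/
def write (s : RAMState) (a v : ℕ) : RAMState :=
  { s with mem := Function.update s.mem a v }

/-- Draw the next document of the corpus `X` and write its words to the cells `a`, `a + 1`, …. -/
def draw {ℓ n : ℕ} (X : ℕ → Fin ℓ → Fin n) (s : RAMState) (a : ℕ) : RAMState where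
  mem := fun b => if h : a ≤ b ∧ b - a < ℓ then (X s.drawn ⟨b - a, h.2⟩ : ℕ) else s.mem b
  drawn := s.drawn + 1

end RAMState

/-- `Exec X p s t s'`: with the corpus `X` as the sequence of documents, the program `p` started in
state `s` halts after `t` steps in state `s'`. Drawing a document of `ℓ` words takes `ℓ + 1` steps;
every other instruction and every test takes one step. -/
inductive RAMProgram.Exec {ℓ n : ℕ} (X : ℕ → Fin ℓ → Fin n) :
    RAMProgram → RAMState → ℕ → RAMState → Prop
  | const (i c : ℕ) (s : RAMState) : Exec X (.const i c) s 1 (s.write i c)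
  | add (i j k : ℕ) (s : RAMState) :
      Exec X (.add i j k) s 1 (s.write i (s.mem j + s.mem k))
  | sub (i j k : ℕ) (s : RAMState) :
      Exec X (.sub i j k) s 1 (s.write i (s.mem j - s.mem k))
  | load (i j : ℕ) (s : RAMState) :
      Exec X (.load i j) s 1 (s.write i (s.mem (s.mem j)))
  | store (i j : ℕ) (s : RAMState) :
      Exec X (.store i j) s 1 (s.write (s.mem i) (s.mem j))
  | sample (i : ℕ) (s : RAMState) :
      Exec X (.sample i) s (ℓ + 1) (s.draw X (s.mem i))
  | seq {p q : RAMProgram} {s s' s'' : RAMState} {t t' : ℕ} :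
      Exec X p s t s' → Exec X q s' t' s'' → Exec X (.seq p q) s (t + t') s''
  | cond_true {i : ℕ} {p q : RAMProgram} {s s' : RAMState} {t : ℕ} :
      s.mem i ≠ 0 → Exec X p s t s' → Exec X (.cond i p q) s (t + 1) s'
  | cond_false {i : ℕ} {p q : RAMProgram} {s s' : RAMState} {t : ℕ} :
      s.mem i = 0 → Exec X q s t s' → Exec X (.cond i p q) s (t + 1) s'
  | loop_done {i : ℕ} {p : RAMProgram} {s : RAMState} :
      s.mem i = 0 → Exec X (.loop i p) s 1 s
  | loop_step {i : ℕ} {p : RAMProgram} {s s' s'' : RAMState} {t t' : ℕ} :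
      s.mem i ≠ 0 → Exec X p s t s' → Exec X (.loop i p) s' t' s'' →
      Exec X (.loop i p) s (t + t' + 1) s''

namespace RAMState

/-- The initial state: the cells `0, …, 4` hold the dictionary size `n`, the number `R` of topics,
and the accuracy `η`, the weight bound `γ` and the parameter `τ` in the form of the integers
`⌈1/η⌉`, `⌈1/γ⌉`, `⌈τ⌉`; all other cells are zero, and no document has been drawn. -/
noncomputable def input (n R : ℕ) (η γ τ : ℝ) : RAMState where
  mem := fun a =>
    if a = 0 then n else if a = 1 then R else if a = 2 then ⌈1 / η⌉₊
    else if a = 3 then ⌈1 / γ⌉₊ else if a = 4 then ⌈τ⌉₊ else 0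
  drawn := 0

/-- The word matrix that a final state represents: cell `0` holds a common denominator, the next
`n * R` cells the numerators of the entries, row by row. -/
noncomputable def outMatrix (n R : ℕ) (s : RAMState) : Matrix (Fin n) (Fin R) ℝ :=
  Matrix.of fun i r => (s.mem (1 + i * R + r) : ℝ) / (s.mem 0 : ℝ)

/-- The topic weights that a final state represents: the numerators are in the `R` cells after those
of the matrix. -/
noncomputable def outWeight (n R : ℕ) (s : RAMState) (r : Fin R) : ℝ :=
  (s.mem (1 + n * R + r) : ℝ) / (s.mem 0 : ℝ)

end RAMState

open scoped Matrix.Norms.Frobenius in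
/-- The matrix `M'` and the weights `w'` are within `η` of the parameters of the model, up to a
renaming `π` of the topics: `M` and the renamed `M'` in Frobenius norm, and each weight. -/
def TopicModel.RecoveredBy {n R : ℕ} (𝓜 : TopicModel n R) (η : ℝ)
    (M' : Matrix (Fin n) (Fin R) ℝ) (w' : Fin R → ℝ) : Prop :=
  ∃ π : Equiv.Perm (Fin R),
    ‖𝓜.wordMatrix - M'.submatrix id π‖ ≤ η ∧ ∀ r : Fin R, |𝓜.weight r - w' (π r)| < η

/-- Every coefficient of a linear combination of at most `k` of the vectors `u i` is bounded by `κ`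
times the norm of the combination. -/
def RobustIndep {ι E : Type*} [NormedAddCommGroup E] [InnerProductSpace ℝ E] (κ : ℝ) (k : ℕ)
    (u : ι → E) : Prop :=
  ∀ S : Finset ι, S.card ≤ k → ∀ c : ι → ℝ, ∀ i ∈ S, |c i| ≤ κ * ‖∑ j ∈ S, c j • u j‖

/-- The product of the linear forms `⟨x, ·⟩` for `x` in the list `l`. -/
noncomputable def formProd {E : Type*} [NormedAddCommGroup E] [InnerProductSpace ℝ E]
    (l : List E) (v : E) : ℝ := (l.map fun x => inner ℝ x v).prod

section Kruskal

variable {ι E : Type*} [NormedAddCommGroup E] [InnerProductSpace ℝ E]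

lemma formProd_append (l l' : List E) (v : E) :
    formProd (l ++ l') v = formProd l v * formProd l' v := by
  simp [formProd]

lemma formProd_cons (x : E) (l : List E) (v : E) :
    formProd (x :: l) v = inner ℝ x v * formProd l v := by
  simp [formProd]

lemma norm_prod_nonneg (l : List E) : 0 ≤ (l.map norm).prod :=
  List.prod_nonneg (by simp only [List.mem_map]; rintro _ ⟨x, -, rfl⟩; exact norm_nonneg x)

lemma norm_prod_le_pow {l : List E} {κ : ℝ} (h : ∀ x ∈ l, ‖x‖ ≤ κ) :
    (l.map norm).prod ≤ κ ^ l.length := by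
  induction l with
  | nil => simp
  | cons x l ih =>
    simp only [List.map_cons, List.prod_cons, List.length_cons, pow_succ']
    have h1 := h x (by simp)
    exact mul_le_mul h1 (ih fun y hy => h y (by simp [hy]))
      (norm_prod_nonneg l) ((norm_nonneg x).trans h1)

lemma exists_sum_smul_eq_of_mem_span {u : ι → E} {S : Finset ι} {x : E}
    (hx : x ∈ Submodule.span ℝ (u '' (S : Set ι))) : ∃ c : ι → ℝ, ∑ j ∈ S, c j • u j = x := by
  classical
  obtain ⟨c, hc⟩ := (Submodule.mem_span_image_finset_iff_exists_fun ℝ).1 hx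
  refine ⟨fun j => if h : j ∈ S then c ⟨j, h⟩ else 0, ?_⟩
  rw [← hc, ← Finset.sum_coe_sort S]
  exact Finset.sum_congr rfl fun j _ => by simp

namespace RobustIndep

lemma mono {κ κ' : ℝ} {k k' : ℕ} {u : ι → E} (h : RobustIndep κ k u) (hκ : κ ≤ κ') (hk : k' ≤ k) :
    RobustIndep κ' k' u := fun S hS c i hi =>
  (h S (hS.trans hk) c i hi).trans (mul_le_mul_of_nonneg_right hκ (norm_nonneg _))

variable [DecidableEq ι]

/-- A dual vector that separates `u i` from the other vectors of a small set. -/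
lemma exists_dual {κ : ℝ} {k : ℕ} {u : ι → E} (h : RobustIndep κ k u) {S : Finset ι}
    (hS : S.card ≤ k) {i : ι} (hi : i ∈ S) :
    ∃ x : E, ‖x‖ ≤ κ ∧ inner ℝ x (u i) = (1 : ℝ) ∧
      ∀ j ∈ S, j ≠ i → inner ℝ x (u j) = (0 : ℝ) := by
  classical
  set K : Submodule ℝ E := Submodule.span ℝ (u '' (S.erase i : Finset ι)) with hK
  have : FiniteDimensional ℝ K :=
    FiniteDimensional.span_of_finite ℝ ((Finset.finite_toSet _).image u)
  set y : E := u i - K.starProjection (u i) with hy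
  have hmem : K.starProjection (u i) ∈ K := Submodule.starProjection_apply_mem K (u i)
  obtain ⟨c, hc⟩ := exists_sum_smul_eq_of_mem_span hmem
  have hyo : y ∈ Kᗮ := Submodule.sub_starProjection_mem_orthogonal (u i)
  have h1 : 1 ≤ κ * ‖y‖ := by
    have := h S hS (fun j => if j = i then 1 else - c j) i hi
    simp only [if_true, abs_one] at this
    convert this using 3
    rw [← Finset.add_sum_erase S _ hi]
    simp only [if_true, one_smul, hy, ← hc, sub_eq_add_neg]
    rw [← Finset.sum_neg_distrib]
    congr 1
    refine Finset.sum_congr rfl fun j hj => ?_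
    rw [if_neg (Finset.ne_of_mem_erase hj), neg_smul]
  have hy0 : 0 < ‖y‖ := by
    rcases (norm_nonneg y).lt_or_eq with h0 | h0
    · exact h0
    · rw [← h0] at h1; norm_num at h1
  have hyi : inner ℝ y (u i) = ‖y‖ ^ 2 := by
    have : u i = y + K.starProjection (u i) := by rw [hy]; abel
    conv_lhs => rw [this]
    rw [inner_add_right, real_inner_self_eq_norm_sq,
      Submodule.inner_left_of_mem_orthogonal hmem hyo, add_zero]
  refine ⟨(‖y‖ ^ 2)⁻¹ • y, ?_, ?_, ?_⟩
  · rw [norm_smul, norm_inv, norm_pow, norm_norm]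
    have : (‖y‖ ^ 2)⁻¹ * ‖y‖ = 1 / ‖y‖ := by field_simp
    rw [this, div_le_iff₀ hy0]; exact h1
  · rw [real_inner_smul_left, hyi, inv_mul_cancel₀ (by positivity)]
  · intro j hj hji
    rw [real_inner_smul_left, Submodule.inner_left_of_mem_orthogonal _ hyo, mul_zero]
    exact Submodule.subset_span ⟨j, by simp [hj, hji], rfl⟩

/-- A product of `a` linear forms that separates `u i` from up to `a * (k - 1)` other vectors. -/
lemma exists_forms {κ : ℝ} {k : ℕ} {u : ι → E} (h : RobustIndep κ k u) (hk : 1 ≤ k) {i : ι} (a : ℕ) :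
    ∀ S : Finset ι, i ∈ S → S.card ≤ a * (k - 1) + 1 →
    ∃ l : List E, l.length = a ∧ (∀ x ∈ l, ‖x‖ ≤ κ) ∧ formProd l (u i) = 1 ∧
      ∀ j ∈ S, j ≠ i → formProd l (u j) = 0 := by
  induction a with
  | zero =>
    intro S hi hS
    refine ⟨[], rfl, by simp, by simp [formProd], fun j hj hji => ?_⟩
    exact absurd (Finset.card_le_one.1 (by simpa using hS) j hj i hi) hji
  | succ a ih =>
    intro S hi hS
    have hcard := Finset.card_erase_of_mem hi
    obtain ⟨A, hAS, hA⟩ := Finset.exists_subset_card_eq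
      (s := S.erase i) (n := min (k - 1) (S.card - 1)) (by rw [hcard]; exact min_le_right _ _)
    have hiA : i ∉ A := fun hh => by simpa using hAS hh
    have hSc : 1 ≤ S.card := Finset.card_pos.2 ⟨i, hi⟩
    obtain ⟨x, hx1, hx2, hx3⟩ := h.exists_dual (S := insert i A)
      (by rw [Finset.card_insert_of_notMem hiA]; omega) (Finset.mem_insert_self i A)
    obtain ⟨l, hl1, hl2, hl3, hl4⟩ := ih (S \ A) (by simp [hi, hiA]) (by
      rw [Finset.card_sdiff_of_subset (hAS.trans (Finset.erase_subset _ _)), hA]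
      have : (a + 1) * (k - 1) = a * (k - 1) + (k - 1) := by ring
      rw [this] at hS
      omega)
    refine ⟨x :: l, by simp [hl1], by simpa using ⟨hx1, hl2⟩, by rw [formProd_cons, hx2, hl3, one_mul],
      fun j hj hji => ?_⟩
    rw [formProd_cons]
    by_cases hjA : j ∈ A
    · rw [hx3 j (by simp [hjA]) hji, zero_mul]
    · rw [hl4 j (by simp [hj, hjA]) hji, mul_zero]

end RobustIndep

/-- If two weighted sums of powers are close as symmetric tensors and `x` annihilates `k - 1`
vectors of the second family, then `⟨x, ·⟩` is small on at least `k - 1` vectors of the first. -/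
lemma card_large_inner_le [Fintype ι] [DecidableEq ι] {u v : ι → E} {w w' : ι → ℝ} {κ γ δ : ℝ}
    {k ℓ : ℕ} (hu : RobustIndep κ k u) (hκ : 0 ≤ κ) (hγ : 0 < γ) (hw : ∀ r, γ ≤ w r) (hδ : 0 ≤ δ)
    (hclose : ∀ l : List E, l.length = ℓ →
      |∑ r, w r * formProd l (u r) - ∑ s, w' s * formProd l (v s)| ≤ δ * (l.map norm).prod)
    (hk : 2 ≤ k) (hkR : k ≤ Fintype.card ι) (hℓ : 2 * Fintype.card ι ≤ ℓ * (k - 1))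
    {S : Finset ι} (hS : S.card = k - 1) {x : E} (hx : ‖x‖ ≤ 1)
    (hx0 : ∀ s ∈ S, inner ℝ x (v s) = (0 : ℝ)) :
    (Finset.univ.filter fun r => Fintype.card ι * δ * κ ^ (ℓ - 1) / γ < |inner ℝ x (u r)|).card
      ≤ Fintype.card ι - k + 1 := by
  by_contra! hcon
  set R := Fintype.card ι with hR
  obtain ⟨J, hJsub, hJ⟩ := Finset.exists_subset_card_eq (n := R - k + 2) (Nat.succ_le_of_lt hcon)
  obtain ⟨m, rfl⟩ : ∃ m, k = m + 1 := ⟨k - 1, by omega⟩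
  simp only [Nat.add_sub_cancel] at hℓ hS
  have hℓ2 : 2 < ℓ := by
    by_contra! hh
    have : ℓ * m ≤ 2 * m := Nat.mul_le_mul_right m hh
    omega
  set a := (ℓ - 1) / 2 with ha
  set b := ℓ - 1 - a with hb
  have ha1 : R ≤ (a + 1) * m := by
    have : ℓ * m ≤ (2 * (a + 1)) * m := Nat.mul_le_mul_right m (by omega)
    have h2 : (2 * (a + 1)) * m = 2 * ((a + 1) * m) := by ring
    omega
  have hb1 : (a + 1) * m ≤ (b + 1) * m := Nat.mul_le_mul_right m (by omega)
  have hab : (a + b + 1) * m = ℓ * m := by congr 1; omega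
  have e1 : (a + 1) * m = a * m + m := by ring
  have e2 : (b + 1) * m = b * m + m := by ring
  have e3 : (a + b + 1) * m = a * m + b * m + m := by ring
  -- split the remaining indices among the two blocks of forms
  have hJc : (Finset.univ \ J).card = m - 1 := by
    rw [Finset.card_sdiff_of_subset (Finset.subset_univ J), Finset.card_univ, hJ]; omega
  obtain ⟨A, hA, hAc⟩ := Finset.exists_subset_card_eq (s := Finset.univ \ J)
    (n := min (m - 1) (a * m + 1 - J.card)) (by rw [hJc]; exact min_le_left _ _)
  have hAJ : Disjoint J A := Finset.disjoint_left.2 fun j hj hjA => by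
    have := hA hjA; simp [hj] at this
  have hZ1 : (J ∪ A).card ≤ a * m + 1 := by
    rw [Finset.card_union_of_disjoint hAJ, hAc, hJ]; omega
  have hZ2 : (Finset.univ \ A).card ≤ b * m + 1 := by
    rw [Finset.card_sdiff_of_subset (Finset.subset_univ A), Finset.card_univ, hAc, hJ]; omega
  have hP : ∀ i : J, ∃ l : List E, l.length = a ∧ (∀ x ∈ l, ‖x‖ ≤ κ) ∧ formProd l (u i) = 1 ∧
      ∀ j ∈ J ∪ A, j ≠ i → formProd l (u j) = 0 := fun i =>
    hu.exists_forms (by omega) a _ (Finset.mem_union_left _ i.2) (by simpa using hZ1)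
  have hQ : ∀ i : J, ∃ l : List E, l.length = b ∧ (∀ x ∈ l, ‖x‖ ≤ κ) ∧ formProd l (u i) = 1 ∧
      ∀ j ∈ Finset.univ \ A, j ≠ i → formProd l (u j) = 0 := fun i =>
    hu.exists_forms (by omega) b _
      (by simpa using Finset.disjoint_left.1 hAJ i.2) (by simpa using hZ2)
  choose P hP1 hP2 hP3 hP4 using hP
  choose Q hQ1 hQ2 hQ3 hQ4 using hQ
  -- the matrix of the first tensor is diagonal
  have hdiag : ∀ i j : J, ∑ r, w r * formProd (x :: (P i ++ Q j)) (u r)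
      = if i = j then w i * inner ℝ x (u i) else 0 := by
    intro i j
    have hz : ∀ r : ι, r ≠ (i : ι) → w r * formProd (x :: (P i ++ Q j)) (u r) = 0 := by
      intro r hr
      rw [formProd_cons, formProd_append]
      by_cases hrZ : r ∈ J ∪ A
      · rw [hP4 i r hrZ hr]; ring
      · rw [hQ4 j r (by simp at hrZ ⊢; exact hrZ.2) (fun hh => hrZ (by simp [hh]))]; ring
    rw [Finset.sum_eq_single (i : ι) (fun r _ hr => hz r hr) (by simp)]
    rw [formProd_cons, formProd_append, hP3]
    split_ifs with hij
    · rw [hij, hQ3]; ring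
    · rw [hQ4 j i (by simpa using Finset.disjoint_left.1 hAJ i.2) (fun hh => hij (Subtype.ext hh))]
      ring
  -- a kernel vector of the matrix of the second tensor
  let Φ : (J → ℝ) →ₗ[ℝ] ({s // s ∉ S} → ℝ) :=
    Matrix.mulVecLin (Matrix.of fun (s : {s // s ∉ S}) (j : J) => formProd (Q j) (v s))
  have hker : Φ.ker ≠ ⊥ := by
    apply LinearMap.ker_ne_bot_of_finrank_lt
    rw [Module.finrank_fintype_fun_eq_card, Module.finrank_fintype_fun_eq_card,
      Fintype.card_coe, hJ, Fintype.card_subtype_compl, Fintype.card_coe, hS]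
    omega
  obtain ⟨c, hcker, hc0⟩ := Submodule.exists_mem_ne_zero_of_ne_bot hker
  have hcz : ∀ s, s ∉ S → ∑ j : J, formProd (Q j) (v s) * c j = 0 := fun s hs =>
    congrFun (LinearMap.mem_ker.1 hcker) ⟨s, hs⟩
  have hJne : (Finset.univ : Finset J).Nonempty := by
    rw [← Finset.card_pos, Finset.card_univ, Fintype.card_coe, hJ]; omega
  obtain ⟨i, -, hi⟩ := Finset.exists_max_image Finset.univ (fun j : J => |c j|) hJne
  have hci : 0 < |c i| := by
    by_contra! hh
    exact hc0 (funext fun j => abs_nonpos_iff.1 ((hi j (Finset.mem_univ j)).trans hh))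
  have hsecond : ∑ j : J, c j * ∑ s, w' s * formProd (x :: (P i ++ Q j)) (v s) = 0 := by
    simp only [Finset.mul_sum]
    rw [Finset.sum_comm]
    refine Finset.sum_eq_zero fun s _ => ?_
    by_cases hs : s ∈ S
    · simp [formProd_cons, hx0 s hs]
    · have : ∀ j : J, c j * (w' s * formProd (x :: (P i ++ Q j)) (v s))
          = (w' s * inner ℝ x (v s) * formProd (P i) (v s)) * (formProd (Q j) (v s) * c j) := by
        intro j; rw [formProd_cons, formProd_append]; ring
      simp only [this]
      rw [← Finset.mul_sum, hcz s hs, mul_zero]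
  have hfirst : ∑ j : J, c j * ∑ r, w r * formProd (x :: (P i ++ Q j)) (u r)
      = c i * (w i * inner ℝ x (u i)) := by
    simp only [hdiag]
    rw [Finset.sum_eq_single i (fun j _ hj => by simp [Ne.symm hj]) (by simp)]
    simp
  have hbound : |c i| * (w i * |inner ℝ x (u i)|) ≤ |c i| * (R * δ * κ ^ (ℓ - 1)) := by
    have hwi : 0 < w i := hγ.trans_le (hw i)
    calc |c i| * (w i * |inner ℝ x (u i)|)
        = |∑ j : J, c j * (∑ r, w r * formProd (x :: (P i ++ Q j)) (u r)
            - ∑ s, w' s * formProd (x :: (P i ++ Q j)) (v s))| := by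
          simp only [mul_sub, Finset.sum_sub_distrib]
          rw [hfirst, hsecond, sub_zero, abs_mul, abs_mul, abs_of_pos hwi]
      _ ≤ ∑ j : J, |c i| * (δ * κ ^ (ℓ - 1)) := by
          refine (Finset.abs_sum_le_sum_abs _ _).trans (Finset.sum_le_sum fun j _ => ?_)
          rw [abs_mul]
          refine mul_le_mul (hi j (Finset.mem_univ j)) ?_ (abs_nonneg _) (abs_nonneg _)
          refine (hclose _ (by simp [hP1, hQ1]; omega)).trans (mul_le_mul_of_nonneg_left ?_ hδ)
          rw [List.map_cons, List.prod_cons]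
          refine (mul_le_of_le_one_left (norm_prod_nonneg _) hx).trans ?_
          refine (norm_prod_le_pow (κ := κ) ?_).trans (le_of_eq ?_)
          · intro y hy
            rcases List.mem_append.1 hy with hy | hy
            · exact hP2 i y hy
            · exact hQ2 j y hy
          · rw [List.length_append, hP1, hQ1]; congr 1; omega
      _ = (J.card : ℝ) * (|c i| * (δ * κ ^ (ℓ - 1))) := by simp
      _ ≤ R * (|c i| * (δ * κ ^ (ℓ - 1))) := by
          refine mul_le_mul_of_nonneg_right ?_ (by positivity)
          exact_mod_cast Finset.card_le_univ J
      _ = _ := by ring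
  have hlt := (Finset.mem_filter.1 (hJsub i.2)).2
  rw [div_lt_iff₀ hγ] at hlt
  have h3 := le_of_mul_le_mul_left hbound hci
  have h4 : γ * |inner ℝ x (u i)| ≤ w i * |inner ℝ x (u i)| :=
    mul_le_mul_of_nonneg_right (hw i) (abs_nonneg _)
  linarith [mul_comm γ |inner ℝ x (u i)|]

end Kruskal

section Permutation

variable {ι E : Type*} [NormedAddCommGroup E] [InnerProductSpace ℝ E]

lemma card_fun_eq_off_le [Fintype ι] [DecidableEq ι] {N : ℕ} (r : ι) (B : Finset (ι → Fin N))
    (hB : ∀ α ∈ B, ∀ β ∈ B, (∀ s, s ≠ r → α s = β s) → α = β) :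
    B.card ≤ N ^ (Fintype.card ι - 1) := by
  have h := Finset.card_le_card_of_injOn (s := B) (t := Finset.univ)
    (fun (α : ι → Fin N) (s : {s // s ≠ r}) => α s) (fun _ _ => Finset.mem_coe.2 (Finset.mem_univ _))
    (fun α hα β hβ h => hB α hα β hβ fun s hs => congrFun h ⟨s, hs⟩)
  refine h.trans (le_of_eq ?_)
  rw [Finset.card_univ, Fintype.card_fun, Fintype.card_fin, Fintype.card_subtype_compl,
    Fintype.card_subtype_eq]

/-- Some combination of the vectors `g r` has a large inner product with each of them. -/
lemma exists_inner_large [Fintype ι] (g : ι → E) :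
    ∃ α : ι → ℝ, ‖∑ s, α s • g s‖ ≤ (Fintype.card ι : ℝ) ^ 2 ∧
      ∀ r, ‖g r‖ / 2 ≤ |inner ℝ (∑ s, α s • g s) (g r)| := by
  classical
  set R := Fintype.card ι with hR
  let x : (ι → Fin (R + 1)) → E := fun α => ∑ s, (((α s : ℕ) : ℝ) * ‖g s‖⁻¹) • g s
  have hx : ∀ α, ‖x α‖ ≤ (R : ℝ) ^ 2 := by
    intro α
    calc ‖x α‖ ≤ ∑ s : ι, (R : ℝ) := by
          refine (norm_sum_le _ _).trans (Finset.sum_le_sum fun s _ => ?_)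
          rw [norm_smul, norm_mul, norm_inv, norm_norm, Real.norm_natCast, mul_assoc]
          have h1 : ‖g s‖⁻¹ * ‖g s‖ ≤ 1 := inv_mul_le_one
          have h2 : ((α s : ℕ) : ℝ) ≤ R := by exact_mod_cast Nat.lt_succ_iff.1 (α s).2
          calc ((α s : ℕ) : ℝ) * (‖g s‖⁻¹ * ‖g s‖) ≤ ((α s : ℕ) : ℝ) * 1 :=
                mul_le_mul_of_nonneg_left h1 (by positivity)
            _ ≤ R := by linarith
      _ = (R : ℝ) ^ 2 := by simp [hR, sq]
  by_contra! hcon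
  have hbad : ∀ α : ι → Fin (R + 1), ∃ r, |inner ℝ (x α) (g r)| < ‖g r‖ / 2 := fun α =>
    hcon (fun s => ((α s : ℕ) : ℝ) * ‖g s‖⁻¹) (hx α)
  let B : ι → Finset (ι → Fin (R + 1)) := fun r =>
    Finset.univ.filter fun α => |inner ℝ (x α) (g r)| < ‖g r‖ / 2
  have hB : ∀ r, (B r).card ≤ (R + 1) ^ (R - 1) := by
    intro r
    refine card_fun_eq_off_le r _ fun α hα β hβ hαβ => ?_
    have h1 := (Finset.mem_filter.1 hα).2
    have h2 := (Finset.mem_filter.1 hβ).2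
    have hg : 0 < ‖g r‖ := by
      by_contra! hh
      linarith [abs_nonneg (inner ℝ (x α) (g r))]
    have hd : inner ℝ (x α) (g r) - inner ℝ (x β) (g r)
        = (((α r : ℕ) : ℝ) - ((β r : ℕ) : ℝ)) * ‖g r‖ := by
      rw [← inner_sub_left, ← Finset.sum_sub_distrib, Finset.sum_eq_single r]
      · rw [← sub_smul, real_inner_smul_left, real_inner_self_eq_norm_sq]
        field_simp
      · intro s _ hs; simp [hαβ s hs]
      · simp
    have h3 : |((α r : ℕ) : ℝ) - ((β r : ℕ) : ℝ)| * ‖g r‖ < 1 * ‖g r‖ := by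
      rw [← abs_of_pos hg, ← abs_mul, abs_of_pos hg, ← hd, one_mul]
      exact (abs_sub _ _).trans_lt (by linarith)
    have h4 := lt_of_mul_lt_mul_right h3 hg.le
    have h5 : (α r : ℕ) = (β r : ℕ) := by
      have : |((α r : ℕ) : ℤ) - ((β r : ℕ) : ℤ)| < 1 := by exact_mod_cast h4
      have := Int.abs_lt_one_iff.1 this
      omega
    funext s
    by_cases hs : s = r
    · rw [hs]; exact Fin.ext h5
    · exact hαβ s hs
  have hcover : (Finset.univ : Finset (ι → Fin (R + 1))) ⊆ Finset.univ.biUnion B := by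
    intro α _
    obtain ⟨r, hr⟩ := hbad α
    simp only [Finset.mem_biUnion, Finset.mem_univ, true_and]
    exact ⟨r, Finset.mem_filter.2 ⟨Finset.mem_univ _, hr⟩⟩
  have h1 := (Finset.card_le_card hcover).trans
    (Finset.card_biUnion_le_card_mul _ _ _ fun r _ => hB r)
  rw [Finset.card_univ, Fintype.card_fun, Fintype.card_fin, Finset.card_univ, ← hR] at h1
  rcases Nat.eq_zero_or_pos R with h0 | h0
  · rw [h0] at h1; simp at h1
  · obtain ⟨Q, hQ⟩ : ∃ Q, R = Q + 1 := ⟨R - 1, by omega⟩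
    rw [hQ, Nat.add_sub_cancel, pow_succ'] at h1
    have := Nat.le_of_mul_le_mul_right h1 (by positivity)
    omega

variable [Fintype ι]

/-- `y` is within `δ` of a linear combination of the `v s`, `s ∈ S`. -/
def NearSpan (v : ι → E) (δ : ℝ) (S : Finset ι) (y : E) : Prop :=
  ∃ c : ι → ℝ, (∀ j, j ∉ S → c j = 0) ∧ ‖y - ∑ j, c j • v j‖ ≤ δ

lemma NearSpan.mono {v : ι → E} {δ δ' : ℝ} {S : Finset ι} {y : E} (h : NearSpan v δ S y)
    (hδ : δ ≤ δ') : NearSpan v δ' S y := by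
  obtain ⟨c, h1, h2⟩ := h
  exact ⟨c, h1, h2.trans hδ⟩

lemma RobustIndep.abs_le {κ : ℝ} {k : ℕ} {v : ι → E} (h : RobustIndep κ k v) (hκ : 0 ≤ κ)
    {S : Finset ι} (hS : S.card ≤ k) {c : ι → ℝ} (hc : ∀ j, j ∉ S → c j = 0) (i : ι) :
    |c i| ≤ κ * ‖∑ j, c j • v j‖ := by
  have hs : ∑ j, c j • v j = ∑ j ∈ S, c j • v j :=
    (Finset.sum_subset (Finset.subset_univ S) fun j _ hj => by rw [hc j hj, zero_smul]).symm
  by_cases hi : i ∈ S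
  · rw [hs]; exact h S hS c i hi
  · rw [hc i hi, abs_zero]; positivity

lemma RobustIndep.abs_sub_le {κ : ℝ} {k : ℕ} {v : ι → E} (h : RobustIndep κ k v) (hκ : 0 ≤ κ)
    {S : Finset ι} (hS : S.card ≤ k) {c c' : ι → ℝ} (hc : ∀ j, j ∉ S → c j = 0)
    (hc' : ∀ j, j ∉ S → c' j = 0) {y : E} {δ δ' : ℝ} (hδ : ‖y - ∑ j, c j • v j‖ ≤ δ)
    (hδ' : ‖y - ∑ j, c' j • v j‖ ≤ δ') (i : ι) : |c i - c' i| ≤ κ * (δ + δ') := by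
  refine (h.abs_le hκ hS (c := fun j => c j - c' j)
    (fun j hj => by rw [hc j hj, hc' j hj, sub_zero]) i).trans (mul_le_mul_of_nonneg_left ?_ hκ)
  have : ∑ j, (c j - c' j) • v j
      = (y - ∑ j, c' j • v j) - (y - ∑ j, c j • v j) := by
    simp only [sub_smul, Finset.sum_sub_distrib]; abel
  rw [this]
  exact (norm_sub_le _ _).trans (by linarith)

lemma card_not_nearSpan_le {u v : ι → E} {S : Finset ι} {δ : ℝ} {q : ℕ} [Nonempty ι]
    (h : ∀ x : E, ‖x‖ ≤ 1 → (∀ s ∈ S, inner ℝ x (v s) = (0 : ℝ)) →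
      (Finset.univ.filter fun r => δ < |inner ℝ x (u r)|).card ≤ q)
    [DecidablePred fun r => ¬ NearSpan v (2 * (Fintype.card ι : ℝ) ^ 2 * δ) S (u r)] :
    (Finset.univ.filter fun r => ¬ NearSpan v (2 * (Fintype.card ι : ℝ) ^ 2 * δ) S (u r)).card
      ≤ q := by
  classical
  set K : Submodule ℝ E := Submodule.span ℝ (v '' (S : Set ι)) with hK
  have : FiniteDimensional ℝ K :=
    FiniteDimensional.span_of_finite ℝ ((Finset.finite_toSet _).image v)
  let g : ι → E := fun r => u r - K.starProjection (u r)
  have hg : ∀ r, g r ∈ Kᗮ := fun r => Submodule.sub_starProjection_mem_orthogonal (u r)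
  obtain ⟨α, hα1, hα2⟩ := exists_inner_large g
  set x := ∑ s, α s • g s with hx
  have hxK : x ∈ Kᗮ := Submodule.sum_mem _ fun s _ => Submodule.smul_mem _ _ (hg s)
  have hR : (0 : ℝ) < (Fintype.card ι : ℝ) ^ 2 := by
    have : 0 < Fintype.card ι := Fintype.card_pos
    positivity
  refine (Finset.card_le_card ?_).trans (h (((Fintype.card ι : ℝ) ^ 2)⁻¹ • x) ?_ ?_)
  · intro r hr
    have hr := (Finset.mem_filter.1 hr).2
    refine Finset.mem_filter.2 ⟨Finset.mem_univ r, ?_⟩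
    have hgr : 2 * (Fintype.card ι : ℝ) ^ 2 * δ < ‖g r‖ := by
      by_contra! hh
      obtain ⟨c, hc⟩ := exists_sum_smul_eq_of_mem_span (Submodule.starProjection_apply_mem K (u r))
      refine hr ⟨fun j => if j ∈ S then c j else 0, fun j hj => by simp [hj], ?_⟩
      simpa [ite_smul, Finset.sum_ite_mem, hc, g] using hh
    have hin : inner ℝ x (u r) = (inner ℝ x (g r) : ℝ) := by
      have : u r = g r + K.starProjection (u r) := by simp [g]
      conv_lhs => rw [this]
      rw [inner_add_right, Submodule.inner_left_of_mem_orthogonal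
        (Submodule.starProjection_apply_mem K (u r)) hxK, add_zero]
    rw [real_inner_smul_left, hin, abs_mul, abs_of_pos (inv_pos.2 hR), ← div_eq_inv_mul,
      lt_div_iff₀ hR]
    linarith [hα2 r]
  · rw [norm_smul, norm_inv, Real.norm_of_nonneg hR.le, ← div_eq_inv_mul]
    exact div_le_one_of_le₀ hα1 hR.le
  · intro s hs
    rw [real_inner_smul_left, Submodule.inner_left_of_mem_orthogonal _ hxK, mul_zero]
    exact Submodule.subset_span ⟨s, hs, rfl⟩

end Permutation

section Counting

variable {ι : Type*} [Fintype ι] [DecidableEq ι]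

/-- A bound on a family `F` of `m`-sets that satisfies an exchange property. -/
lemma card_exchange_family_le {F F' : Finset ι → Prop} [DecidablePred F] [DecidablePred F']
    {m t : ℕ} (hFF : ∀ S, F S → F' S)
    (ht : ∀ S e f f', S.card = m → e ∈ S → f ∉ S → f' ∉ S → f ≠ f' →
      F (insert f (S.erase e)) → F (insert f' (S.erase e)) → F' S)
    (e : ι) (hg : ∀ S, S.card = m → F S → e ∉ S →
      t ≤ (S.filter fun f => ¬ F' (insert e (S.erase f))).card) :
    ((Finset.powersetCard m Finset.univ).filter fun S => F S ∧ e ∉ S).card * t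
      + ((Finset.powersetCard m Finset.univ).filter fun S => F S ∧ e ∈ S).card
      ≤ (Fintype.card ι - 1).choose (m - 1) := by
  set P := Finset.powersetCard m (Finset.univ : Finset ι) with hP
  have hPm : ∀ S, S ∈ P ↔ S.card = m := fun S => by simp [hP]
  set s := P.filter fun S => F S ∧ e ∉ S with hs
  set T := P.filter fun S => e ∈ S ∧ ¬ F' S with hT
  have hdc : s.card * t ≤ T.card * 1 := by
    classical
    refine Finset.card_mul_le_card_mul (fun S₀ S => ∃ f ∈ S₀, S = insert e (S₀.erase f)) ?_ ?_
    · intro S₀ hS₀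
      obtain ⟨h1, h2, h3⟩ := Finset.mem_filter.1 hS₀
      rw [hPm] at h1
      refine (hg S₀ h1 h2 h3).trans (Finset.card_le_card_of_injOn
        (fun f => insert e (S₀.erase f)) ?_ ?_)
      · intro f hf
        obtain ⟨hf1, hf2⟩ := Finset.mem_filter.1 (Finset.mem_coe.1 hf)
        refine Finset.mem_coe.2 (Finset.mem_filter.2 ⟨Finset.mem_filter.2 ⟨(hPm _).2 ?_,
          Finset.mem_insert_self _ _, hf2⟩, f, hf1, rfl⟩)
        rw [Finset.card_insert_of_notMem (by simp [h3]), Finset.card_erase_of_mem hf1]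
        have := Finset.card_pos.2 ⟨f, hf1⟩
        omega
      · intro f hf f' hf' hff
        have hf1 := (Finset.mem_filter.1 (Finset.mem_coe.1 hf)).1
        have hf1' := (Finset.mem_filter.1 (Finset.mem_coe.1 hf')).1
        by_contra hne
        have hmem : f' ∈ insert e (S₀.erase f) :=
          Finset.mem_insert_of_mem (Finset.mem_erase.2 ⟨Ne.symm hne, hf1'⟩)
        rw [show insert e (S₀.erase f) = insert e (S₀.erase f') from hff] at hmem
        rcases Finset.mem_insert.1 hmem with hh | hh
        · exact h3 (hh ▸ hf1')
        · simp at hh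
    · intro S hS
      obtain ⟨h1, h2, h3⟩ := Finset.mem_filter.1 hS
      rw [hPm] at h1
      refine Finset.card_le_one.2 fun A hA B hB => ?_
      obtain ⟨hA1, f, hfA, hA2⟩ := Finset.mem_filter.1 hA
      obtain ⟨hB1, f', hfB, hB2⟩ := Finset.mem_filter.1 hB
      obtain ⟨-, hFA, heA⟩ := Finset.mem_filter.1 hA1
      obtain ⟨-, hFB, heB⟩ := Finset.mem_filter.1 hB1
      have key : ∀ (A : Finset ι) (f : ι), f ∈ A → e ∉ A → S = insert e (A.erase f) →
          A = insert f (S.erase e) ∧ f ∉ S := by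
        intro A f hf he hS
        rw [hS]
        refine ⟨?_, ?_⟩
        · rw [Finset.erase_insert (by simp [he]), Finset.insert_erase hf]
        · have : f ≠ e := fun h => he (h ▸ hf)
          simp [this]
      obtain ⟨hA3, hfS⟩ := key A f hfA heA hA2
      obtain ⟨hB3, hfS'⟩ := key B f' hfB heB hB2
      by_cases hff : f = f'
      · rw [hA3, hB3, hff]
      · exact absurd (ht S e f f' h1 h2 hfS hfS' hff (hA3 ▸ hFA) (hB3 ▸ hFB)) h3
  have hdisj : Disjoint T (P.filter fun S => F S ∧ e ∈ S) :=
    Finset.disjoint_left.2 fun S h1 h2 =>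
      (Finset.mem_filter.1 h1).2.2 (hFF S (Finset.mem_filter.1 h2).2.1)
  calc s.card * t + (P.filter fun S => F S ∧ e ∈ S).card
      ≤ T.card + (P.filter fun S => F S ∧ e ∈ S).card := by omega
    _ = (T ∪ P.filter fun S => F S ∧ e ∈ S).card := (Finset.card_union_of_disjoint hdisj).symm
    _ ≤ (Finset.powersetCard (m - 1) (Finset.univ.erase e)).card := by
        refine Finset.card_le_card_of_injOn (fun S => S.erase e) ?_ ?_
        · intro S hS
          have hS' : S.card = m ∧ e ∈ S := by
            rcases Finset.mem_union.1 (Finset.mem_coe.1 hS) with h | h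
            · exact ⟨(hPm S).1 (Finset.mem_filter.1 h).1, (Finset.mem_filter.1 h).2.1⟩
            · exact ⟨(hPm S).1 (Finset.mem_filter.1 h).1, (Finset.mem_filter.1 h).2.2⟩
          refine Finset.mem_coe.2 (Finset.mem_powersetCard.2 ⟨?_, ?_⟩)
          · exact Finset.erase_subset_erase e (Finset.subset_univ S)
          · rw [Finset.card_erase_of_mem hS'.2, hS'.1]
        · have hmem : ∀ S ∈ (T ∪ P.filter fun S => F S ∧ e ∈ S), e ∈ S := by
            intro S hS
            rcases Finset.mem_union.1 hS with h | h
            · exact (Finset.mem_filter.1 h).2.1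
            · exact (Finset.mem_filter.1 h).2.2
          intro S hS S' hS' h
          rw [← Finset.insert_erase (hmem S (Finset.mem_coe.1 hS)),
            ← Finset.insert_erase (hmem S' (Finset.mem_coe.1 hS'))]
          exact congrArg (insert e) h
    _ = _ := by
        rw [Finset.card_powersetCard, Finset.card_erase_of_mem (Finset.mem_univ e),
          Finset.card_univ]

end Counting

section Matching

variable {ι E : Type*} [NormedAddCommGroup E] [InnerProductSpace ℝ E] [Fintype ι] [DecidableEq ι]

lemma nearSpan_of_exchange {v : ι → E} {κ δ : ℝ} {m : ℕ} (hv : RobustIndep κ (m + 1) v)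
    (hκ : 0 ≤ κ) (hv2 : ∀ s, ‖v s‖ ≤ 2) {y : E} {S : Finset ι} {e f f' : ι} (hS : S.card = m)
    (he : e ∈ S) (hf : f ∉ S) (hf' : f' ∉ S) (hff : f ≠ f')
    (h : NearSpan v δ (insert f (S.erase e)) y) (h' : NearSpan v δ (insert f' (S.erase e)) y) :
    NearSpan v (δ + 4 * κ * δ) S y := by
  obtain ⟨c, hc, hcδ⟩ := h
  obtain ⟨c', hc', hcδ'⟩ := h'
  have hcard : (insert f (insert f' (S.erase e))).card ≤ m + 1 := by
    refine (Finset.card_insert_le _ _).trans ?_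
    refine Nat.succ_le_succ ((Finset.card_insert_le _ _).trans ?_)
    rw [Finset.card_erase_of_mem he, hS]
    have := Finset.card_pos.2 ⟨e, he⟩
    omega
  have hb := hv.abs_sub_le hκ hcard (c := c) (c' := c')
    (fun j hj => hc j fun hh => hj (by
      rcases Finset.mem_insert.1 hh with hh | hh <;> simp_all))
    (fun j hj => hc' j fun hh => hj (by
      rcases Finset.mem_insert.1 hh with hh | hh <;> simp_all)) hcδ hcδ' f
  rw [hc' f (by simp [hff, hf]), sub_zero] at hb
  refine ⟨Function.update c f 0, fun j hj => ?_, ?_⟩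
  · by_cases hjf : j = f
    · simp [hjf]
    · rw [Function.update_of_ne hjf]
      exact hc j (by simp [hjf, hj])
  · have hsum : ∑ j, Function.update c f 0 j • v j = ∑ j, c j • v j - c f • v f := by
      rw [← Finset.add_sum_erase _ _ (Finset.mem_univ f),
        ← Finset.add_sum_erase _ (fun j => c j • v j) (Finset.mem_univ f)]
      simp only [Function.update_self, zero_smul, zero_add, add_sub_cancel_left]
      exact Finset.sum_congr rfl fun j hj => by
        rw [Function.update_of_ne (Finset.ne_of_mem_erase hj)]
    rw [hsum, sub_sub_eq_add_sub, add_sub_right_comm]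
    refine (norm_add_le _ _).trans ?_
    rw [norm_smul, Real.norm_eq_abs]
    have h1 : |c f| * ‖v f‖ ≤ κ * (δ + δ) * 2 :=
      mul_le_mul hb (hv2 f) (norm_nonneg _) ((abs_nonneg _).trans hb)
    linarith

lemma abs_coeff_le_of_exchange {v : ι → E} {κ δ δ' : ℝ} {m : ℕ} (hv : RobustIndep κ (m + 1) v)
    (hκ : 0 ≤ κ) {y : E} {S : Finset ι} {e f : ι} (hS : S.card = m)
    (he : e ∉ S) (hf : f ∈ S) {c : ι → ℝ} (hc : ∀ j, j ∉ S → c j = 0)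
    (hcδ : ‖y - ∑ j, c j • v j‖ ≤ δ)
    (h' : NearSpan v δ' (insert e (S.erase f)) y) : |c f| ≤ κ * (δ + δ') := by
  obtain ⟨c', hc', hcδ'⟩ := h'
  have hfe : f ≠ e := fun h => he (h ▸ hf)
  have hb := hv.abs_sub_le hκ (S := insert e S) (by rw [Finset.card_insert_of_notMem he, hS])
    (c := c) (c' := c') (fun j hj => hc j fun hh => hj (by simp [hh]))
    (fun j hj => hc' j fun hh => hj (by
      rcases Finset.mem_insert.1 hh with hh | hh <;> simp_all)) hcδ hcδ' f
  rwa [hc' f (by simp [hfe]), sub_zero] at hb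

/-- If every `m` of the vectors `v s` span a space close to at least `m` of the vectors `u r`, then
every `u r` is close to a multiple of some `v s`. -/
theorem exists_near_smul {u v : ι → E} {κ δ ε : ℝ} {m : ℕ} (hv : RobustIndep κ (m + 1) v)
    (hκ : 0 ≤ κ) (hδ : 0 ≤ δ) (hv2 : ∀ s, ‖v s‖ ≤ 2) (hm : 1 ≤ m) (hmR : m < Fintype.card ι)
    (hε : δ + Fintype.card ι * (κ * (δ + (δ + 4 * κ * δ)) * 2) ≤ ε) (hu : ∀ r, ε < ‖u r‖)
    (hnear : ∀ S : Finset ι, S.card = m → ∀ [DecidablePred fun r => ¬ NearSpan v δ S (u r)],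
      (Finset.univ.filter fun r => ¬ NearSpan v δ S (u r)).card ≤ Fintype.card ι - m) (r₀ : ι) :
    ∃ (s : ι) (c : ℝ), ‖u r₀ - c • v s‖ ≤ ε := by
  classical
  by_contra! hno
  set R := Fintype.card ι with hR
  set δ' := δ + 4 * κ * δ with hδ'
  have hδδ' : δ ≤ δ' := by rw [hδ']; nlinarith [mul_nonneg hκ hδ]
  let P := Finset.powersetCard m (Finset.univ : Finset ι)
  let F : ι → Finset ι → Prop := fun r S => NearSpan v δ S (u r)
  let F' : ι → Finset ι → Prop := fun r S => NearSpan v δ' S (u r)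
  have hex : ∀ r e t, (∀ S : Finset ι, S.card = m → F r S → e ∉ S →
      t ≤ (S.filter fun f => ¬ F' r (insert e (S.erase f))).card) →
      (P.filter fun S => F r S ∧ e ∉ S).card * t + (P.filter fun S => F r S ∧ e ∈ S).card
        ≤ (R - 1).choose (m - 1) := fun r e t hg =>
    card_exchange_family_le (F := F r) (F' := F' r) (fun S h => h.mono hδδ')
      (fun S e f f' hS he hf hf' hff h h' =>
        nearSpan_of_exchange hv hκ hv2 hS he hf hf' hff h h') e hg
  have hsplit : ∀ r e, (P.filter (F r)).card
      = (P.filter fun S => F r S ∧ e ∉ S).card + (P.filter fun S => F r S ∧ e ∈ S).card := by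
    intro r e
    rw [← Finset.card_filter_add_card_filter_not (s := P.filter (F r)) (fun S => e ∉ S),
      Finset.filter_filter, Finset.filter_filter]
    simp only [not_not]
  have hrest : ∀ (r e : ι) (S : Finset ι), S.card = m → F r S → e ∉ S →
      ∃ c : ι → ℝ, (∀ f ∈ S, F' r (insert e (S.erase f)) → ‖c f • v f‖ ≤ κ * (δ + δ') * 2) ∧
        (∀ j, j ∉ S → c j = 0) ∧ ‖u r - ∑ j, c j • v j‖ ≤ δ := by
    intro r e S hS hF he
    obtain ⟨c, hc, hcδ⟩ := hF
    refine ⟨c, fun f hf hF' => ?_, hc, hcδ⟩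
    have h1 := abs_coeff_le_of_exchange hv hκ hS he hf hc hcδ hF'
    rw [norm_smul, Real.norm_eq_abs]
    exact mul_le_mul h1 (hv2 f) (norm_nonneg _) ((abs_nonneg _).trans h1)
  have hB0 : 0 ≤ κ * (δ + δ') * 2 := by positivity
  have hone : ∀ (r e : ι) (S : Finset ι), S.card = m → F r S → e ∉ S →
      1 ≤ (S.filter fun f => ¬ F' r (insert e (S.erase f))).card := by
    intro r e S hS hF he
    by_contra! hlt
    have hemp := Finset.filter_eq_empty_iff.1 (Finset.card_eq_zero.1 (Nat.lt_one_iff.1 hlt))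
    obtain ⟨c, hc1, hc2, hc3⟩ := hrest r e S hS hF he
    have hall : ∀ j, ‖c j • v j‖ ≤ κ * (δ + δ') * 2 := by
      intro j
      by_cases hj : j ∈ S
      · exact hc1 j hj (not_not.1 (hemp hj))
      · rw [hc2 j hj, zero_smul, norm_zero]; exact hB0
    have h1 : ‖∑ j, c j • v j‖ ≤ R * (κ * (δ + δ') * 2) := by
      refine (norm_sum_le _ _).trans ((Finset.sum_le_sum fun j _ => hall j).trans ?_)
      simp [hR]
    have h2 : ‖u r‖ ≤ ‖u r - ∑ j, c j • v j‖ + ‖∑ j, c j • v j‖ := by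
      have := norm_add_le (u r - ∑ j, c j • v j) (∑ j, c j • v j)
      rwa [sub_add_cancel] at this
    linarith [hu r]
  have htwo : ∀ (e : ι) (S : Finset ι), S.card = m → F r₀ S → e ∉ S →
      2 ≤ (S.filter fun f => ¬ F' r₀ (insert e (S.erase f))).card := by
    intro e S hS hF he
    by_contra! hlt
    obtain ⟨f₀, hf₀⟩ := Finset.card_pos.1 (hone r₀ e S hS hF he)
    have hle : (S.filter fun f => ¬ F' r₀ (insert e (S.erase f))).card ≤ 1 := by omega
    obtain ⟨c, hc1, hc2, hc3⟩ := hrest r₀ e S hS hF he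
    have hall : ∀ j ∈ Finset.univ.erase f₀, ‖c j • v j‖ ≤ κ * (δ + δ') * 2 := by
      intro j hj
      by_cases hjS : j ∈ S
      · refine hc1 j hjS ?_
        by_contra hF'
        exact Finset.ne_of_mem_erase hj
          (Finset.card_le_one.1 hle j (Finset.mem_filter.2 ⟨hjS, hF'⟩) f₀ hf₀)
      · rw [hc2 j hjS, zero_smul, norm_zero]; exact hB0
    have h1 : ‖∑ j ∈ Finset.univ.erase f₀, c j • v j‖ ≤ R * (κ * (δ + δ') * 2) := by
      refine (norm_sum_le _ _).trans ((Finset.sum_le_sum hall).trans ?_)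
      rw [Finset.sum_const, nsmul_eq_mul]
      refine mul_le_mul_of_nonneg_right ?_ hB0
      exact_mod_cast (Finset.card_le_univ _)
    have h2 : u r₀ - c f₀ • v f₀
        = (u r₀ - ∑ j, c j • v j) + ∑ j ∈ Finset.univ.erase f₀, c j • v j := by
      rw [← Finset.add_sum_erase _ (fun j => c j • v j) (Finset.mem_univ f₀)]; abel
    have h3 := hno f₀ (c f₀)
    rw [h2] at h3
    linarith [norm_add_le (u r₀ - ∑ j, c j • v j) (∑ j ∈ Finset.univ.erase f₀, c j • v j)]
  have hle : ∀ r, (P.filter (F r)).card ≤ (R - 1).choose (m - 1) := by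
    intro r
    have := hex r r₀ 1 (fun S hS hF he => hone r r₀ S hS hF he)
    rw [hsplit r r₀]; omega
  have hlt : (P.filter (F r₀)).card < (R - 1).choose (m - 1) := by
    rcases (P.filter (F r₀)).eq_empty_or_nonempty with h0 | ⟨S, hS⟩
    · rw [h0, Finset.card_empty]
      exact Nat.choose_pos (by omega)
    · obtain ⟨hSP, hSF⟩ := Finset.mem_filter.1 hS
      have hSm : S.card = m := (Finset.mem_powersetCard.1 hSP).2
      obtain ⟨e, he⟩ : ∃ e, e ∉ S := by
        by_contra! hh
        have : S = Finset.univ := Finset.eq_univ_iff_forall.2 hh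
        rw [this, Finset.card_univ] at hSm
        omega
      have h1 := hex r₀ e 2 (fun S hS hF he => htwo e S hS hF he)
      have h2 : 0 < (P.filter fun S => F r₀ S ∧ e ∉ S).card :=
        Finset.card_pos.2 ⟨S, Finset.mem_filter.2 ⟨hSP, hSF, he⟩⟩
      rw [hsplit r₀ e]; omega
  have hsum : ∑ r, (P.filter (F r)).card < R * (R - 1).choose (m - 1) := by
    calc _ < ∑ _r : ι, (R - 1).choose (m - 1) :=
          Finset.sum_lt_sum (fun r _ => hle r) ⟨r₀, Finset.mem_univ _, hlt⟩
      _ = _ := by simp [hR]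
  have hge : R.choose m * m ≤ ∑ r, (P.filter (F r)).card := by
    have hswap : ∑ r, (P.filter (F r)).card
        = ∑ S ∈ P, (Finset.univ.filter fun r => F r S).card := by
      simp only [Finset.card_filter]
      exact Finset.sum_comm
    rw [hswap]
    calc R.choose m * m = ∑ _S ∈ P, m := by
          rw [Finset.sum_const, Finset.card_powersetCard, Finset.card_univ, smul_eq_mul]
      _ ≤ _ := by
          refine Finset.sum_le_sum fun S hS => ?_
          have h1 := hnear S (Finset.mem_powersetCard.1 hS).2
          have h2 := Finset.card_filter_add_card_filter_not (s := (Finset.univ : Finset ι))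
            (fun r => F r S)
          rw [Finset.card_univ] at h2
          change (Finset.univ.filter fun r => ¬ F r S).card ≤ _ at h1
          omega
  have hid : R * (R - 1).choose (m - 1) = R.choose m * m := by
    have := Nat.add_one_mul_choose_eq (R - 1) (m - 1)
    rw [Nat.sub_add_cancel hm,
      Nat.sub_add_cancel (by omega)] at this
    exact this
  omega

end Matching

section SingularValues

lemma LinearMap.singularValues_mul_norm_le {E F : Type*} [NormedAddCommGroup E]
    [InnerProductSpace ℝ E] [FiniteDimensional ℝ E] [NormedAddCommGroup F] [InnerProductSpace ℝ F]
    [FiniteDimensional ℝ F] (T : E →ₗ[ℝ] F) {k : ℕ} (hk : Module.finrank ℝ E = k + 1) (x : E) :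
    T.singularValues k * ‖x‖ ≤ ‖T x‖ := by
  have hT := T.isSymmetric_adjoint_comp_self
  set b := hT.eigenvectorBasis hk with hb
  have h1 : ‖T x‖ ^ 2 = ∑ i, hT.eigenvalues hk i * (inner ℝ (b i) x : ℝ) ^ 2 := by
    rw [← real_inner_self_eq_norm_sq, ← LinearMap.adjoint_inner_left,
      ← LinearMap.comp_apply, ← b.sum_inner_mul_inner]
    refine Finset.sum_congr rfl fun i _ => ?_
    rw [hT, hb, hT.apply_eigenvectorBasis hk i, inner_smul_right, real_inner_comm]
    simp only [RCLike.ofReal_real_eq_id, id_eq]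
    ring
  have h2 : ∀ i, T.singularValues k ^ 2 ≤ hT.eigenvalues hk i := by
    intro i
    rw [← T.sq_singularValues_fin hk i]
    exact pow_le_pow_left₀ (T.singularValues_nonneg k)
      (T.singularValues_antitone (Nat.lt_succ_iff.1 i.2)) 2
  refine le_of_sq_le_sq ?_ (norm_nonneg _)
  rw [h1, mul_pow, ← b.sum_sq_inner_right x, Finset.mul_sum]
  exact Finset.sum_le_sum fun i _ => mul_le_mul_of_nonneg_right (h2 i) (sq_nonneg _)

lemma robustIndep_of_le_robustKruskalRank {n R k : ℕ} {τ : ℝ} (hτ : 0 < τ)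
    {M : Matrix (Fin n) (Fin R) ℝ} (hk : 1 ≤ k) (h : k ≤ robustKruskalRank τ M) :
    RobustIndep τ k (fun r => (WithLp.toLp 2 (fun i => M i r) : EuclideanSpace ℝ (Fin n))) := by
  classical
  set K := robustKruskalRank τ M with hK
  have hne : {k : ℕ | k ≤ R ∧ ∀ S : Finset (Fin R), S.card = k →
      1 / τ ≤ sigmaK (M.submatrix id (fun j : S => (j : Fin R))) k}.Nonempty := by
    by_contra hh
    rw [Set.not_nonempty_iff_eq_empty] at hh
    rw [robustKruskalRank, hh, csSup_empty] at hK
    simp only [bot_eq_zero'] at hK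
    omega
  obtain ⟨hKR, hKS⟩ := Nat.sSup_mem hne ⟨R, fun x hx => hx.1⟩
  change K ≤ R at hKR
  change ∀ S : Finset (Fin R), S.card = K → _ at hKS
  intro S hS c i hi
  obtain ⟨S', hSS', -, hS'⟩ := Finset.exists_subsuperset_card_eq (Finset.subset_univ S)
    (hS.trans h) (by simpa using hKR)
  have hσ := hKS S' hS'
  set A := M.submatrix id (fun j : S' => (j : Fin R)) with hA
  let x : EuclideanSpace ℝ S' := WithLp.toLp 2 fun j => if (j : Fin R) ∈ S then c j else 0
  have hTx : Matrix.toEuclideanLin A x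
      = ∑ j ∈ S, c j • (WithLp.toLp 2 (fun i => M i j) : EuclideanSpace ℝ (Fin n)) := by
    ext a
    rw [Matrix.toLpLin_apply]
    simp only [Matrix.mulVec, dotProduct, hA, Matrix.submatrix_apply, id, x, WithLp.ofLp_sum,
      Finset.sum_apply, WithLp.ofLp_smul, Pi.smul_apply, smul_eq_mul]
    rw [Finset.sum_coe_sort S' (fun j => M a j * if j ∈ S then c j else 0),
      ← Finset.sum_subset hSS' (fun j _ hj => by simp [hj])]
    exact Finset.sum_congr rfl fun j hj => by simp [hj, mul_comm]
  have hsv := LinearMap.singularValues_mul_norm_le (Matrix.toEuclideanLin A) (k := K - 1)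
    (by rw [finrank_euclideanSpace, Fintype.card_coe, hS']; omega) x
  have hσ' : 1 / τ ≤ (Matrix.toEuclideanLin A).singularValues (K - 1) := hσ
  rw [hTx] at hsv
  have hci : |c i| ≤ ‖x‖ := by
    have := PiLp.norm_apply_le x ⟨i, hSS' hi⟩
    simpa [x, hi] using this
  have h3 : 1 / τ * ‖x‖ ≤ _ := (mul_le_mul_of_nonneg_right hσ' (norm_nonneg x)).trans hsv
  rw [one_div, ← div_eq_inv_mul, div_le_iff₀' hτ] at h3
  exact hci.trans h3

end SingularValues

lemma abs_prod_sub_prod_le {α : Type*} (s : Finset α) {x y : α → ℝ} {B d : ℝ} (hB : 1 ≤ B)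
    (hd : 0 ≤ d) (hx : ∀ a ∈ s, |x a| ≤ B) (hy : ∀ a ∈ s, |y a| ≤ B)
    (hxy : ∀ a ∈ s, |x a - y a| ≤ d) :
    |∏ a ∈ s, x a - ∏ a ∈ s, y a| ≤ s.card * B ^ s.card * d := by
  classical
  induction s using Finset.induction_on with
  | empty => simp
  | insert a s ha ih =>
    rw [Finset.prod_insert ha, Finset.prod_insert ha, Finset.card_insert_of_notMem ha]
    have ih' := ih (fun b hb => hx b (by simp [hb])) (fun b hb => hy b (by simp [hb]))
      (fun b hb => hxy b (by simp [hb]))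
    have hyp : |∏ b ∈ s, y b| ≤ B ^ s.card := by
      rw [Finset.abs_prod]
      refine (Finset.prod_le_prod (fun b _ => abs_nonneg _)
        (fun b hb => hy b (by simp [hb]))).trans (le_of_eq ?_)
      rw [Finset.prod_const]
    have e : x a * ∏ b ∈ s, x b - y a * ∏ b ∈ s, y b
        = x a * (∏ b ∈ s, x b - ∏ b ∈ s, y b) + (x a - y a) * ∏ b ∈ s, y b := by ring
    rw [e]
    refine (abs_add_le _ _).trans ?_
    rw [abs_mul, abs_mul]
    have h1 := mul_le_mul (hx a (by simp)) ih' (abs_nonneg _) (by linarith)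
    have h2 := mul_le_mul (hxy a (by simp)) hyp (abs_nonneg _) hd
    have h3 : d * B ^ s.card ≤ d * B ^ (s.card + 1) :=
      mul_le_mul_of_nonneg_left (pow_le_pow_right₀ hB (Nat.le_succ _)) hd
    calc _ ≤ B * (s.card * B ^ s.card * d) + d * B ^ s.card := add_le_add h1 h2
      _ ≤ B * (s.card * B ^ s.card * d) + d * B ^ (s.card + 1) := by linarith
      _ = _ := by push_cast; ring

section Tensor

lemma formProd_ofFn {E : Type*} [NormedAddCommGroup E] [InnerProductSpace ℝ E] {ℓ : ℕ}
    (f : Fin ℓ → E) (v : E) : formProd (List.ofFn f) v = ∏ a, inner ℝ (f a) v := by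
  simp [formProd, List.map_ofFn, List.prod_ofFn]

variable {n : ℕ}

lemma formProd_ofFn_eq_sum {ℓ : ℕ} (f : Fin ℓ → EuclideanSpace ℝ (Fin n))
    (v : EuclideanSpace ℝ (Fin n)) :
    formProd (List.ofFn f) v = ∑ i : Fin ℓ → Fin n, (∏ a, f a (i a)) * ∏ a, v (i a) := by
  rw [formProd_ofFn]
  simp only [PiLp.inner_apply, RCLike.inner_apply, conj_trivial]
  rw [Finset.prod_univ_sum, Fintype.piFinset_univ]
  refine Finset.sum_congr rfl fun i _ => ?_
  rw [← Finset.prod_mul_distrib]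
  exact Finset.prod_congr rfl fun a _ => mul_comm _ _

lemma sum_abs_le_mul_norm (x : EuclideanSpace ℝ (Fin n)) : ∑ i, |x i| ≤ n * ‖x‖ := by
  calc ∑ i, |x i| ≤ ∑ _i : Fin n, ‖x‖ := Finset.sum_le_sum fun i _ => PiLp.norm_apply_le x i
    _ = n * ‖x‖ := by simp

lemma norm_le_sum_abs (x : EuclideanSpace ℝ (Fin n)) : ‖x‖ ≤ ∑ i, |x i| := by
  rw [EuclideanSpace.norm_eq]
  refine Real.sqrt_le_iff.2 ⟨Finset.sum_nonneg fun i _ => abs_nonneg _, ?_⟩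
  simp only [Real.norm_eq_abs]
  exact Finset.sum_sq_le_sq_sum_of_nonneg fun i _ => abs_nonneg _

lemma sum_abs_prod_le {ℓ : ℕ} (f : Fin ℓ → EuclideanSpace ℝ (Fin n)) :
    ∑ i : Fin ℓ → Fin n, |∏ a, f a (i a)| ≤ (n : ℝ) ^ ℓ * ∏ a, ‖f a‖ := by
  have h : ∑ i : Fin ℓ → Fin n, |∏ a, f a (i a)| = ∏ a, ∑ i, |f a i| := by
    rw [Finset.prod_univ_sum, Fintype.piFinset_univ]
    exact Finset.sum_congr rfl fun i _ => Finset.abs_prod _ _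
  rw [h]
  calc ∏ a, ∑ i, |f a i| ≤ ∏ a : Fin ℓ, ((n : ℝ) * ‖f a‖) :=
        Finset.prod_le_prod (fun a _ => Finset.sum_nonneg fun i _ => abs_nonneg _)
          fun a _ => sum_abs_le_mul_norm (f a)
    _ = _ := by rw [Finset.prod_mul_distrib]; simp

/-- Entrywise closeness of two tensors gives closeness of the multilinear forms. -/
lemma abs_sub_formProd_le {R ℓ : ℕ} {u v : Fin R → EuclideanSpace ℝ (Fin n)} {w w' : Fin R → ℝ}
    {δ : ℝ} (h : ∀ i : Fin ℓ → Fin n,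
      |∑ r, w r * ∏ a, u r (i a) - ∑ r, w' r * ∏ a, v r (i a)| ≤ δ)
    (hδ : 0 ≤ δ) (l : List (EuclideanSpace ℝ (Fin n))) (hl : l.length = ℓ) :
    |∑ r, w r * formProd l (u r) - ∑ s, w' s * formProd l (v s)|
      ≤ (n : ℝ) ^ ℓ * δ * (l.map norm).prod := by
  subst hl
  obtain ⟨f, hf⟩ : ∃ f : Fin l.length → EuclideanSpace ℝ (Fin n), l = List.ofFn f :=
    ⟨l.get, (List.ofFn_get l).symm⟩
  have hnorm : (l.map norm).prod = ∏ a, ‖f a‖ := by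
    conv_lhs => rw [hf]
    rw [List.map_ofFn, List.prod_ofFn]; rfl
  have key : ∀ (w : Fin R → ℝ) (u : Fin R → EuclideanSpace ℝ (Fin n)),
      ∑ r, w r * formProd l (u r)
        = ∑ i : Fin l.length → Fin n, (∏ a, f a (i a)) * ∑ r, w r * ∏ a, u r (i a) := by
    intro w u
    have hr : ∀ r, formProd l (u r) = ∑ i : Fin l.length → Fin n, (∏ a, f a (i a)) * ∏ a, u r (i a) :=
      fun r => by conv_lhs => rw [hf]
                  exact formProd_ofFn_eq_sum f (u r)
    simp only [hr, Finset.mul_sum]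
    rw [Finset.sum_comm]
    exact Finset.sum_congr rfl fun i _ => Finset.sum_congr rfl fun r _ => by ring
  rw [key, key, ← Finset.sum_sub_distrib, hnorm]
  calc _ ≤ ∑ i : Fin l.length → Fin n, |∏ a, f a (i a)| * δ := by
        refine (Finset.abs_sum_le_sum_abs _ _).trans (Finset.sum_le_sum fun i _ => ?_)
        rw [← mul_sub, abs_mul]
        exact mul_le_mul_of_nonneg_left (h i) (abs_nonneg _)
    _ = (∑ i : Fin l.length → Fin n, |∏ a, f a (i a)|) * δ := by rw [Finset.sum_mul]
    _ ≤ ((n : ℝ) ^ l.length * ∏ a, ‖f a‖) * δ :=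
        mul_le_mul_of_nonneg_right (sum_abs_prod_le f) hδ
    _ = _ := by ring

end Tensor

section Recovery

variable {n R : ℕ}

lemma abs_formProd_sub_le {E : Type*} [NormedAddCommGroup E] [InnerProductSpace ℝ E]
    {l : List E} {κ B d : ℝ} {x y : E} (hl : ∀ z ∈ l, ‖z‖ ≤ κ) (hκ : 0 ≤ κ) (hB : 1 ≤ B)
    (hx : κ * ‖x‖ ≤ B) (hy : κ * ‖y‖ ≤ B) (hxy : κ * ‖x - y‖ ≤ d) :
    |formProd l x - formProd l y| ≤ l.length * B ^ l.length * d := by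
  obtain ⟨f, hf⟩ : ∃ f : Fin l.length → E, l = List.ofFn f := ⟨l.get, (List.ofFn_get l).symm⟩
  have hfl : ∀ a, ‖f a‖ ≤ κ := fun a => hl _ (by rw [hf]; exact List.mem_ofFn.2 ⟨a, rfl⟩)
  have hin : ∀ a z, |inner ℝ (f a) z| ≤ κ * ‖z‖ := fun a z =>
    (abs_real_inner_le_norm _ _).trans (mul_le_mul_of_nonneg_right (hfl a) (norm_nonneg _))
  have hd : 0 ≤ d := (mul_nonneg hκ (norm_nonneg _)).trans hxy
  have h := abs_prod_sub_prod_le (Finset.univ : Finset (Fin l.length))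
    (x := fun a => inner ℝ (f a) x) (y := fun a => inner ℝ (f a) y) hB hd
    (fun a _ => (hin a x).trans hx) (fun a _ => (hin a y).trans hy)
    (fun a _ => by rw [← inner_sub_right]; exact (hin a _).trans hxy)
  have e : ∀ z, formProd l z = ∏ a, inner ℝ (f a) z := fun z => by
    conv_lhs => rw [hf]
    exact formProd_ofFn f z
  rw [e, e]
  simpa using h

lemma norm_sub_le_of_near_smul {x y : EuclideanSpace ℝ (Fin n)} {b ε δ₀ c : ℝ} (hb : 8 ≤ b)
    (hn : (n : ℝ) ≤ b) (hε0 : 0 ≤ ε) (hε : ε * b ^ 2 ≤ 1) (hδ : δ₀ * b ≤ ε) (hδ0 : 0 ≤ δ₀)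
    (hx : ∑ i, x i = 1) (hy : |∑ i, y i - 1| ≤ δ₀) (hy2 : ‖y‖ ≤ 2) (hc : ‖x - c • y‖ ≤ ε) :
    ‖x - y‖ ≤ ε * b ^ 2 := by
  have hσ := abs_le.1 hy
  set σ := ∑ i, y i with hσdef
  have h1 : |1 - c * σ| ≤ b * ε := by
    have e : 1 - c * σ = ∑ i, (x - c • y) i := by
      simp only [PiLp.sub_apply, PiLp.smul_apply, smul_eq_mul, Finset.sum_sub_distrib, hx,
        ← Finset.mul_sum, hσdef]
    rw [e]
    refine (Finset.abs_sum_le_sum_abs _ _).trans ((sum_abs_le_mul_norm _).trans ?_)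
    exact mul_le_mul hn hc (norm_nonneg _) (by linarith)
  have hbε : b * ε * 8 ≤ 1 := by
    calc b * ε * 8 ≤ b * ε * b := mul_le_mul_of_nonneg_left hb (by positivity)
      _ = ε * b ^ 2 := by ring
      _ ≤ 1 := hε
  have hε8 : ε * 8 ≤ b * ε := by rw [mul_comm]; exact mul_le_mul_of_nonneg_right hb hε0
  have hδ8 : δ₀ * 8 ≤ ε := (mul_le_mul_of_nonneg_left hb hδ0).trans hδ
  have hσ1 : 1 / 2 ≤ σ := by linarith
  have hc4 : |c| ≤ 4 := by
    have h2 : |c * σ| ≤ 2 := by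
      have := abs_sub_abs_le_abs_sub (c * σ) 1
      rw [abs_one, abs_sub_comm] at this
      linarith
    rw [abs_mul, abs_of_nonneg (by linarith : 0 ≤ σ)] at h2
    have h3 : |c| * (1 / 2) ≤ |c| * σ := mul_le_mul_of_nonneg_left hσ1 (abs_nonneg c)
    linarith
  have hc1 : |c - 1| ≤ b * ε + 4 * δ₀ := by
    have e : c - 1 = -(1 - c * σ) - c * (σ - 1) := by ring
    rw [e]
    refine (abs_sub _ _).trans ?_
    rw [abs_neg, abs_mul]
    exact add_le_add h1 (mul_le_mul hc4 hy (abs_nonneg _) (by norm_num))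
  have e : x - y = (x - c • y) + (c - 1) • y := by rw [sub_smul, one_smul]; abel
  rw [e]
  refine (norm_add_le _ _).trans ?_
  rw [norm_smul, Real.norm_eq_abs]
  have h5 : |c - 1| * ‖y‖ ≤ (b * ε + 4 * δ₀) * 2 :=
    mul_le_mul hc1 hy2 (norm_nonneg _) (by positivity)
  have h6 : b * ε * 8 ≤ ε * b ^ 2 := by
    calc b * ε * 8 ≤ b * ε * b := mul_le_mul_of_nonneg_left hb (by positivity)
      _ = ε * b ^ 2 := by ring
  linarith

/-- Uniqueness of the decomposition: a second family of distributions and weights with nearly the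
same tensor is, up to a permutation, close to the first. All bounds are in terms of `b`. -/
theorem exists_perm_near {ℓ k : ℕ} {u v : Fin R → EuclideanSpace ℝ (Fin n)} {w w' : Fin R → ℝ}
    {b κ κ' γ δ₀ : ℝ} (hb : 8 ≤ b) (hn : (n : ℝ) ≤ b) (hR : (R : ℝ) ≤ b) (hℓb : (ℓ : ℝ) ≤ b)
    (hκ1 : 1 ≤ κ) (hκ : 2 * κ ≤ b) (hκ'0 : 0 ≤ κ') (hκ' : κ' ≤ b) (hγ : 0 < γ) (hγb : 1 / γ ≤ b)
    (hδ0 : 0 ≤ δ₀) (hδ : δ₀ * b ^ (4 * ℓ + 21) ≤ 1)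
    (hu : RobustIndep κ k u) (hv : RobustIndep κ' k v) (hk : 2 ≤ k) (hkR : k ≤ R)
    (hℓ : 2 * R ≤ ℓ * (k - 1)) (hw : ∀ r, γ ≤ w r) (hw'0 : ∀ s, 0 ≤ w' s)
    (hw' : ∀ s, w' s ≤ b ^ (ℓ + 2)) (hu0 : ∀ r i, 0 ≤ u r i) (hu1 : ∀ r, ∑ i, u r i = 1)
    (hv0 : ∀ s i, 0 ≤ v s i) (hv1 : ∀ s, |∑ i, v s i - 1| ≤ δ₀)
    (hT : ∀ i : Fin ℓ → Fin n,
      |∑ r, w r * ∏ a, u r (i a) - ∑ r, w' r * ∏ a, v r (i a)| ≤ δ₀) :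
    ∃ π : Equiv.Perm (Fin R), ∀ r, ‖u r - v (π r)‖ ≤ 1 / b ^ 4 ∧
      |w r - w' (π r)| ≤ 1 / b ^ 4 := by
  have hb0 : 0 < b := by linarith
  have hb1 : 1 ≤ b := by linarith
  have hR0 : 0 < R := by omega
  have : Nonempty (Fin R) := ⟨⟨0, hR0⟩⟩
  have hκ0 : 0 ≤ κ := by linarith
  have hκb : κ ≤ b := by linarith
  have hpow : ∀ {i j : ℕ}, i ≤ j → δ₀ * b ^ i ≤ δ₀ * b ^ j := fun h =>
    mul_le_mul_of_nonneg_left (pow_le_pow_right₀ hb1 h) hδ0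
  have hδ1 : δ₀ ≤ 1 := by
    have := (hpow (Nat.zero_le (4 * ℓ + 21))).trans hδ
    simpa using this
  have hu2 : ∀ r, ‖u r‖ ≤ 1 := fun r => (norm_le_sum_abs _).trans (by
    rw [← hu1 r]; exact Finset.sum_le_sum fun i _ => (abs_of_nonneg (hu0 r i)).le)
  have hv2 : ∀ s, ‖v s‖ ≤ 2 := fun s => (norm_le_sum_abs _).trans (by
    have h1 : ∑ i, |v s i| = ∑ i, v s i := Finset.sum_congr rfl fun i _ => abs_of_nonneg (hv0 s i)
    rw [h1]; linarith [(abs_le.1 (hv1 s)).2])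
  obtain ⟨m, rfl⟩ : ∃ m, k = m + 1 := ⟨k - 1, by omega⟩
  have hℓ1 : 1 ≤ ℓ := by
    by_contra! hh
    have : ℓ = 0 := by omega
    subst this; omega
  set δ := (n : ℝ) ^ ℓ * δ₀ with hδdef
  have hclose := fun l hl => abs_sub_formProd_le hT hδ0 l hl
  have hδn : 0 ≤ δ := by positivity
  have hδb : δ ≤ δ₀ * b ^ ℓ := by
    rw [hδdef, mul_comm]
    exact mul_le_mul_of_nonneg_left (pow_le_pow_left₀ (by positivity) hn ℓ) hδ0
  -- the Kruskal step
  set δ₂ := (R : ℝ) * δ * κ ^ (ℓ - 1) / γ with hδ₂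
  have hδ₂0 : 0 ≤ δ₂ := by positivity
  have hδ₂b : δ₂ ≤ δ₀ * b ^ (2 * ℓ + 1) := by
    calc δ₂ = (R * δ) * κ ^ (ℓ - 1) * (1 / γ) := by rw [hδ₂]; ring
      _ ≤ (b * (δ₀ * b ^ ℓ)) * b ^ (ℓ - 1) * b := by gcongr
      _ = δ₀ * b ^ (2 * ℓ + 1) := by
          have : 2 * ℓ + 1 = ℓ + (ℓ - 1) + 2 := by omega
          rw [this]; ring
  set δ₃ := 2 * (R : ℝ) ^ 2 * δ₂ with hδ₃
  have hδ₃0 : 0 ≤ δ₃ := by positivity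
  have hδ₃b : δ₃ ≤ δ₀ * b ^ (2 * ℓ + 4) := by
    calc δ₃ ≤ b * b ^ 2 * (δ₀ * b ^ (2 * ℓ + 1)) := by
          rw [hδ₃]; gcongr; linarith
      _ = _ := by ring
  set ε := δ₀ * b ^ (2 * ℓ + 9) with hε
  have hε0 : 0 ≤ ε := by positivity
  have hεb : ε * b ^ (2 * ℓ + 12) ≤ 1 := by
    calc _ = δ₀ * b ^ (4 * ℓ + 21) := by rw [hε, mul_assoc, ← pow_add]; congr 2; omega
      _ ≤ 1 := hδ
  have hε2 : ε * b ^ 2 ≤ 1 := by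
    refine le_trans ?_ hεb
    exact mul_le_mul_of_nonneg_left (pow_le_pow_right₀ hb1 (by omega)) hε0
  have hne : ∀ r, 1 ≤ κ * ‖u r‖ := by
    intro r
    have := hu {r} (by simp) (fun _ => 1) r (by simp)
    simpa using this
  have hsmall : ∀ r, ε < ‖u r‖ := by
    intro r
    have h1 : 1 ≤ b * ‖u r‖ := (hne r).trans (mul_le_mul_of_nonneg_right hκb (norm_nonneg _))
    by_contra! hh
    have h2 : 1 ≤ b * ε := h1.trans (mul_le_mul_of_nonneg_left hh hb0.le)
    nlinarith
  have hnear := exists_near_smul (u := u) (v := v) (κ := κ') (δ := δ₃) (ε := ε) (m := m) hv hκ'0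
    hδ₃0 hv2 (by omega) (by simpa using hkR) (by
      rw [Fintype.card_fin]
      calc δ₃ + R * (κ' * (δ₃ + (δ₃ + 4 * κ' * δ₃)) * 2)
          ≤ δ₃ + b * (b * (δ₃ + (δ₃ + 4 * b * δ₃)) * 2) := by gcongr
        _ = δ₃ * (1 + 4 * b ^ 2 + 8 * b ^ 3) := by ring
        _ ≤ δ₃ * b ^ 5 := by
            refine mul_le_mul_of_nonneg_left ?_ hδ₃0
            have h3 : 8 * b ^ 3 ≤ b * b ^ 3 := by gcongr
            have h2 : 8 * b ^ 2 ≤ b * b ^ 2 := by gcongr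
            have h4 : 8 * b ^ 4 ≤ b * b ^ 4 := by gcongr
            have h5 : 1 ≤ b ^ 2 := one_le_pow₀ hb1
            have h6 : 0 ≤ b ^ 4 := by positivity
            nlinarith
        _ ≤ (δ₀ * b ^ (2 * ℓ + 4)) * b ^ 5 := by gcongr
        _ = ε := by rw [hε]; ring) hsmall (by
      intro S hS inst
      have hq : Fintype.card (Fin R) - m = R - (m + 1) + 1 := by simp; omega
      classical
      have := card_not_nearSpan_le (u := u) (v := v) (S := S) (δ := δ₂) (q := R - (m + 1) + 1)
        (fun x hx hx0 => by
          have h := card_large_inner_le (u := u) (v := v) (w := w) (w' := w') hu hκ0 hγ hw hδn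
            hclose hk (by simpa using hkR) (by simpa using hℓ) (S := S) (by simpa using hS) hx hx0
          simpa only [Fintype.card_fin] using h)
      simp only [Fintype.card_fin] at this
      rw [hq]
      convert this)
  -- the multiples are close to one
  have hnear' : ∀ r, ∃ s, ‖u r - v s‖ ≤ ε * b ^ 2 := by
    intro r
    obtain ⟨s, c, hc⟩ := hnear r
    refine ⟨s, ?_⟩
    exact norm_sub_le_of_near_smul hb hn hε0 hε2
      (by simpa using hpow (i := 1) (j := 2 * ℓ + 9) (by omega)) hδ0 (hu1 r) (hv1 s) (hv2 s) hc
  choose p hp using hnear'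
  have hinj : Function.Injective p := by
    intro r r' hrr
    by_contra hne'
    have h1 := hu {r, r'} (by rw [Finset.card_pair hne']; omega)
      (fun j => if j = r then 1 else -1) r (by simp)
    rw [Finset.sum_pair hne'] at h1
    simp only [if_true, abs_one, one_smul, if_neg (Ne.symm hne'), neg_smul] at h1
    have h2 : ‖u r + -u r'‖ ≤ 2 * (ε * b ^ 2) := by
      have e : u r + -u r' = (u r - v (p r)) - (u r' - v (p r')) := by rw [hrr]; abel
      rw [e]
      exact (norm_sub_le _ _).trans (by linarith [hp r, hp r'])
    have h3 : 1 ≤ b * (ε * b ^ 2) := by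
      calc 1 ≤ κ * (2 * (ε * b ^ 2)) := h1.trans (mul_le_mul_of_nonneg_left h2 hκ0)
        _ = (2 * κ) * (ε * b ^ 2) := by ring
        _ ≤ b * (ε * b ^ 2) := by gcongr
    have h4 : b * (ε * b ^ 2) * b ≤ 1 := by
      calc _ = ε * b ^ 4 := by ring
        _ ≤ ε * b ^ (2 * ℓ + 12) :=
          mul_le_mul_of_nonneg_left (pow_le_pow_right₀ hb1 (by omega)) hε0
        _ ≤ 1 := hεb
    nlinarith
  let π : Equiv.Perm (Fin R) := Equiv.ofBijective p (Finite.injective_iff_bijective.1 hinj)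
  have hπ : ∀ r, π r = p r := fun r => rfl
  have hdist : ∀ r, ‖u r - v (π r)‖ ≤ ε * b ^ 2 := fun r => hp r
  refine ⟨π, fun r => ⟨?_, ?_⟩⟩
  · rw [le_div_iff₀ (by positivity)]
    calc ‖u r - v (π r)‖ * b ^ 4 ≤ ε * b ^ 2 * b ^ 4 := by gcongr; exact hdist r
      _ = ε * b ^ 6 := by ring
      _ ≤ ε * b ^ (2 * ℓ + 12) :=
          mul_le_mul_of_nonneg_left (pow_le_pow_right₀ hb1 (by omega)) hε0
      _ ≤ 1 := hεb
  · have hcard : R ≤ ℓ * (m + 1 - 1) + 1 := by omega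
    obtain ⟨l, hl1, hl2, hl3, hl4⟩ := hu.exists_forms (by omega) (i := r) ℓ Finset.univ
      (Finset.mem_univ r) (by simpa using hcard)
    have hw1 : w r = ∑ j, w j * formProd l (u j) := by
      rw [Finset.sum_eq_single r (fun j _ hj => by rw [hl4 j (Finset.mem_univ j) hj, mul_zero])
        (by simp), hl3, mul_one]
    have hw2 : w' (π r) = ∑ j, w' (π j) * formProd l (u j) := by
      rw [Finset.sum_eq_single r (fun j _ hj => by rw [hl4 j (Finset.mem_univ j) hj, mul_zero])
        (by simp), hl3, mul_one]
    have hw3 : ∑ s, w' s * formProd l (v s) = ∑ j, w' (π j) * formProd l (v (π j)) :=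
      (Equiv.sum_comp π _).symm
    have hd1 : |∑ j, w j * formProd l (u j) - ∑ s, w' s * formProd l (v s)|
        ≤ δ₀ * b ^ (2 * ℓ) := by
      refine (hclose l hl1).trans ?_
      calc δ * (l.map norm).prod ≤ (δ₀ * b ^ ℓ) * b ^ ℓ := by
            refine mul_le_mul hδb ?_ (norm_prod_nonneg l) (by positivity)
            refine (norm_prod_le_pow (κ := b) fun x hx => (hl2 x hx).trans hκb).trans ?_
            rw [hl1]
        _ = _ := by ring
    have hd2 : |∑ j, w' (π j) * formProd l (v (π j)) - ∑ j, w' (π j) * formProd l (u j)|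
        ≤ ε * b ^ (2 * ℓ + 7) := by
      rw [← Finset.sum_sub_distrib]
      calc _ ≤ ∑ _j : Fin R, b ^ (ℓ + 2) * (b * b ^ ℓ * (b * (ε * b ^ 2))) := by
            refine (Finset.abs_sum_le_sum_abs _ _).trans (Finset.sum_le_sum fun j _ => ?_)
            rw [← mul_sub, abs_mul, abs_of_nonneg (hw'0 _)]
            refine mul_le_mul (hw' _) ?_ (abs_nonneg _) (by positivity)
            refine (abs_formProd_sub_le (B := b) (d := b * (ε * b ^ 2)) hl2 hκ0 hb1 ?_ ?_ ?_).trans ?_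
            · exact (mul_le_mul_of_nonneg_left (hv2 _) hκ0).trans (by linarith)
            · exact (mul_le_mul_of_nonneg_left (hu2 _) hκ0).trans (by linarith)
            · rw [norm_sub_rev]
              exact mul_le_mul hκb (hdist j) (norm_nonneg _) hb0.le
            · rw [hl1]; gcongr
        _ = R * (b ^ (ℓ + 2) * (b * b ^ ℓ * (b * (ε * b ^ 2)))) := by simp
        _ ≤ b * (b ^ (ℓ + 2) * (b * b ^ ℓ * (b * (ε * b ^ 2)))) := by gcongr
        _ = _ := by ring
    rw [le_div_iff₀ (by positivity)]
    have hfin : |w r - w' (π r)| ≤ δ₀ * b ^ (2 * ℓ) + ε * b ^ (2 * ℓ + 7) := by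
      rw [hw1, hw2]
      have e : ∑ j, w j * formProd l (u j) - ∑ j, w' (π j) * formProd l (u j)
          = (∑ j, w j * formProd l (u j) - ∑ s, w' s * formProd l (v s))
            + (∑ j, w' (π j) * formProd l (v (π j)) - ∑ j, w' (π j) * formProd l (u j)) := by
        rw [hw3]; ring
      rw [e]
      exact (abs_add_le _ _).trans (add_le_add hd1 hd2)
    have h1 : δ₀ * b ^ (2 * ℓ + 4) * b ≤ 1 := by
      rw [mul_assoc, ← pow_succ]
      exact (hpow (by omega)).trans hδ
    have h2 : ε * b ^ (2 * ℓ + 11) * b ≤ 1 := by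
      rw [mul_assoc, ← pow_succ]; exact hεb
    have h3 : |w r - w' (π r)| * b ^ 4 ≤ δ₀ * b ^ (2 * ℓ + 4) + ε * b ^ (2 * ℓ + 11) := by
      calc _ ≤ (δ₀ * b ^ (2 * ℓ) + ε * b ^ (2 * ℓ + 7)) * b ^ 4 := by gcongr
        _ = _ := by ring
    have h4 : |w r - w' (π r)| * b ^ 4 * b ≤ 2 := by
      refine (mul_le_mul_of_nonneg_right h3 hb0.le).trans ?_
      linarith
    have h5 : 0 ≤ |w r - w' (π r)| * b ^ 4 := by positivity
    linarith [mul_le_mul_of_nonneg_left hb h5]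

end Recovery

section MaximalVolume

/-- Among finitely many vectors of `ℝ^R` that have a dual family, some `R` of them represent all of
them with coefficients of absolute value at most one. -/
lemma exists_bounded_coordinates {ι : Type*} [Fintype ι] {R : ℕ} (K : ι → Fin R → ℝ)
    (Y : Fin R → ι → ℝ) (hY : ∀ r s, ∑ α, Y r α * K α s = if r = s then 1 else 0) :
    ∃ (f : Fin R → ι) (c : ι → Fin R → ℝ), (∀ α j, |c α j| ≤ 1) ∧
      ∀ α s, K α s = ∑ j, c α j * K (f j) s := by
  classical
  let D : (Fin R → ι) → ℝ := fun f => Matrix.det (Matrix.of fun j => K (f j))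
  have hex : ∃ f, D f ≠ 0 := by
    by_contra! hh
    have h1 : (Matrix.detRowAlternating (R := ℝ) (n := Fin R)).toMultilinearMap
        (fun r => ∑ α, Y r α • K α) = 1 := by
      have : (fun r => ∑ α, Y r α • K α) = (1 : Matrix (Fin R) (Fin R) ℝ) := by
        funext r s
        rw [Finset.sum_apply]
        simp only [Pi.smul_apply, smul_eq_mul]
        rw [hY, Matrix.one_apply]
      rw [this]
      exact Matrix.det_one
    rw [MultilinearMap.map_sum] at h1
    have h2 : ∀ f : Fin R → ι, (Matrix.detRowAlternating (R := ℝ) (n := Fin R)).toMultilinearMap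
        (fun r => Y r (f r) • K (f r)) = 0 := by
      intro f
      rw [MultilinearMap.map_smul_univ]
      have : (Matrix.detRowAlternating (R := ℝ) (n := Fin R)).toMultilinearMap
        (fun r => K (f r)) = D f := rfl
      rw [this, hh f, smul_zero]
    simp only [h2, Finset.sum_const_zero] at h1
    exact zero_ne_one h1
  obtain ⟨f₀, hf₀⟩ := hex
  obtain ⟨f, -, hf⟩ := Finset.exists_max_image Finset.univ (fun f => |D f|) ⟨f₀, Finset.mem_univ _⟩
  have hD : 0 < |D f| := (abs_pos.2 hf₀).trans_le (hf f₀ (Finset.mem_univ _))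
  set A : Matrix (Fin R) (Fin R) ℝ := Matrix.of fun j => K (f j) with hA
  refine ⟨f, fun α j => (Matrix.cramer A.transpose (K α) j) / D f, fun α j => ?_, fun α s => ?_⟩
  · rw [abs_div, div_le_one hD, Matrix.cramer_transpose_apply]
    have : A.updateRow j (K α) = Matrix.of fun i => K (Function.update f j α i) := by
      ext i s
      by_cases hij : i = j
      · subst hij; simp
      · simp [hij, hA]
    rw [this]
    exact hf _ (Finset.mem_univ _)
  · have h1 := congrFun (Matrix.mulVec_cramer A.transpose (K α)) s
    rw [Matrix.det_transpose] at h1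
    have hD0 : D f ≠ 0 := abs_pos.1 hD
    have h2 : D f * K α s = ∑ j, K (f j) s * Matrix.cramer A.transpose (K α) j := h1.symm
    rw [eq_comm, ← mul_right_inj' hD0, h2, Finset.mul_sum]
    exact Finset.sum_congr rfl fun j _ => by field_simp

end MaximalVolume

section Candidate

variable {n R : ℕ}

/-- The components are combinations, with bounded coefficients, of `R` fibres of the tensor. -/
lemma exists_fibres {ℓ k : ℕ} {u : Fin R → EuclideanSpace ℝ (Fin n)} {w : Fin R → ℝ} {κ γ : ℝ}
    (hκ : 0 ≤ κ) (hγ : 0 < γ) (hw : ∀ r, γ ≤ w r) (hu : RobustIndep κ k u) (hk : 1 ≤ k)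
    (hR : R ≤ ℓ * (k - 1) + 1) :
    ∃ (f : Fin R → Fin ℓ → Fin n) (X : Fin R → Fin R → ℝ),
      (∀ j r, |X j r| ≤ 1 / γ * ((n : ℝ) ^ ℓ * κ ^ ℓ)) ∧
      ∀ r i, u r i = ∑ j, X j r * ∑ s, w s * (u s i * ∏ a, u s (f j a)) := by
  have hw0 : ∀ r, 0 < w r := fun r => hγ.trans_le (hw r)
  have hforms : ∀ r : Fin R, ∃ x : Fin ℓ → EuclideanSpace ℝ (Fin n), (∀ a, ‖x a‖ ≤ κ) ∧
      ∀ s, ∏ a, inner ℝ (x a) (u s) = if r = s then (1 : ℝ) else 0 := by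
    intro r
    obtain ⟨l, hl1, hl2, hl3, hl4⟩ := hu.exists_forms hk (i := r) ℓ Finset.univ
      (Finset.mem_univ r) (by simpa using hR)
    subst hl1
    refine ⟨l.get, fun a => hl2 _ (List.get_mem l a), fun s => ?_⟩
    rw [← formProd_ofFn, List.ofFn_get]
    split_ifs with h
    · rw [← h, hl3]
    · exact hl4 s (Finset.mem_univ s) (Ne.symm h)
  choose x hx1 hx2 using hforms
  let K : (Fin ℓ → Fin n) → Fin R → ℝ := fun α s => w s * ∏ a, u s (α a)
  let Y : Fin R → (Fin ℓ → Fin n) → ℝ := fun r α => (w r)⁻¹ * ∏ a, x r a (α a)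
  have hY : ∀ r s, ∑ α, Y r α * K α s = if r = s then 1 else 0 := by
    intro r s
    have h1 : ∑ α, Y r α * K α s = (w r)⁻¹ * w s * ∏ a, inner ℝ (x r a) (u s) := by
      rw [← formProd_ofFn, formProd_ofFn_eq_sum, Finset.mul_sum]
      exact Finset.sum_congr rfl fun α _ => by simp only [Y, K]; ring
    rw [h1, hx2]
    split_ifs with h
    · rw [h, inv_mul_cancel₀ (hw0 s).ne', one_mul]
    · rw [mul_zero]
  obtain ⟨f, c, hc1, hc2⟩ := exists_bounded_coordinates K Y hY
  refine ⟨f, fun j r => ∑ α, Y r α * c α j, fun j r => ?_, fun r i => ?_⟩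
  · calc |∑ α, Y r α * c α j| ≤ ∑ α : Fin ℓ → Fin n, (w r)⁻¹ * |∏ a, x r a (α a)| := by
          refine (Finset.abs_sum_le_sum_abs _ _).trans (Finset.sum_le_sum fun α _ => ?_)
          rw [abs_mul, abs_mul, abs_of_pos (inv_pos.2 (hw0 r))]
          exact mul_le_of_le_one_right (by have := hw0 r; positivity) (hc1 α j)
      _ = (w r)⁻¹ * ∑ α : Fin ℓ → Fin n, |∏ a, x r a (α a)| := by rw [Finset.mul_sum]
      _ ≤ (w r)⁻¹ * ((n : ℝ) ^ ℓ * ∏ a, ‖x r a‖) :=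
          mul_le_mul_of_nonneg_left (sum_abs_prod_le _) (inv_pos.2 (hw0 r)).le
      _ ≤ 1 / γ * ((n : ℝ) ^ ℓ * κ ^ ℓ) := by
          rw [one_div]
          have h1 : (w r)⁻¹ ≤ γ⁻¹ := inv_anti₀ hγ (hw r)
          have h2 : ∏ a, ‖x r a‖ ≤ κ ^ ℓ :=
            (Finset.prod_le_prod (fun a _ => norm_nonneg _) (fun a _ => hx1 r a)).trans
              (by simp)
          have h3 : 0 ≤ ∏ a, ‖x r a‖ := Finset.prod_nonneg fun a _ => norm_nonneg _
          gcongr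
  · have h1 : ∀ s, ∑ j, (∑ α, Y r α * c α j) * K (f j) s = if r = s then 1 else 0 := by
      intro s
      rw [← hY r s]
      simp only [Finset.sum_mul]
      rw [Finset.sum_comm]
      refine Finset.sum_congr rfl fun α _ => ?_
      rw [hc2 α s, Finset.mul_sum]
      exact Finset.sum_congr rfl fun j _ => by ring
    have h2 : ∑ s, u s i * ∑ j, (∑ α, Y r α * c α j) * K (f j) s = u r i := by
      simp [h1]
    rw [← h2]
    simp only [Finset.mul_sum]
    rw [Finset.sum_comm]
    refine Finset.sum_congr rfl fun j _ => Finset.sum_congr rfl fun s _ => ?_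
    simp only [K]
    ring

end Candidate

section Grid

variable {n R : ℕ}

/-- Robust independence follows from a test on the integer points of a large cube. -/
lemma robustIndep_of_grid {k : ℕ} {v : Fin R → EuclideanSpace ℝ (Fin n)} {T : ℝ} {H : ℕ}
    (hT : 0 < T) (hv : ∀ s, ∑ i, |v s i| ≤ 2) (hH : 8 * R * T ≤ H) (hH0 : 0 < H)
    (h : ∀ z : Fin R → ℤ, (∀ j, |z j| ≤ H) → (Finset.univ.filter fun j => z j ≠ 0).card ≤ k →
      ∀ j, |(z j : ℝ)| ≤ 2 * T * ∑ i, |∑ s, v s i * z s|) :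
    RobustIndep (4 * T * n) k v := by
  intro S hS c i₀ hi₀
  obtain ⟨j, hjS, hj⟩ := Finset.exists_max_image S (fun j => |c j|) ⟨i₀, hi₀⟩
  refine (hj i₀ hi₀).trans ?_
  rcases (abs_nonneg (c j)).eq_or_lt with h0 | hpos
  · rw [← h0]; positivity
  set y := ∑ s ∈ S, c s • v s with hy
  have hH' : (0 : ℝ) < H := by exact_mod_cast hH0
  let e : Fin R → ℝ := fun s => if s ∈ S then H * (c s / |c j|) else 0
  let z : Fin R → ℤ := fun s => ⌊e s⌋
  have he : ∀ s, |e s| ≤ H := by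
    intro s
    by_cases hs : s ∈ S
    · simp only [e, hs, if_true]
      rw [abs_mul, abs_of_pos hH', abs_div, abs_abs]
      exact mul_le_of_le_one_right hH'.le ((div_le_one hpos).2 (hj s hs))
    · simp [e, hs]
  have hz : ∀ s, |z s| ≤ H := by
    intro s
    have := abs_le.1 (he s)
    refine abs_le.2 ⟨Int.le_floor.2 (by push_cast; linarith), ?_⟩
    have h1 : (z s : ℝ) ≤ H := (Int.floor_le _).trans this.2
    exact_mod_cast h1
  have hsupp : (Finset.univ.filter fun s => z s ≠ 0).card ≤ k := by
    refine (Finset.card_le_card fun s hs => ?_).trans hS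
    by_contra hsS
    exact (Finset.mem_filter.1 hs).2 (by simp [z, e, hsS])
  have hzj : |(z j : ℝ)| = H := by
    have h1 : e j = H ∨ e j = -H := by
      simp only [e, hjS, if_true]
      rcases abs_choice (c j) with h | h
      · left; rw [h, div_self (fun hh => by rw [hh] at hpos; simp at hpos), mul_one]
      · right
        rw [h, div_neg, div_self (fun hh => by rw [hh] at hpos; simp at hpos)]; ring
    rcases h1 with h1 | h1
    · simp only [z, h1, Int.floor_natCast]; simp
    · have : (-(H : ℝ)) = ((-(H : ℤ) : ℤ) : ℝ) := by push_cast; ring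
      simp only [z, h1, this, Int.floor_intCast]; simp
  have hmain := h z hz hsupp j
  rw [hzj] at hmain
  have hround : ∀ i, |∑ s, v s i * z s| ≤ H / |c j| * |y i| + ∑ s, |v s i| := by
    intro i
    have hyi : ∑ s, v s i * e s = H / |c j| * y i := by
      have : y i = ∑ s ∈ S, c s * v s i := by
        rw [hy]; simp [WithLp.ofLp_sum, Finset.sum_apply]
      rw [this, Finset.mul_sum, ← Finset.sum_subset (Finset.subset_univ S)
        (fun s _ hs => by simp [e, hs])]
      exact Finset.sum_congr rfl fun s hs => by simp only [e, hs, if_true]; ring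
    have e1 : ∑ s, v s i * z s = ∑ s, v s i * e s + ∑ s, v s i * (z s - e s) := by
      rw [← Finset.sum_add_distrib]
      exact Finset.sum_congr rfl fun s _ => by ring
    rw [e1, hyi]
    refine (abs_add_le _ _).trans (add_le_add ?_ ?_)
    · rw [abs_mul, abs_of_pos (div_pos hH' hpos)]
    · refine (Finset.abs_sum_le_sum_abs _ _).trans (Finset.sum_le_sum fun s _ => ?_)
      rw [abs_mul]
      refine mul_le_of_le_one_right (abs_nonneg _) (abs_le.2 ⟨?_, ?_⟩)
      · have := Int.lt_floor_add_one (e s)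
        simp only [z]; linarith
      · have := Int.floor_le (e s)
        simp only [z]; linarith
  have hsum : ∑ i, |∑ s, v s i * z s| ≤ H / |c j| * (n * ‖y‖) + 2 * R := by
    calc _ ≤ ∑ i, (H / |c j| * |y i| + ∑ s, |v s i|) := Finset.sum_le_sum fun i _ => hround i
      _ = H / |c j| * ∑ i, |y i| + ∑ s, ∑ i, |v s i| := by
          rw [Finset.sum_add_distrib, Finset.mul_sum, Finset.sum_comm (f := fun i s => |v s i|)]
      _ ≤ H / |c j| * (n * ‖y‖) + ∑ _s : Fin R, (2 : ℝ) :=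
          add_le_add (mul_le_mul_of_nonneg_left (sum_abs_le_mul_norm y) (by positivity))
            (Finset.sum_le_sum fun s _ => hv s)
      _ = _ := by simp [mul_comm]
  have h2 : (H : ℝ) ≤ 2 * T * (H / |c j| * (n * ‖y‖) + 2 * R) :=
    hmain.trans (mul_le_mul_of_nonneg_left hsum (by positivity))
  have h3 : (H : ℝ) / 2 ≤ 2 * T * (H / |c j| * (n * ‖y‖)) := by linarith
  have h4 : 2 * T * (H / |c j| * (n * ‖y‖)) = (H : ℝ) / 2 * (4 * T * n * ‖y‖ / |c j|) := by
    field_simp; ring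
  rw [h4] at h3
  have h5 : 1 ≤ 4 * T * n * ‖y‖ / |c j| :=
    le_of_mul_le_mul_left (by linarith) (half_pos hH')
  rw [le_div_iff₀ hpos] at h5
  linarith

end Grid

section Sampling

/-- Hoeffding's inequality for the empirical frequency of an event, both tails. -/
lemma infinitePi_real_frequency_le {Ω : Type*} [MeasurableSpace Ω] (μ : Measure Ω)
    [IsProbabilityMeasure μ] {S : Set Ω} (hS : MeasurableSet S) (N : ℕ) {ε : ℝ}
    (hε : 0 < ε) :
    (Measure.infinitePi fun _ : ℕ => μ).real
      {X | ε * N ≤ |∑ j ∈ Finset.range N, (S.indicator (fun _ => (1 : ℝ)) (X j) - μ.real S)|}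
      ≤ 2 * Real.exp (-(2 * N * ε ^ 2)) := by
  set P := Measure.infinitePi fun _ : ℕ => μ with hP
  set f : Ω → ℝ := S.indicator fun _ => (1 : ℝ) with hf
  have hfm : Measurable f := measurable_const.indicator hS
  have hf01 : ∀ x, f x ∈ Set.Icc (0 : ℝ) 1 := fun x => by
    by_cases hx : x ∈ S <;> simp [f, hx]
  have hint : ∀ j : ℕ, ∫ X, f (X j) ∂P = μ.real S := by
    intro j
    have hmap : P.map (fun X => X j) = μ := Measure.infinitePi_map_eval (fun _ : ℕ => μ) j
    have h1 : ∫ X, f (X j) ∂P = ∫ x, f x ∂(P.map fun X => X j) :=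
      (integral_map (measurable_pi_apply j).aemeasurable hfm.aestronglyMeasurable).symm
    rw [h1, hmap, hf, integral_indicator_const _ hS]
    simp
  have hindep : ∀ s : ℝ, ProbabilityTheory.iIndepFun
      (fun (j : ℕ) (X : ℕ → Ω) => s * (f (X j) - μ.real S)) P := fun s =>
    ProbabilityTheory.iIndepFun_infinitePi (P := fun _ : ℕ => μ)
      (X := fun _ x => s * (f x - μ.real S)) fun _ => (hfm.sub_const _).const_mul s
  have hsub : ∀ j : ℕ, ProbabilityTheory.HasSubgaussianMGF
      (fun X : ℕ → Ω => f (X j) - μ.real S) ((‖(1 : ℝ) - 0‖₊ / 2) ^ 2) P := by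
    intro j
    have h := ProbabilityTheory.hasSubgaussianMGF_of_mem_Icc (μ := P) (X := fun X => f (X j))
      (hfm.comp (measurable_pi_apply j)).aemeasurable (Filter.Eventually.of_forall fun X => hf01 _)
    simpa only [hint j] using h
  have hεN : 0 ≤ ε * N := by positivity
  have hexp : Real.exp (-(ε * N) ^ 2 / (2 * N * (((‖(1 : ℝ) - 0‖₊ / 2) ^ 2 : NNReal) : ℝ)))
      = Real.exp (-(2 * N * ε ^ 2)) := by
    rcases Nat.eq_zero_or_pos N with h0 | h0
    · simp [h0]
    · have : (N : ℝ) ≠ 0 := by positivity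
      congr 1
      simp
      field_simp
  have h1 := ProbabilityTheory.HasSubgaussianMGF.measure_sum_range_ge_le_of_iIndepFun
    (hindep 1) (n := N) (c := (‖(1 : ℝ) - 0‖₊ / 2) ^ 2)
    (fun i _ => by simp only [one_mul]; exact hsub i) hεN
  have h2 := ProbabilityTheory.HasSubgaussianMGF.measure_sum_range_ge_le_of_iIndepFun
    (hindep (-1)) (n := N) (c := (‖(1 : ℝ) - 0‖₊ / 2) ^ 2)
    (fun i _ => by simp only [neg_one_mul]; exact (hsub i).neg) hεN
  rw [hexp] at h1 h2
  refine (measureReal_mono (s₂ := {X : ℕ → Ω | ε * N ≤ ∑ j ∈ Finset.range N, 1 * (f (X j) - μ.real S)}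
    ∪ {X : ℕ → Ω | ε * N ≤ ∑ j ∈ Finset.range N, (-1) * (f (X j) - μ.real S)}) ?_).trans ?_
  · intro X hX
    simp only [Set.mem_ofPred_eq, Set.mem_union, ← Finset.mul_sum] at hX ⊢
    rcases le_abs.1 hX with h | h
    · left; linarith
    · right; linarith
  · refine (measureReal_union_le _ _).trans ?_
    linarith

namespace TopicModel

variable {n R : ℕ}

/-- The probability that a document is `i`. -/
noncomputable def tensor (𝓜 : TopicModel n R) (ℓ : ℕ) (i : Fin ℓ → Fin n) : ℝ :=
  ∑ r, 𝓜.weight r * ∏ a, 𝓜.wordMatrix (i a) r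

lemma documentLaw_real_singleton (𝓜 : TopicModel n R) {ℓ : ℕ} (i : Fin ℓ → Fin n) :
    (𝓜.documentLaw ℓ).real {i} = 𝓜.tensor ℓ i := by
  have h : 𝓜.documentLaw ℓ {i} = ∑ r, 𝓜.topic r * ∏ a, 𝓜.word r (i a) := by
    rw [documentLaw, Measure.finsetSum_apply]
    refine Finset.sum_congr rfl fun r _ => ?_
    rw [Measure.smul_apply, Measure.pi_singleton, smul_eq_mul]
    congr 1
    exact Finset.prod_congr rfl fun a _ =>
      PMF.toMeasure_apply_singleton _ _ (measurableSet_singleton _)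
  rw [measureReal_def, h, ENNReal.toReal_sum, tensor]
  · refine Finset.sum_congr rfl fun r _ => ?_
    rw [ENNReal.toReal_mul, ENNReal.toReal_prod]
    rfl
  · exact fun r _ => ENNReal.mul_ne_top (PMF.apply_ne_top _ _)
      (ENNReal.prod_ne_top fun a _ => PMF.apply_ne_top _ _)

/-- The number of the first `N` documents that are equal to `i`. -/
def docCount {ℓ : ℕ} (X : ℕ → Fin ℓ → Fin n) (N : ℕ) (i : Fin ℓ → Fin n) : ℕ :=
  ((Finset.range N).filter fun j => X j = i).card

lemma corpusLaw_real_close (𝓜 : TopicModel n R) (ℓ : ℕ) {N : ℕ} (hN : 0 < N) {ε : ℝ}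
    (hε : 0 < ε) :
    1 - (n : ℝ) ^ ℓ * (2 * Real.exp (-(2 * N * ε ^ 2))) ≤
      (𝓜.corpusLaw ℓ).real {X | ∀ i, |(docCount X N i : ℝ) / N - 𝓜.tensor ℓ i| ≤ ε} := by
  have hP : IsProbabilityMeasure (𝓜.corpusLaw ℓ) := by unfold corpusLaw; infer_instance
  set A : Set (ℕ → Fin ℓ → Fin n) :=
    {X | ∀ i, |(docCount X N i : ℝ) / N - 𝓜.tensor ℓ i| ≤ ε} with hA
  set B : (Fin ℓ → Fin n) → Set (ℕ → Fin ℓ → Fin n) := fun i =>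
    {X | ε * N ≤ |∑ j ∈ Finset.range N, (({i} : Set (Fin ℓ → Fin n)).indicator
      (fun _ => (1 : ℝ)) (X j) - (𝓜.documentLaw ℓ).real {i})|} with hB
  have hcover : Set.univ ⊆ A ∪ ⋃ i ∈ (Finset.univ : Finset (Fin ℓ → Fin n)), B i := by
    intro X _
    by_cases hX : X ∈ A
    · exact Or.inl hX
    · right
      simp only [hA, Set.mem_ofPred_eq, not_forall, not_le] at hX
      obtain ⟨i, hi⟩ := hX
      simp only [Finset.mem_univ, Set.iUnion_true, Set.mem_iUnion]
      refine ⟨i, ?_⟩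
      simp only [hB, Set.mem_ofPred_eq]
      have hN' : (0 : ℝ) < N := by exact_mod_cast hN
      have hsum : ∑ j ∈ Finset.range N, (({i} : Set (Fin ℓ → Fin n)).indicator
          (fun _ => (1 : ℝ)) (X j) - (𝓜.documentLaw ℓ).real {i})
          = ((docCount X N i : ℝ) / N - 𝓜.tensor ℓ i) * N := by
        rw [Finset.sum_sub_distrib, 𝓜.documentLaw_real_singleton i, sub_mul,
          div_mul_cancel₀ _ hN'.ne']
        simp [docCount, Set.indicator_apply, mul_comm]
      rw [hsum, abs_mul, abs_of_pos hN']
      exact mul_le_mul_of_nonneg_right hi.le hN'.le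
  have h1 : (1 : ℝ) ≤ (𝓜.corpusLaw ℓ).real A
      + (𝓜.corpusLaw ℓ).real (⋃ i ∈ (Finset.univ : Finset (Fin ℓ → Fin n)), B i) := by
    calc (1 : ℝ) = (𝓜.corpusLaw ℓ).real Set.univ := by simp
      _ ≤ _ := measureReal_mono hcover
      _ ≤ _ := measureReal_union_le _ _
  have h2 : (𝓜.corpusLaw ℓ).real (⋃ i ∈ (Finset.univ : Finset (Fin ℓ → Fin n)), B i)
      ≤ (n : ℝ) ^ ℓ * (2 * Real.exp (-(2 * N * ε ^ 2))) := by
    refine (measureReal_biUnion_finset_le _ _).trans ?_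
    calc _ ≤ ∑ _i : Fin ℓ → Fin n, 2 * Real.exp (-(2 * N * ε ^ 2)) :=
          Finset.sum_le_sum fun i _ =>
            infinitePi_real_frequency_le (𝓜.documentLaw ℓ) (measurableSet_singleton i) N hε
      _ = _ := by simp
  linarith

end TopicModel

end Sampling

section Machine

lemma RAMState.write_mem (s : RAMState) (a v c : ℕ) :
    (s.write a v).mem c = if c = a then v else s.mem c := by
  simp [RAMState.write, Function.update_apply]

lemma RAMState.write_drawn (s : RAMState) (a v : ℕ) : (s.write a v).drawn = s.drawn := rfl

/-- A loop that counts the cell `c` down from `G`. -/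
lemma RAMProgram.exec_loop {ℓ n : ℕ} {X : ℕ → Fin ℓ → Fin n} {p : RAMProgram} {c G T : ℕ}
    (Inv : ℕ → RAMState → Prop) (hc : ∀ i s, Inv i s → s.mem c = G - i)
    (hstep : ∀ i s, i < G → Inv i s → ∃ t s', RAMProgram.Exec X p s t s' ∧ t ≤ T ∧ Inv (i + 1) s')
    {s : RAMState} (h0 : Inv 0 s) :
    ∃ t s', RAMProgram.Exec X (.loop c p) s t s' ∧ t ≤ G * (T + 1) + 1 ∧ Inv G s' := by
  suffices h : ∀ d i s, i + d = G → Inv i s →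
      ∃ t s', RAMProgram.Exec X (.loop c p) s t s' ∧ t ≤ d * (T + 1) + 1 ∧ Inv G s' from
    h G 0 s (Nat.zero_add G) h0
  intro d
  induction d with
  | zero =>
    intro i s hi hs
    have hi' : i = G := by omega
    subst hi'
    exact ⟨1, s, .loop_done (by rw [hc i s hs, Nat.sub_self]), by omega, hs⟩
  | succ d ih =>
    intro i s hi hs
    obtain ⟨t, s', he, ht, hs'⟩ := hstep i s (by omega) hs
    obtain ⟨t', s'', he', ht', hs''⟩ := ih (i + 1) s' (by omega) hs'
    refine ⟨t + t' + 1, s'', .loop_step (by rw [hc i s hs]; omega) he he', ?_, hs''⟩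
    rw [Nat.succ_mul]
    omega

/-- The data of type `α` that an arithmetic expression refers to: an array `mem` and finitely many
variables. -/
class RAMContext (α : Type) where
  size : ℕ
  mem : α → ℕ → ℕ
  var : α → ℕ → ℕ

instance RAMContext.extend {α : Type} [RAMContext α] : RAMContext (α × ℕ) where
  size := RAMContext.size α + 1
  mem a := RAMContext.mem a.1
  var a v := if v = RAMContext.size α then a.2 else RAMContext.var a.1 v

variable {α : Type} [RAMContext α]

/-- All data in the context are at most `B`. -/
def RAMContext.BoundedBy (a : α) (B : ℕ) : Prop :=
  (∀ i, RAMContext.mem a i ≤ B) ∧ ∀ v < RAMContext.size α, RAMContext.var a v ≤ B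

/-- The state `s` holds the variables of the context in the cells `loc v` and the array from the
cell `W` on. -/
def RAMContext.HeldBy (loc : ℕ → ℕ) (W : ℕ) (s : RAMState) (a : α) : Prop :=
  (∀ v < RAMContext.size α, s.mem (loc v) = RAMContext.var a v) ∧
    ∀ i, s.mem (W + i) = RAMContext.mem a i

/-- `p` writes the value `v` to the cell `k` in at most `T` steps; it draws no document and changes
no cell before `k` or from `W` on. -/
def RAMProgram.Evaluates {ℓ n : ℕ} (X : ℕ → Fin ℓ → Fin n) (p : RAMProgram) (s : RAMState)
    (k W v T : ℕ) : Prop :=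
  ∃ t s', RAMProgram.Exec X p s t s' ∧ t ≤ T ∧ s'.drawn = s.drawn ∧ s'.mem k = v ∧
    ∀ c, c < k ∨ W ≤ c → s'.mem c = s.mem c

/-- `f` is computed by a program, in time polynomial in the largest number in the context. -/
def PolyComputable (f : α → ℕ) : Prop :=
  ∃ q need : ℕ, 1 ≤ q ∧ (∀ a B, 2 ≤ B → RAMContext.BoundedBy a B → f a ≤ B ^ q) ∧
    ∀ (loc : ℕ → ℕ) (k W : ℕ), (∀ v < RAMContext.size α, loc v < k) → k + need ≤ W →
      ∃ p : RAMProgram, ∀ (ℓ n : ℕ) (X : ℕ → Fin ℓ → Fin n) (s : RAMState) (a : α) (B : ℕ), 2 ≤ B →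
        RAMContext.BoundedBy a B → RAMContext.HeldBy loc W s a →
        RAMProgram.Evaluates X p s k W (f a) (B ^ q)

lemma RAMContext.HeldBy.congr {loc : ℕ → ℕ} {W k : ℕ} {s s' : RAMState} {a : α}
    (h : RAMContext.HeldBy loc W s a) (hloc : ∀ v < RAMContext.size α, loc v < k)
    (hs : ∀ c, c < k ∨ W ≤ c → s'.mem c = s.mem c) : RAMContext.HeldBy loc W s' a :=
  ⟨fun v hv => (hs _ (Or.inl (hloc v hv))).trans (h.1 v hv),
    fun i => (hs _ (Or.inr (Nat.le_add_right W i))).trans (h.2 i)⟩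

lemma RAMContext.BoundedBy.mono {a : α} {B B' : ℕ} (h : RAMContext.BoundedBy a B) (hB : B ≤ B') :
    RAMContext.BoundedBy a B' :=
  ⟨fun i => (h.1 i).trans hB, fun v hv => (h.2 v hv).trans hB⟩

lemma mul_pow_le_pow_add {B c m : ℕ} (hB : 2 ≤ B) : c * B ^ m ≤ B ^ (m + c) := by
  rw [pow_add, mul_comm]
  exact Nat.mul_le_mul_left _ (Nat.lt_two_pow_self.le.trans (Nat.pow_le_pow_left hB c))

namespace PolyComputable

lemma congr {f g : α → ℕ} (hf : PolyComputable f) (h : ∀ a, f a = g a) : PolyComputable g := by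
  have : f = g := funext h
  exact this ▸ hf

lemma const (c : ℕ) : PolyComputable fun _ : α => c := by
  refine ⟨c + 1, 1, by omega, fun a B hB _ => ?_, fun loc k W hloc hW =>
    ⟨.const k c, fun ℓ n X s a B hB hb hs => ?_⟩⟩
  · exact Nat.lt_two_pow_self.le.trans ((Nat.pow_le_pow_left hB c).trans
      (Nat.pow_le_pow_right (by omega) (by omega)))
  · refine ⟨1, _, .const k c s, Nat.one_le_pow _ _ (by omega), rfl, by simp [RAMState.write_mem],
      fun d hd => ?_⟩
    rw [RAMState.write_mem, if_neg (by omega)]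

lemma var {v : ℕ} (hv : v < RAMContext.size α) :
    PolyComputable fun a : α => RAMContext.var a v := by
  refine ⟨1, 1, le_rfl, fun a B hB hb => by simpa using hb.2 v hv, fun loc k W hloc hW =>
    ⟨.seq (.const k 0) (.add k (loc v) k), fun ℓ n X s a B hB hb hs => ?_⟩⟩
  have hk : loc v ≠ k := (hloc v hv).ne
  refine ⟨_, _, .seq (.const k 0 s) (.add k (loc v) k _), by simpa using hB, rfl, ?_, fun d hd => ?_⟩
  · simp [RAMState.write_mem, hk, hs.1 v hv]
  · have : d ≠ k := by omega
    simp [RAMState.write_mem, this]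

lemma add {f g : α → ℕ} (hf : PolyComputable f) (hg : PolyComputable g) :
    PolyComputable fun a => f a + g a := by
  obtain ⟨q, m, hq, hv, hp⟩ := hf
  obtain ⟨q', m', hq', hv', hp'⟩ := hg
  have key : ∀ B x y, 2 ≤ B → x ≤ B ^ q → y ≤ B ^ q' → x + (y + 1) ≤ B ^ (q + q' + 3) := by
    intro B x y hB hx hy
    have h1 := hx.trans (Nat.pow_le_pow_right (by omega : 0 < B) (by omega : q ≤ q + q'))
    have h2 := hy.trans (Nat.pow_le_pow_right (by omega : 0 < B) (by omega : q' ≤ q + q'))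
    have h3 := Nat.one_le_pow (q + q') B (by omega)
    have h4 := mul_pow_le_pow_add (c := 3) (m := q + q') hB
    omega
  refine ⟨q + q' + 3, m + m' + 2, by omega, fun a B hB hb =>
    (by have := key B _ _ hB (hv a B hB hb) (hv' a B hB hb); dsimp only; omega), fun loc k W hloc hW => ?_⟩
  obtain ⟨p, hp⟩ := hp loc k W hloc (by omega)
  obtain ⟨p', hp'⟩ := hp' loc (k + 1) W (fun v h => (hloc v h).trans (Nat.lt_succ_self k)) (by omega)
  refine ⟨.seq p (.seq p' (.add k k (k + 1))), fun ℓ n X s a B hB hb hs => ?_⟩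
  obtain ⟨t, s₁, he, ht, hd, hr, hfr⟩ := hp ℓ n X s a B hB hb hs
  obtain ⟨t', s₂, he', ht', hd', hr', hfr'⟩ := hp' ℓ n X s₁ a B hB hb (hs.congr hloc hfr)
  refine ⟨_, _, .seq he (.seq he' (.add k k (k + 1) s₂)), key B _ _ hB ht ht', ?_, ?_, fun d hd => ?_⟩
  · rw [RAMState.write_drawn, hd', hd]
  · rw [RAMState.write_mem, if_pos rfl, hr', hfr' k (Or.inl (by omega)), hr]
  · rw [RAMState.write_mem, if_neg (by omega), hfr' d (by omega), hfr d hd]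

lemma sub {f g : α → ℕ} (hf : PolyComputable f) (hg : PolyComputable g) :
    PolyComputable fun a => f a - g a := by
  obtain ⟨q, m, hq, hv, hp⟩ := hf
  obtain ⟨q', m', hq', hv', hp'⟩ := hg
  have key : ∀ B x y, 2 ≤ B → x ≤ B ^ q → y ≤ B ^ q' → x + (y + 1) ≤ B ^ (q + q' + 3) := by
    intro B x y hB hx hy
    have h1 := hx.trans (Nat.pow_le_pow_right (by omega : 0 < B) (by omega : q ≤ q + q'))
    have h2 := hy.trans (Nat.pow_le_pow_right (by omega : 0 < B) (by omega : q' ≤ q + q'))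
    have h3 := Nat.one_le_pow (q + q') B (by omega)
    have h4 := mul_pow_le_pow_add (c := 3) (m := q + q') hB
    omega
  refine ⟨q + q' + 3, m + m' + 2, by omega, fun a B hB hb =>
    (by have := key B _ _ hB (hv a B hB hb) (hv' a B hB hb); dsimp only; omega), fun loc k W hloc hW => ?_⟩
  obtain ⟨p, hp⟩ := hp loc k W hloc (by omega)
  obtain ⟨p', hp'⟩ := hp' loc (k + 1) W (fun v h => (hloc v h).trans (Nat.lt_succ_self k)) (by omega)
  refine ⟨.seq p (.seq p' (.sub k k (k + 1))), fun ℓ n X s a B hB hb hs => ?_⟩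
  obtain ⟨t, s₁, he, ht, hd, hr, hfr⟩ := hp ℓ n X s a B hB hb hs
  obtain ⟨t', s₂, he', ht', hd', hr', hfr'⟩ := hp' ℓ n X s₁ a B hB hb (hs.congr hloc hfr)
  refine ⟨_, _, .seq he (.seq he' (.sub k k (k + 1) s₂)), key B _ _ hB ht ht', ?_, ?_, fun d hd => ?_⟩
  · rw [RAMState.write_drawn, hd', hd]
  · rw [RAMState.write_mem, if_pos rfl, hr', hfr' k (Or.inl (by omega)), hr]
  · rw [RAMState.write_mem, if_neg (by omega), hfr' d (by omega), hfr d hd]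

lemma get {f : α → ℕ} (hf : PolyComputable f) :
    PolyComputable fun a => RAMContext.mem a (f a) := by
  obtain ⟨q, m, hq, hv, hp⟩ := hf
  refine ⟨q + 4, m + 2, by omega, fun a B hB hb => (hb.1 _).trans ?_, fun loc k W hloc hW => ?_⟩
  · exact Nat.le_self_pow (by omega) B
  obtain ⟨p, hp⟩ := hp loc k W hloc (by omega)
  refine ⟨.seq p (.seq (.const (k + 1) W) (.seq (.add k k (k + 1)) (.load k k))),
    fun ℓ n X s a B hB hb hs => ?_⟩
  obtain ⟨t, s₁, he, ht, hd, hr, hfr⟩ := hp ℓ n X s a B hB hb hs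
  refine ⟨_, _, .seq he (.seq (.const (k + 1) W s₁) (.seq (.add k k (k + 1) _) (.load k k _))),
    ?_, hd, ?_, fun d hd => ?_⟩
  · have h3 := Nat.one_le_pow q B (by omega)
    have h4 := mul_pow_le_pow_add (c := 4) (m := q) hB
    omega
  · have h1 : f a + W ≠ k := by omega
    have h2 : f a + W ≠ k + 1 := by omega
    simp [RAMState.write_mem, hr, h1, h2]
    rw [hfr _ (Or.inr (by omega)), add_comm, hs.2]
  · have h1 : d ≠ k := by omega
    have h2 : d ≠ k + 1 := by omega
    simp [RAMState.write_mem, h1, h2]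
    exact hfr d hd

lemma sum {g : α → ℕ} {h : α → ℕ → ℕ} (hg : PolyComputable g)
    (hh : PolyComputable fun p : α × ℕ => h p.1 p.2) :
    PolyComputable fun a => ∑ i ∈ Finset.range (g a), h a i := by
  obtain ⟨q, m, hq, hv, hp⟩ := hg
  obtain ⟨q', m', hq', hv', hp'⟩ := hh
  have hext : ∀ a B i, 2 ≤ B → RAMContext.BoundedBy a B → i < g a →
      2 ≤ B ^ q ∧ RAMContext.BoundedBy ((a, i) : α × ℕ) (B ^ q) := by
    intro a B i hB hb hi
    have h1 : B ≤ B ^ q := Nat.le_self_pow (by omega) B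
    refine ⟨hB.trans h1, fun j => (hb.1 j).trans h1, fun v hv1 => ?_⟩
    change (if v = RAMContext.size α then i else RAMContext.var a v) ≤ _
    split_ifs with hvs
    · exact hi.le.trans (hv a B hB hb)
    · have : v < RAMContext.size α + 1 := hv1
      exact (hb.2 v (by omega)).trans h1
  refine ⟨q + q + q * q' + 16, m + m' + 5, by omega, fun a B hB hb => ?_, fun loc k W hloc hW => ?_⟩
  · calc ∑ i ∈ Finset.range (g a), h a i ≤ ∑ _i ∈ Finset.range (g a), (B ^ q) ^ q' := by
          refine Finset.sum_le_sum fun i hi => ?_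
          obtain ⟨h1, h2⟩ := hext a B i hB hb (Finset.mem_range.1 hi)
          exact hv' (a, i) (B ^ q) h1 h2
      _ = g a * B ^ (q * q') := by simp [pow_mul]
      _ ≤ B ^ q * B ^ (q * q') := Nat.mul_le_mul_right _ (hv a B hB hb)
      _ = B ^ (q + q * q') := (pow_add _ _ _).symm
      _ ≤ _ := Nat.pow_le_pow_right (by omega) (by omega)
  obtain ⟨p, hp⟩ := hp loc k W hloc (by omega)
  obtain ⟨p', hp'⟩ := hp' (fun v => if v = RAMContext.size α then k + 2 else loc v) (k + 3) W
    (fun v hv => by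
      have hv : v < RAMContext.size α + 1 := hv
      split_ifs with h
      · omega
      · exact (hloc v (by omega)).trans (by omega)) (by omega)
  refine ⟨.seq p (.seq (.const (k + 1) 0) (.seq (.const (k + 2) 0) (.seq
    (.loop k (.seq p' (.seq (.add (k + 1) (k + 1) (k + 3)) (.seq (.const (k + 3) 1)
      (.seq (.add (k + 2) (k + 2) (k + 3)) (.sub k k (k + 3)))))))
    (.seq (.const k 0) (.add k k (k + 1)))))), fun ℓ n X s a B hB hb hs => ?_⟩
  obtain ⟨t, s₁, he, ht, hd, hr, hfr⟩ := hp ℓ n X s a B hB hb hs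
  let Inv : ℕ → RAMState → Prop := fun i s' => s'.mem k = g a - i ∧
    s'.mem (k + 1) = ∑ j ∈ Finset.range i, h a j ∧ s'.mem (k + 2) = i ∧ s'.drawn = s.drawn ∧
    ∀ c, c < k ∨ W ≤ c → s'.mem c = s.mem c
  obtain ⟨t₂, s₂, he₂, ht₂, hi₂⟩ := RAMProgram.exec_loop (X := X) (c := k) (G := g a)
    (T := B ^ (q * q') + 4)
    (p := .seq p' (.seq (.add (k + 1) (k + 1) (k + 3)) (.seq (.const (k + 3) 1)
      (.seq (.add (k + 2) (k + 2) (k + 3)) (.sub k k (k + 3)))))) Inv (fun i s' h => h.1)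
    (fun i s' hi hinv => by
      obtain ⟨hk, hk1, hk2, hdr, hfr'⟩ := hinv
      obtain ⟨h1, h2⟩ := hext a B i hB hb hi
      have hheld : RAMContext.HeldBy (fun v => if v = RAMContext.size α then k + 2 else loc v) W s'
          ((a, i) : α × ℕ) := by
        refine ⟨fun v hv => ?_, fun j => ?_⟩
        · change s'.mem (if v = RAMContext.size α then k + 2 else loc v)
            = if v = RAMContext.size α then i else RAMContext.var a v
          have hv : v < RAMContext.size α + 1 := hv
          split_ifs with hvs
          · exact hk2
          · rw [hfr' _ (Or.inl (hloc v (by omega))), hs.1 v (by omega)]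
        · rw [hfr' _ (Or.inr (Nat.le_add_right _ _))]; exact hs.2 j
      obtain ⟨t', s₃, he₃, ht₃, hd₃, hr₃, hfr₃⟩ := hp' ℓ n X s' (a, i) (B ^ q) h1 h2 hheld
      refine ⟨_, _, .seq he₃ (.seq (.add (k + 1) (k + 1) (k + 3) s₃) (.seq (.const (k + 3) 1 _)
        (.seq (.add (k + 2) (k + 2) (k + 3) _) (.sub k k (k + 3) _)))), ?_, ?_, ?_, ?_, ?_, ?_⟩
      · rw [← pow_mul] at ht₃; omega
      · simp [RAMState.write_mem, hfr₃ k (Or.inl (by omega)), hk]; omega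
      · simp [RAMState.write_mem, hfr₃ (k + 1) (Or.inl (by omega)), hk1, hr₃, Finset.sum_range_succ]
      · simp [RAMState.write_mem, hfr₃ (k + 2) (Or.inl (by omega)), hk2]
      · simp only [RAMState.write_drawn]; rw [hd₃, hdr]
      · intro c hc
        have c0 : c ≠ k := by omega
        have c1 : c ≠ k + 1 := by omega
        have c2 : c ≠ k + 2 := by omega
        have c3 : c ≠ k + 3 := by omega
        simp only [RAMState.write_mem, c0, c1, c2, c3, if_false]
        rw [hfr₃ c (by omega), hfr' c hc])
    (s := (s₁.write (k + 1) 0).write (k + 2) 0) (by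
      refine ⟨?_, ?_, ?_, hd, ?_⟩
      · simp [RAMState.write_mem, hr]
      · simp [RAMState.write_mem]
      · simp [RAMState.write_mem]
      · intro c hc
        have c1 : c ≠ k + 1 := by omega
        have c2 : c ≠ k + 2 := by omega
        simp [RAMState.write_mem, c1, c2, hfr c hc])
  obtain ⟨-, hk1, -, hdr, hfr'⟩ := hi₂
  refine ⟨_, _, .seq he (.seq (.const (k + 1) 0 s₁) (.seq (.const (k + 2) 0 _) (.seq he₂
    (.seq (.const k 0 s₂) (.add k k (k + 1) _))))), ?_, ?_, ?_, ?_⟩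
  · have hg := hv a B hB hb
    have h1 : g a * (B ^ (q * q') + 4 + 1) ≤ B ^ q * (B ^ (q * q') + 5) := Nat.mul_le_mul_right _ hg
    have h2 : B ^ q * (B ^ (q * q') + 5) = B ^ (q + q * q') + 5 * B ^ q := by
      rw [pow_add]; ring
    have h3 : B ^ (q + q * q') ≤ B ^ (q + q + q * q') :=
      Nat.pow_le_pow_right (by omega) (by omega)
    have h4 : B ^ q ≤ B ^ (q + q + q * q') := Nat.pow_le_pow_right (by omega) (by omega)
    have h5 := Nat.one_le_pow (q + q + q * q') B (by omega)
    have h6 := mul_pow_le_pow_add (c := 16) (m := q + q + q * q') hB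
    omega
  · simp only [RAMState.write_drawn]; exact hdr
  · simp [RAMState.write_mem, hk1]
  · intro c hc
    have c0 : c ≠ k := by omega
    simp [RAMState.write_mem, c0, hfr' c hc]

lemma fst {f : α → ℕ} (hf : PolyComputable f) : PolyComputable fun p : α × ℕ => f p.1 := by
  obtain ⟨q, m, hq, hv, hp⟩ := hf
  have hb' : ∀ (a : α × ℕ) B, RAMContext.BoundedBy a B → RAMContext.BoundedBy a.1 B := by
    intro a B hb
    refine ⟨hb.1, fun v hv => ?_⟩
    have h1 := hb.2 v (Nat.lt_succ_of_lt hv)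
    change (if v = RAMContext.size α then a.2 else RAMContext.var a.1 v) ≤ B at h1
    rwa [if_neg hv.ne] at h1
  refine ⟨q, m, hq, fun a B hB hb => hv a.1 B hB (hb' a B hb), fun loc k W hloc hW => ?_⟩
  obtain ⟨p, hp⟩ := hp loc k W (fun v hv => hloc v (Nat.lt_succ_of_lt hv)) hW
  refine ⟨p, fun ℓ n X s a B hB hb hs => hp ℓ n X s a.1 B hB (hb' a B hb) ⟨fun v hv => ?_, hs.2⟩⟩
  have h1 := hs.1 v (Nat.lt_succ_of_lt hv)
  change s.mem (loc v) = (if v = RAMContext.size α then a.2 else RAMContext.var a.1 v) at h1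
  rwa [if_neg hv.ne] at h1

lemma snd : PolyComputable fun p : α × ℕ => p.2 := by
  refine (var (α := α × ℕ) (Nat.lt_succ_self (RAMContext.size α))).congr fun a => ?_
  change (if RAMContext.size α = RAMContext.size α then a.2 else _) = a.2
  rw [if_pos rfl]

end PolyComputable

end Machine

namespace PolyComputable

variable {α : Type} [RAMContext α]

lemma mul {f g : α → ℕ} (hf : PolyComputable f) (hg : PolyComputable g) :
    PolyComputable fun a => f a * g a :=
  (sum (h := fun a _ => g a) hf hg.fst).congr fun a => by simp

lemma pow {f : α → ℕ} (hf : PolyComputable f) (c : ℕ) : PolyComputable fun a => f a ^ c := by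
  induction c with
  | zero => exact (const 1).congr fun a => by simp
  | succ c ih => exact (ih.mul hf).congr fun a => (pow_succ _ _).symm

lemma prod_range {c : ℕ} {f : ℕ → α → ℕ} (hf : ∀ i < c, PolyComputable (f i)) :
    PolyComputable fun a => ∏ i ∈ Finset.range c, f i a := by
  induction c with
  | zero => exact (const 1).congr fun a => by simp
  | succ c ih =>
    exact ((ih fun i hi => hf i (by omega)).mul (hf c (by omega))).congr fun a =>
      (Finset.prod_range_succ _ _).symm

lemma ite_le {f g x y : α → ℕ} (hf : PolyComputable f) (hg : PolyComputable g)
    (hx : PolyComputable x) (hy : PolyComputable y) :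
    PolyComputable fun a => if f a ≤ g a then x a else y a := by
  have h1 : PolyComputable fun a => 1 - (f a - g a) := (const 1).sub (hf.sub hg)
  refine ((h1.mul hx).add (((const 1).sub h1).mul hy)).congr fun a => ?_
  split_ifs with h
  · simp [Nat.sub_eq_zero_of_le h]
  · have : 1 - (f a - g a) = 0 := by omega
    simp [this]

lemma dist {f g : α → ℕ} (hf : PolyComputable f) (hg : PolyComputable g) :
    PolyComputable fun a => Nat.dist (f a) (g a) :=
  ((hf.sub hg).add (hg.sub hf)).congr fun _ => rfl

lemma ite_eq {f g x y : α → ℕ} (hf : PolyComputable f) (hg : PolyComputable g)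
    (hx : PolyComputable x) (hy : PolyComputable y) :
    PolyComputable fun a => if f a = g a then x a else y a :=
  (ite_le (hf.dist hg) (const 0) hx hy).congr fun a => by
    have : Nat.dist (f a) (g a) ≤ 0 ↔ f a = g a :=
      ⟨fun h => Nat.eq_of_dist_eq_zero (Nat.le_zero.1 h), fun h => by rw [h, Nat.dist_self]⟩
    simp only [this]

lemma div {f g : α → ℕ} (hf : PolyComputable f) (hg : PolyComputable g) :
    PolyComputable fun a => f a / g a := by
  refine (ite_eq hg (const 0) (const 0) (sum (h := fun a i => if (i + 1) * g a ≤ f a then 1 else 0)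
    hf (ite_le ((snd.add (const 1)).mul hg.fst) hf.fst (const 1) (const 0)))).congr fun a => ?_
  split_ifs with h
  · simp [h]
  · have hpos : 0 < g a := Nat.pos_of_ne_zero h
    have h1 : (Finset.range (f a)).filter (fun i => (i + 1) * g a ≤ f a)
        = Finset.range (f a / g a) := by
      ext i
      simp only [Finset.mem_filter, Finset.mem_range, ← Nat.le_div_iff_mul_le hpos]
      have := Nat.div_le_self (f a) (g a)
      omega
    rw [← Finset.card_filter, h1, Finset.card_range]

lemma mod {f g : α → ℕ} (hf : PolyComputable f) (hg : PolyComputable g) :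
    PolyComputable fun a => f a % g a :=
  (hf.sub (hg.mul (hf.div hg))).congr fun a => by
    have := Nat.div_add_mod (f a) (g a)
    omega

end PolyComputable

/-- The integers and the array on which the recovery algorithm operates. -/
structure RecoveryData where
  n : ℕ
  R : ℕ
  E : ℕ
  G : ℕ
  T : ℕ
  mem : ℕ → ℕ

namespace RecoveryData

variable (ℓ c : ℕ) (I : RecoveryData)

/-- The base of which all accuracies are powers. -/
def base : ℕ := 2 ^ (ℓ + 4) * (ℓ + c + 8) * (I.n * I.R * I.E * I.G * I.T)

/-- The number of documents. -/
def docs : ℕ := I.base ℓ c ^ (10 * ℓ + 57)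

/-- The reciprocal of the width of the grid of coefficients. -/
def grid : ℕ := I.base ℓ c ^ (4 * ℓ + 28)

/-- The digit that represents the coefficient zero. -/
def offset : ℕ := I.base ℓ c ^ (5 * ℓ + 28)

/-- The number of values of a digit. -/
def radix : ℕ := I.base ℓ c ^ (5 * ℓ + 29)

/-- The reciprocal of the tolerance in the acceptance tests. -/
def tolInv : ℕ := I.base ℓ c ^ (4 * ℓ + 24)

/-- The Kruskal rank that is tested. -/
def rank : ℕ := (2 * I.R + ℓ - 1) / ℓ + 1

/-- The number of digits of a candidate. -/
def len : ℕ := I.R * I.R + I.R + I.R * ℓ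

/-- The number of candidates, from the table of powers of the radix. -/
def total : ℕ := I.mem (I.docs ℓ c * ℓ + I.len ℓ)

/-- The `i`-th digit of `z`. -/
def digit (z i : ℕ) : ℕ := z / I.mem (I.docs ℓ c * ℓ + i) % I.radix ℓ c

/-- The number of sampled documents that are equal to `w`. -/
def count (w : ℕ → ℕ) : ℕ := ∑ j ∈ Finset.range (I.docs ℓ c),
  ∏ a ∈ Finset.range ℓ, if I.mem (j * ℓ + a) = w a then 1 else 0

/-- The document that starts with the word `i` and goes on with the `j`-th fibre of the candidate. -/
def fibre (z i j a : ℕ) : ℕ :=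
  if a = 0 then i else I.digit ℓ c z (I.R * I.R + I.R + j * ℓ + a)

/-- The common denominator. -/
def den : ℕ := I.docs ℓ c * I.grid ℓ c

/-- The numerators of the word matrix of a candidate. -/
def wordNum (z i s : ℕ) : ℕ :=
  ∑ j ∈ Finset.range I.R, I.count ℓ c (I.fibre ℓ c z i j) * I.digit ℓ c z (s * I.R + j)
    - ∑ j ∈ Finset.range I.R, I.count ℓ c (I.fibre ℓ c z i j) * I.offset ℓ c

/-- The numerators of the weights of a candidate. -/
def weightNum (z s : ℕ) : ℕ := I.digit ℓ c z (I.R * I.R + s) * I.docs ℓ c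

/-- The number of entries at which the tensor of a candidate is far from the empirical tensor. -/
def badTensor (z : ℕ) : ℕ := ∑ x ∈ Finset.range (I.n ^ ℓ),
  if I.tolInv ℓ c * Nat.dist
      (∑ s ∈ Finset.range I.R, I.weightNum ℓ c z s *
        ∏ a ∈ Finset.range ℓ, I.wordNum ℓ c z (x / I.n ^ a % I.n) s)
      (I.count ℓ c (fun a => x / I.n ^ a % I.n) * I.grid ℓ c * I.den ℓ c ^ ℓ)
      ≤ I.den ℓ c ^ (ℓ + 1) then 0 else 1

/-- The number of columns of a candidate whose sum is far from one. -/
def badSum (z : ℕ) : ℕ := ∑ s ∈ Finset.range I.R,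
  if I.tolInv ℓ c * Nat.dist (∑ i ∈ Finset.range I.n, I.wordNum ℓ c z i s) (I.den ℓ c) ≤ I.den ℓ c
  then 0 else 1

/-- The number of violations of the robust Kruskal rank condition. -/
def badRank (z : ℕ) : ℕ := ∑ y ∈ Finset.range (I.total ℓ c),
  if ∑ j ∈ Finset.range I.R, (if I.digit ℓ c y j = I.offset ℓ c then 0 else 1) ≤ I.rank ℓ then
    ∑ s ∈ Finset.range I.R,
      if Nat.dist (I.digit ℓ c y s) (I.offset ℓ c) * I.den ℓ c ≤
        2 * I.T * ∑ i ∈ Finset.range I.n,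
          Nat.dist (∑ j ∈ Finset.range I.R, I.wordNum ℓ c z i j * I.digit ℓ c y j)
            (∑ j ∈ Finset.range I.R, I.wordNum ℓ c z i j * I.offset ℓ c)
      then 0 else 1
  else 0

/-- The number of failed tests. -/
def bad (z : ℕ) : ℕ := I.badTensor ℓ c z + I.badSum ℓ c z + I.badRank ℓ c z

/-- The first candidate that passes all tests. -/
def select : ℕ := ∑ y ∈ Finset.range (I.total ℓ c),
  if ∑ z ∈ Finset.range (y + 1), (if I.bad ℓ c z = 0 then 1 else 0) = 0 then 1 else 0

/-- The contents of the cell `j` of the output for the candidate `z`. -/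
def output (z j : ℕ) : ℕ :=
  if j = 0 then I.den ℓ c
  else if j ≤ I.n * I.R then I.wordNum ℓ c z ((j - 1) / I.R) ((j - 1) % I.R)
  else I.weightNum ℓ c z (j - 1 - I.n * I.R)

end RecoveryData

open PolyComputable in
/-- The integers in `e a` are computable, and its array is a computable initial part of that of
the context, followed by zeros. -/
structure RecoveryData.Readable {α : Type} [RAMContext α] (e : α → RecoveryData) : Prop where
  n : PolyComputable fun a => (e a).n
  R : PolyComputable fun a => (e a).R
  E : PolyComputable fun a => (e a).E
  G : PolyComputable fun a => (e a).G
  T : PolyComputable fun a => (e a).T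
  lim : ∃ lim : α → ℕ, PolyComputable lim ∧
    ∀ a i, (e a).mem i = if lim a ≤ i then 0 else RAMContext.mem a i

namespace RecoveryData.Readable

open PolyComputable

variable {α : Type} [RAMContext α] {e : α → RecoveryData} (he : Readable e) (ℓ c : ℕ)

include he

lemma fst : Readable fun p : α × ℕ => e p.1 :=
  ⟨he.n.fst, he.R.fst, he.E.fst, he.G.fst, he.T.fst, by
    obtain ⟨lim, h1, h2⟩ := he.lim
    exact ⟨fun p => lim p.1, h1.fst, fun p => h2 p.1⟩⟩

lemma mem {f : α → ℕ} (hf : PolyComputable f) : PolyComputable fun a => (e a).mem (f a) := by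
  obtain ⟨lim, h1, h2⟩ := he.lim
  exact (ite_le h1 hf (const 0) (get hf)).congr fun a => (h2 a _).symm

lemma base : PolyComputable fun a => (e a).base ℓ c :=
  (const _).mul ((((he.n.mul he.R).mul he.E).mul he.G).mul he.T)

lemma docs : PolyComputable fun a => (e a).docs ℓ c := (he.base ℓ c).pow _

lemma grid : PolyComputable fun a => (e a).grid ℓ c := (he.base ℓ c).pow _

lemma offset : PolyComputable fun a => (e a).offset ℓ c := (he.base ℓ c).pow _

lemma radix : PolyComputable fun a => (e a).radix ℓ c := (he.base ℓ c).pow _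

lemma tolInv : PolyComputable fun a => (e a).tolInv ℓ c := (he.base ℓ c).pow _

lemma rank : PolyComputable fun a => (e a).rank ℓ :=
  (((((const 2).mul he.R).add (const ℓ)).sub (const 1)).div (const ℓ)).add (const 1)

lemma len : PolyComputable fun a => (e a).len ℓ :=
  ((he.R.mul he.R).add he.R).add (he.R.mul (const ℓ))

lemma total : PolyComputable fun a => (e a).total ℓ c :=
  he.mem (((he.docs ℓ c).mul (const ℓ)).add (he.len ℓ))

lemma digit {z i : α → ℕ} (hz : PolyComputable z) (hi : PolyComputable i) :
    PolyComputable fun a => (e a).digit ℓ c (z a) (i a) :=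
  (hz.div (he.mem (((he.docs ℓ c).mul (const ℓ)).add hi))).mod (he.radix ℓ c)

lemma count {w : α → ℕ → ℕ} (hw : ∀ i < ℓ, PolyComputable fun a => w a i) :
    PolyComputable fun a => (e a).count ℓ c (w a) :=
  sum (h := fun a j => ∏ i ∈ Finset.range ℓ, if (e a).mem (j * ℓ + i) = w a i then 1 else 0)
    (he.docs ℓ c) (prod_range fun i hi =>
      ite_eq (he.fst.mem ((snd.mul (const ℓ)).add (const i))) (hw i hi).fst (const 1) (const 0))

lemma fibre {z i j : α → ℕ} (hz : PolyComputable z) (hi : PolyComputable i)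
    (hj : PolyComputable j) (b : ℕ) :
    PolyComputable fun a => (e a).fibre ℓ c (z a) (i a) (j a) b :=
  ite_eq (const b) (const 0) hi (he.digit ℓ c hz
    ((((he.R.mul he.R).add he.R).add (hj.mul (const ℓ))).add (const b)))

lemma den : PolyComputable fun a => (e a).den ℓ c := (he.docs ℓ c).mul (he.grid ℓ c)

lemma wordNum {z i s : α → ℕ} (hz : PolyComputable z) (hi : PolyComputable i)
    (hs : PolyComputable s) : PolyComputable fun a => (e a).wordNum ℓ c (z a) (i a) (s a) :=
  (sum (h := fun a j => (e a).count ℓ c ((e a).fibre ℓ c (z a) (i a) j)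
      * (e a).digit ℓ c (z a) (s a * (e a).R + j)) he.R
    ((he.fst.count ℓ c (w := fun p => (e p.1).fibre ℓ c (z p.1) (i p.1) p.2)
      fun b _ => he.fst.fibre ℓ c hz.fst hi.fst snd b).mul
      (he.fst.digit ℓ c hz.fst ((hs.fst.mul he.R.fst).add snd)))).sub
  (sum (h := fun a j => (e a).count ℓ c ((e a).fibre ℓ c (z a) (i a) j) * (e a).offset ℓ c) he.R
    ((he.fst.count ℓ c (w := fun p => (e p.1).fibre ℓ c (z p.1) (i p.1) p.2)
      fun b _ => he.fst.fibre ℓ c hz.fst hi.fst snd b).mul (he.fst.offset ℓ c)))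

lemma weightNum {z s : α → ℕ} (hz : PolyComputable z) (hs : PolyComputable s) :
    PolyComputable fun a => (e a).weightNum ℓ c (z a) (s a) :=
  (he.digit ℓ c hz ((he.R.mul he.R).add hs)).mul (he.docs ℓ c)

lemma tensorWord (b : ℕ) : PolyComputable fun p : α × ℕ => p.2 / (e p.1).n ^ b % (e p.1).n :=
  (snd.div (he.fst.n.pow b)).mod he.fst.n

lemma badTensor {z : α → ℕ} (hz : PolyComputable z) :
    PolyComputable fun a => (e a).badTensor ℓ c (z a) := by
  refine sum (g := fun a => (e a).n ^ ℓ) (he.n.pow ℓ) (ite_le ((he.fst.tolInv ℓ c).mul (dist ?_ ?_))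
    ((he.fst.den ℓ c).pow (ℓ + 1)) (const 0) (const 1))
  · refine sum (h := fun (p : α × ℕ) s => (e p.1).weightNum ℓ c (z p.1) s *
      ∏ b ∈ Finset.range ℓ, (e p.1).wordNum ℓ c (z p.1) (p.2 / (e p.1).n ^ b % (e p.1).n) s)
      he.fst.R ((he.fst.fst.weightNum ℓ c hz.fst.fst snd).mul (prod_range fun b _ => ?_))
    exact he.fst.fst.wordNum ℓ c hz.fst.fst (he.tensorWord b).fst snd
  · exact ((he.fst.count ℓ c (w := fun p b => p.2 / (e p.1).n ^ b % (e p.1).n)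
      fun b _ => he.tensorWord b).mul (he.fst.grid ℓ c)).mul ((he.fst.den ℓ c).pow ℓ)

lemma badSum {z : α → ℕ} (hz : PolyComputable z) :
    PolyComputable fun a => (e a).badSum ℓ c (z a) :=
  sum he.R (ite_le ((he.fst.tolInv ℓ c).mul (dist
    (sum (h := fun (p : α × ℕ) i => (e p.1).wordNum ℓ c (z p.1) i p.2) he.fst.n
      (he.fst.fst.wordNum ℓ c hz.fst.fst snd snd.fst)) (he.fst.den ℓ c)))
    (he.fst.den ℓ c) (const 0) (const 1))

lemma badRank {z : α → ℕ} (hz : PolyComputable z) :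
    PolyComputable fun a => (e a).badRank ℓ c (z a) := by
  refine sum (he.total ℓ c) (ite_le ?_ (he.fst.rank ℓ) ?_ (const 0))
  · exact sum (h := fun (p : α × ℕ) j =>
      if (e p.1).digit ℓ c p.2 j = (e p.1).offset ℓ c then 0 else 1) he.fst.R
      (ite_eq (he.fst.fst.digit ℓ c snd.fst snd) (he.fst.fst.offset ℓ c) (const 0) (const 1))
  · have h3 := he.fst.fst.fst
    refine sum (h := fun (p : α × ℕ) s =>
      if Nat.dist ((e p.1).digit ℓ c p.2 s) ((e p.1).offset ℓ c) * (e p.1).den ℓ c ≤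
        2 * (e p.1).T * ∑ i ∈ Finset.range (e p.1).n,
          Nat.dist (∑ j ∈ Finset.range (e p.1).R,
              (e p.1).wordNum ℓ c (z p.1) i j * (e p.1).digit ℓ c p.2 j)
            (∑ j ∈ Finset.range (e p.1).R, (e p.1).wordNum ℓ c (z p.1) i j * (e p.1).offset ℓ c)
      then 0 else 1) he.fst.R
      (ite_le ((dist (he.fst.fst.digit ℓ c snd.fst snd) (he.fst.fst.offset ℓ c)).mul
        (he.fst.fst.den ℓ c)) (((const 2).mul he.fst.fst.T).mul ?_) (const 0) (const 1))
    refine sum (h := fun (p : (α × ℕ) × ℕ) i =>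
          Nat.dist (∑ j ∈ Finset.range (e p.1.1).R,
              (e p.1.1).wordNum ℓ c (z p.1.1) i j * (e p.1.1).digit ℓ c p.1.2 j)
            (∑ j ∈ Finset.range (e p.1.1).R,
              (e p.1.1).wordNum ℓ c (z p.1.1) i j * (e p.1.1).offset ℓ c))
      he.fst.fst.n (dist ?_ ?_)
    · exact sum (h := fun (p : ((α × ℕ) × ℕ) × ℕ) j => (e p.1.1.1).wordNum ℓ c (z p.1.1.1) p.2 j
        * (e p.1.1.1).digit ℓ c p.1.1.2 j) h3.R
        ((h3.fst.wordNum ℓ c hz.fst.fst.fst.fst snd.fst snd).mul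
          (h3.fst.digit ℓ c snd.fst.fst.fst snd))
    · exact sum (h := fun (p : ((α × ℕ) × ℕ) × ℕ) j => (e p.1.1.1).wordNum ℓ c (z p.1.1.1) p.2 j
        * (e p.1.1.1).offset ℓ c) h3.R
        ((h3.fst.wordNum ℓ c hz.fst.fst.fst.fst snd.fst snd).mul (h3.fst.offset ℓ c))

lemma bad {z : α → ℕ} (hz : PolyComputable z) : PolyComputable fun a => (e a).bad ℓ c (z a) :=
  ((he.badTensor ℓ c hz).add (he.badSum ℓ c hz)).add (he.badRank ℓ c hz)

lemma select : PolyComputable fun a => (e a).select ℓ c :=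
  sum (he.total ℓ c) (ite_eq (sum (h := fun (p : α × ℕ) z =>
    if (e p.1).bad ℓ c z = 0 then 1 else 0) (snd.add (const 1))
    (ite_eq (he.fst.fst.bad ℓ c snd) (const 0) (const 1) (const 0))) (const 0) (const 1) (const 0))

lemma output {z j : α → ℕ} (hz : PolyComputable z) (hj : PolyComputable j) :
    PolyComputable fun a => (e a).output ℓ c (z a) (j a) :=
  ite_eq hj (const 0) (he.den ℓ c) (ite_le hj (he.n.mul he.R)
    (he.wordNum ℓ c hz ((hj.sub (const 1)).div he.R) ((hj.sub (const 1)).mod he.R))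
    (he.weightNum ℓ c hz ((hj.sub (const 1)).sub (he.n.mul he.R))))

end RecoveryData.Readable

/-- The contents of the variables and of the array of the recovery program. -/
structure RAMEnv where
  mem : ℕ → ℕ
  reg : ℕ → ℕ

instance : RAMContext RAMEnv := ⟨8, RAMEnv.mem, RAMEnv.reg⟩

namespace RAMEnv

/-- Overwrite a variable. -/
def setReg (x : RAMEnv) (v a : ℕ) : RAMEnv := ⟨x.mem, Function.update x.reg v a⟩

/-- The state holds the environment: variables in the cells `0, …, 7`, the array from `W` on. -/
abbrev HeldBy (W : ℕ) (s : RAMState) (x : RAMEnv) : Prop := RAMContext.HeldBy id W s x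

lemma polyComputable_reg {v : ℕ} (hv : v < 8) : PolyComputable fun x : RAMEnv => x.reg v :=
  PolyComputable.var (α := RAMEnv) hv

/-- Some program transforms the environment by `F`, in time polynomial in any `B` that satisfies
`ok`. -/
def Implementable (F : RAMEnv → RAMEnv) (ok : RAMEnv → ℕ → Prop) : Prop :=
  ∃ q need : ℕ, ∀ W, need ≤ W → ∃ p : RAMProgram,
    ∀ (ℓ n : ℕ) (X : ℕ → Fin ℓ → Fin n) (s : RAMState) (x : RAMEnv) (B : ℕ), 2 ≤ B → ok x B →
      x.HeldBy W s → ∃ t s', RAMProgram.Exec X p s t s' ∧ t ≤ B ^ q ∧ s'.drawn = s.drawn ∧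
        (F x).HeldBy W s'

lemma Implementable.comp {F F' : RAMEnv → RAMEnv} {ok ok' : RAMEnv → ℕ → Prop}
    (h : Implementable F ok) (h' : Implementable F' ok') :
    Implementable (fun x => F' (F x)) (fun x B => ok x B ∧ ok' (F x) B) := by
  obtain ⟨q, m, h⟩ := h
  obtain ⟨q', m', h'⟩ := h'
  refine ⟨q + q' + 2, m + m', fun W hW => ?_⟩
  obtain ⟨p, hp⟩ := h W (by omega)
  obtain ⟨p', hp'⟩ := h' W (by omega)
  refine ⟨.seq p p', fun ℓ n X s x B hB hok hs => ?_⟩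
  obtain ⟨t, s₁, he, ht, hd, hs₁⟩ := hp ℓ n X s x B hB hok.1 hs
  obtain ⟨t', s₂, he', ht', hd', hs₂⟩ := hp' ℓ n X s₁ (F x) B hB hok.2 hs₁
  refine ⟨_, s₂, .seq he he', ?_, hd'.trans hd, hs₂⟩
  have h1 := Nat.pow_le_pow_right (by omega : 0 < B) (by omega : q ≤ q + q')
  have h2 := Nat.pow_le_pow_right (by omega : 0 < B) (by omega : q' ≤ q + q')
  have h4 := mul_pow_le_pow_add (c := 2) (m := q + q') hB
  omega

lemma implementable_setReg {f : RAMEnv → ℕ} (hf : PolyComputable f) {v : ℕ} (hv : v < 8) :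
    Implementable (fun x => x.setReg v (f x)) RAMContext.BoundedBy := by
  obtain ⟨q, m, hq, -, hp⟩ := hf
  refine ⟨q + 3, m + 9, fun W hW => ?_⟩
  obtain ⟨p, hp⟩ := hp id 8 W (fun v hv => hv) (by omega)
  refine ⟨.seq p (.seq (.const v 0) (.add v v 8)), fun ℓ n X s x B hB hok hs => ?_⟩
  obtain ⟨t, s₁, he, ht, hd, hr, hfr⟩ := hp ℓ n X s x B hB hok hs
  refine ⟨_, _, .seq he (.seq (.const v 0 s₁) (.add v v 8 _)), ?_, hd, fun w hw => ?_, fun i => ?_⟩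
  · have h1 := Nat.one_le_pow q B (by omega)
    have h2 := mul_pow_le_pow_add (c := 3) (m := q) hB
    omega
  · have h8 : (8 : ℕ) ≠ v := by omega
    change ((_ : RAMState).mem w : ℕ) = Function.update x.reg v (f x) w
    by_cases hwv : w = v
    · subst hwv
      simp [RAMState.write_mem, h8, hr]
    · have : s.mem w = x.reg w := hs.1 w hw
      simp [RAMState.write_mem, hwv, hfr w (Or.inl hw), this]
  · have h1 : W + i ≠ v := by omega
    change ((_ : RAMState).mem (W + i) : ℕ) = x.mem i
    have : s.mem (W + i) = x.mem i := hs.2 i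
    simp [RAMState.write_mem, h1, hfr _ (Or.inr (Nat.le_add_right W i)), this]

/-- Write to the array and increment the variable `5`. -/
def putStep (addr val : RAMEnv → ℕ) (x : RAMEnv) : RAMEnv :=
  ⟨Function.update x.mem (addr x) (val x), Function.update x.reg 5 (x.reg 5 + 1)⟩

/-- Repeat `putStep`, with the variable `5` as counter from zero. -/
def putLoop (g addr val : RAMEnv → ℕ) (x : RAMEnv) : RAMEnv :=
  (putStep addr val)^[g (x.setReg 5 0)] (x.setReg 5 0)

lemma implementable_putLoop {g addr val : RAMEnv → ℕ} (hg : PolyComputable g)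
    (ha : PolyComputable addr) (hv : PolyComputable val) :
    Implementable (putLoop g addr val) fun x B =>
      ∀ i ≤ g (x.setReg 5 0), RAMContext.BoundedBy ((putStep addr val)^[i] (x.setReg 5 0)) B := by
  obtain ⟨q₁, m₁, hq₁, hb₁, hp₁⟩ := hg
  obtain ⟨q₂, m₂, hq₂, -, hp₂⟩ := ha
  obtain ⟨q₃, m₃, hq₃, -, hp₃⟩ := hv
  refine ⟨q₁ + q₂ + q₃ + q₁ + 20, m₁ + m₂ + m₃ + 12, fun W hW => ?_⟩
  obtain ⟨p₁, hp₁⟩ := hp₁ id 8 W (fun v hv => hv) (by omega)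
  obtain ⟨p₂, hp₂⟩ := hp₂ id 9 W (fun v hv => Nat.lt_succ_of_lt hv) (by omega)
  obtain ⟨p₃, hp₃⟩ := hp₃ id 10 W (fun v hv => Nat.lt_succ_of_lt (Nat.lt_succ_of_lt hv)) (by omega)
  refine ⟨.seq (.const 5 0) (.seq p₁ (.loop 8 (.seq p₂ (.seq p₃ (.seq (.const 11 W)
    (.seq (.add 9 9 11) (.seq (.store 9 10) (.seq (.const 11 1) (.seq (.add 5 5 11)
      (.sub 8 8 11)))))))))), fun ℓ n X s x B hB hok hs => ?_⟩
  set x₀ := x.setReg 5 0 with hx₀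
  have hs₀ : x₀.HeldBy W (s.write 5 0) := by
    refine ⟨fun w hw => ?_, fun i => ?_⟩
    · change (s.write 5 0).mem w = Function.update x.reg 5 0 w
      have : s.mem w = x.reg w := hs.1 w hw
      rw [RAMState.write_mem, Function.update_apply, this]
    · have h1 : W + i ≠ 5 := by omega
      rw [RAMState.write_mem, if_neg h1]; exact hs.2 i
  obtain ⟨t₁, s₁, he₁, ht₁, hd₁, hr₁, hfr₁⟩ := hp₁ ℓ n X _ x₀ B hB (hok 0 (Nat.zero_le _)) hs₀
  let Inv : ℕ → RAMState → Prop := fun i s' => s'.mem 8 = g x₀ - i ∧ s'.drawn = s.drawn ∧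
    ((putStep addr val)^[i] x₀).HeldBy W s'
  obtain ⟨t₂, s₂, he₂, ht₂, hi₂⟩ := RAMProgram.exec_loop (X := X) (c := 8) (G := g x₀)
    (T := B ^ q₂ + B ^ q₃ + 6) (p := .seq p₂ (.seq p₃ (.seq (.const 11 W)
    (.seq (.add 9 9 11) (.seq (.store 9 10) (.seq (.const 11 1) (.seq (.add 5 5 11)
      (.sub 8 8 11)))))))) Inv (fun i s' h => h.1) (fun i s' hi hinv => by
      obtain ⟨h8, hdr, hheld⟩ := hinv
      set y := (putStep addr val)^[i] x₀ with hy
      have hby := hok i hi.le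
      obtain ⟨t₃, s₃, he₃, ht₃, hd₃, hr₃, hfr₃⟩ := hp₂ ℓ n X s' y B hB hby hheld
      have hheld₃ : y.HeldBy W s₃ := hheld.congr (k := 9) (fun v hv => Nat.lt_succ_of_lt hv) hfr₃
      obtain ⟨t₄, s₄, he₄, ht₄, hd₄, hr₄, hfr₄⟩ := hp₃ ℓ n X s₃ y B hB hby hheld₃
      have hheld₄ : y.HeldBy W s₄ :=
        hheld₃.congr (k := 10) (fun v hv => Nat.lt_succ_of_lt (Nat.lt_succ_of_lt hv)) hfr₄
      have h9 : s₄.mem 9 = addr y := by rw [hfr₄ 9 (Or.inl (by omega)), hr₃]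
      have h8' : s₄.mem 8 = g x₀ - i := by
        rw [hfr₄ 8 (Or.inl (by omega)), hfr₃ 8 (Or.inl (by omega)), h8]
      have hne : ∀ v, v < 12 → v ≠ addr y + W := fun v hv => by omega
      refine ⟨_, _, .seq he₃ (.seq he₄ (.seq (.const 11 W s₄) (.seq (.add 9 9 11 _)
        (.seq (.store 9 10 _) (.seq (.const 11 1 _) (.seq (.add 5 5 11 _) (.sub 8 8 11 _))))))),
        by omega, ?_, ?_, ?_, ?_⟩
      · simp [RAMState.write_mem, h9, h8', hne 8]
        omega
      · simp only [RAMState.write_drawn]; rw [hd₄, hd₃, hdr]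
      · intro w hw
        have hw : w < 8 := hw
        rw [Function.iterate_succ_apply', ← hy]
        change _ = Function.update y.reg 5 (y.reg 5 + 1) w
        have hyw : s₄.mem w = y.reg w := hheld₄.1 w hw
        have hy5 : s₄.mem 5 = y.reg 5 := hheld₄.1 5 (by decide)
        by_cases hw5 : w = 5
        · subst hw5
          simp [RAMState.write_mem, h9, hne 5, hy5]
        · have c1 : w ≠ 8 := by omega
          have c2 : w ≠ 11 := by omega
          have c3 : w ≠ 9 := by omega
          simp [RAMState.write_mem, h9, hne w (by omega), hw5, c1, c2, c3, hyw]
      · intro j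
        rw [Function.iterate_succ_apply', ← hy]
        change _ = Function.update y.mem (addr y) (val y) j
        have hyj : s₄.mem (W + j) = y.mem j := hheld₄.2 j
        have c1 : W + j ≠ 8 := by omega
        have c2 : W + j ≠ 11 := by omega
        have c3 : W + j ≠ 9 := by omega
        have c4 : W + j ≠ 5 := by omega
        by_cases hj : j = addr y
        · subst hj
          simp [RAMState.write_mem, h9, c1, c2, c4, hr₄, add_comm]
        · have c5 : W + j ≠ addr y + W := by omega
          simp [RAMState.write_mem, h9, c1, c2, c3, c4, c5, hyj, hj])
    (s := s₁) ⟨hr₁, hd₁, hs₀.congr (k := 8) (fun v hv => hv) hfr₁⟩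
  refine ⟨_, s₂, .seq (.const 5 0 s) (.seq he₁ he₂), ?_, hi₂.2.1, hi₂.2.2⟩
  have hgb := hb₁ x₀ B hB (hok 0 (Nat.zero_le _))
  have h1 : g x₀ * (B ^ q₂ + B ^ q₃ + 6 + 1) ≤ B ^ q₁ * (B ^ q₂ + B ^ q₃ + 7) :=
    Nat.mul_le_mul_right _ hgb
  have hpow : ∀ i, i ≤ q₁ + q₂ + q₃ + q₁ → B ^ i ≤ B ^ (q₁ + q₂ + q₃ + q₁) := fun i hi =>
    Nat.pow_le_pow_right (by omega) hi
  have h2 : B ^ q₁ * (B ^ q₂ + B ^ q₃ + 7) = B ^ (q₁ + q₂) + B ^ (q₁ + q₃) + 7 * B ^ q₁ := by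
    rw [pow_add, pow_add]; ring
  have h3 := hpow (q₁ + q₂) (by omega)
  have h4 := hpow (q₁ + q₃) (by omega)
  have h5 := hpow q₁ (by omega)
  have h6 := Nat.one_le_pow (q₁ + q₂ + q₃ + q₁) B (by omega)
  have h7 := mul_pow_le_pow_add (c := 20) (m := q₁ + q₂ + q₃ + q₁) hB
  omega

lemma putStep_iterate {addr val : RAMEnv → ℕ} {x : RAMEnv} {off G : ℕ} {v : ℕ → ℕ}
    (h5 : x.reg 5 = 0) (h : ∀ i < G, ∀ y : RAMEnv,
      y = ⟨fun j => if off ≤ j ∧ j < off + i then v (j - off) else x.mem j,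
        Function.update x.reg 5 i⟩ → addr y = off + i ∧ val y = v i) :
    ∀ i ≤ G, (putStep addr val)^[i] x
      = ⟨fun j => if off ≤ j ∧ j < off + i then v (j - off) else x.mem j,
        Function.update x.reg 5 i⟩ := by
  intro i
  induction i with
  | zero =>
    intro _
    have h1 : Function.update x.reg 5 0 = x.reg := by rw [← h5, Function.update_eq_self]
    have h2 : (fun j => if off ≤ j ∧ j < off + 0 then v (j - off) else x.mem j) = x.mem := by
      funext j
      rw [if_neg (by omega)]
    rw [h1, h2, Function.iterate_zero, id]
  | succ i ih =>
    intro hi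
    obtain ⟨ha, hv⟩ := h i (by omega) _ (ih (by omega))
    rw [Function.iterate_succ_apply', putStep, ha, hv, ih (by omega)]
    congr 1
    · funext j
      change Function.update (fun j => if off ≤ j ∧ j < off + i then v (j - off) else x.mem j)
        (off + i) (v i) j = _
      rw [Function.update_apply]
      by_cases h1 : j = off + i
      · rw [if_pos h1, if_pos (by omega), h1, Nat.add_sub_cancel_left]
      · rw [if_neg h1]
        simp only [show (off ≤ j ∧ j < off + i) ↔ (off ≤ j ∧ j < off + (i + 1)) by omega]
    · simp

lemma putLoop_eq {g addr val : RAMEnv → ℕ} {x : RAMEnv} {off G : ℕ} {v : ℕ → ℕ}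
    (hg : g (x.setReg 5 0) = G) (h : ∀ i < G, ∀ y : RAMEnv,
      y = ⟨fun j => if off ≤ j ∧ j < off + i then v (j - off) else x.mem j,
        Function.update x.reg 5 i⟩ → addr y = off + i ∧ val y = v i) :
    putLoop g addr val x = ⟨fun j => if off ≤ j ∧ j < off + G then v (j - off) else x.mem j,
      Function.update x.reg 5 G⟩ := by
  have h1 := putStep_iterate (addr := addr) (val := val) (x := x.setReg 5 0) (off := off) (G := G)
    (v := v) (by simp [setReg]) (fun i hi y hy => h i hi y (by rw [hy]; simp [setReg])) G le_rfl
  rw [putLoop, hg, h1]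
  simp [setReg]

lemma putLoop_boundedBy {g addr val : RAMEnv → ℕ} {x : RAMEnv} {off G B : ℕ} {v : ℕ → ℕ}
    (hg : g (x.setReg 5 0) = G) (h : ∀ i < G, ∀ y : RAMEnv,
      y = ⟨fun j => if off ≤ j ∧ j < off + i then v (j - off) else x.mem j,
        Function.update x.reg 5 i⟩ → addr y = off + i ∧ val y = v i)
    (hx : RAMContext.BoundedBy x B) (hG : G ≤ B) (hv : ∀ i < G, v i ≤ B) :
    ∀ i ≤ g (x.setReg 5 0), RAMContext.BoundedBy ((putStep addr val)^[i] (x.setReg 5 0)) B := by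
  intro i hi
  rw [hg] at hi
  rw [putStep_iterate (addr := addr) (val := val) (x := x.setReg 5 0) (off := off) (G := G)
    (v := v) (by simp [setReg]) (fun i hi y hy => h i hi y (by rw [hy]; simp [setReg])) i hi]
  refine ⟨fun j => ?_, fun w hw => ?_⟩
  · change (if off ≤ j ∧ j < off + i then v (j - off) else x.mem j) ≤ B
    split_ifs with hj
    · exact hv _ (by omega)
    · exact hx.1 j
  · change Function.update (Function.update x.reg 5 0) 5 i w ≤ B
    rw [Function.update_idem, Function.update_apply]
    split_ifs
    · omega
    · exact hx.2 w hw

lemma boundedBy_setReg {x : RAMEnv} {v a B : ℕ} (hx : RAMContext.BoundedBy x B) (ha : a ≤ B) :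
    RAMContext.BoundedBy (x.setReg v a) B := by
  refine ⟨hx.1, fun w hw => ?_⟩
  change Function.update x.reg v a w ≤ B
  rw [Function.update_apply]
  split_ifs
  · exact ha
  · exact hx.2 w hw

variable (ℓ c : ℕ)

/-- The parameters held by an environment. -/
def sizes (x : RAMEnv) : RecoveryData := ⟨x.reg 0, x.reg 1, x.reg 2, x.reg 3, x.reg 4, fun _ => 0⟩

/-- The length of the array of documents and powers of the radix. -/
def dataEnd (x : RAMEnv) : ℕ := x.sizes.docs ℓ c * ℓ + x.sizes.len ℓ + 1

/-- The recovery data held by an environment. -/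
def data (x : RAMEnv) : RecoveryData :=
  ⟨x.reg 0, x.reg 1, x.reg 2, x.reg 3, x.reg 4, fun i => if x.dataEnd ℓ c ≤ i then 0 else x.mem i⟩

/-- The number of cells of the output. -/
def outLen (x : RAMEnv) : ℕ := x.reg 0 * x.reg 1 + x.reg 1 + 1

/-- Where the array holds the output. -/
def outStart (x : RAMEnv) : ℕ := x.dataEnd ℓ c + x.outLen

lemma readable_sizes : RecoveryData.Readable sizes where
  n := polyComputable_reg (by decide)
  R := polyComputable_reg (by decide)
  E := polyComputable_reg (by decide)
  G := polyComputable_reg (by decide)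
  T := polyComputable_reg (by decide)
  lim := ⟨fun _ => 0, .const 0, fun a i => by simp [sizes]⟩

lemma polyComputable_dataEnd : PolyComputable (dataEnd ℓ c) :=
  (((readable_sizes.docs ℓ c).mul (.const ℓ)).add (readable_sizes.len ℓ)).add (.const 1)

lemma readable_data : RecoveryData.Readable (data ℓ c) where
  n := polyComputable_reg (by decide)
  R := polyComputable_reg (by decide)
  E := polyComputable_reg (by decide)
  G := polyComputable_reg (by decide)
  T := polyComputable_reg (by decide)
  lim := ⟨_, polyComputable_dataEnd ℓ c, fun _ _ => rfl⟩

lemma polyComputable_outLen : PolyComputable outLen :=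
  (((polyComputable_reg (by decide)).mul (polyComputable_reg (by decide))).add
    (polyComputable_reg (by decide))).add (.const 1)

lemma polyComputable_outStart : PolyComputable (outStart ℓ c) :=
  (polyComputable_dataEnd ℓ c).add polyComputable_outLen

/-- Append the powers of the radix to the documents. -/
def writePowers : RAMEnv → RAMEnv :=
  putLoop (fun x => x.sizes.len ℓ + 1) (fun x => x.sizes.docs ℓ c * ℓ + x.reg 5)
    fun x => if x.reg 5 = 0 then 1 else x.mem (x.sizes.docs ℓ c * ℓ + x.reg 5 - 1) * x.sizes.radix ℓ c

/-- Write the output for the candidate in the variable `6`. -/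
def writeOutput : RAMEnv → RAMEnv :=
  putLoop outLen (fun x => x.outStart ℓ c + x.reg 5)
    fun x => (x.data ℓ c).output ℓ c (x.reg 6) (x.reg 5)

/-- Copy the output, except for its first cells, to the beginning of the array. -/
def copyOutput : RAMEnv → RAMEnv :=
  putLoop (fun x => x.outLen - x.reg 7) (fun x => x.reg 5)
    fun x => x.mem (x.outStart ℓ c + x.reg 7 + x.reg 5)

lemma implementable_writePowers : Implementable (writePowers ℓ c) fun x B =>
    ∀ i ≤ (x.setReg 5 0).sizes.len ℓ + 1, RAMContext.BoundedBy
      ((putStep (fun x => x.sizes.docs ℓ c * ℓ + x.reg 5) fun x => if x.reg 5 = 0 then 1 else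
        x.mem (x.sizes.docs ℓ c * ℓ + x.reg 5 - 1) * x.sizes.radix ℓ c)^[i] (x.setReg 5 0)) B := by
  have h5 : PolyComputable fun x : RAMEnv => x.reg 5 := polyComputable_reg (by decide)
  have hd := (readable_sizes.docs ℓ c).mul (.const ℓ)
  exact implementable_putLoop (g := fun x => x.sizes.len ℓ + 1) ((readable_sizes.len ℓ).add (.const 1))
    (hd.add h5) (.ite_eq h5 (.const 0) (.const 1)
      ((PolyComputable.get ((hd.add h5).sub (.const 1))).mul (readable_sizes.radix ℓ c)))

lemma implementable_writeOutput : Implementable (writeOutput ℓ c) fun x B =>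
    ∀ i ≤ (x.setReg 5 0).outLen, RAMContext.BoundedBy
      ((putStep (fun x => x.outStart ℓ c + x.reg 5) fun x =>
        (x.data ℓ c).output ℓ c (x.reg 6) (x.reg 5))^[i] (x.setReg 5 0)) B :=
  have h5 : PolyComputable fun x : RAMEnv => x.reg 5 := polyComputable_reg (by decide)
  implementable_putLoop polyComputable_outLen ((polyComputable_outStart ℓ c).add h5)
    ((readable_data ℓ c).output ℓ c (polyComputable_reg (by decide)) h5)

lemma implementable_copyOutput : Implementable (copyOutput ℓ c) fun x B =>
    ∀ i ≤ (x.setReg 5 0).outLen - (x.setReg 5 0).reg 7, RAMContext.BoundedBy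
      ((putStep (fun x => x.reg 5) fun x =>
        x.mem (x.outStart ℓ c + x.reg 7 + x.reg 5))^[i] (x.setReg 5 0)) B :=
  have h5 : PolyComputable fun x : RAMEnv => x.reg 5 := polyComputable_reg (by decide)
  have h7 : PolyComputable fun x : RAMEnv => x.reg 7 := polyComputable_reg (by decide)
  implementable_putLoop (g := fun x => x.outLen - x.reg 7) (polyComputable_outLen.sub h7) h5
    (PolyComputable.get (((polyComputable_outStart ℓ c).add h7).add h5))

end RAMEnv

/-- Sample as many documents as the cell `6` says, to the cells from the one that the cell `5`
points to on. -/
def RAMProgram.sampleLoop (ℓ : ℕ) : RAMProgram :=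
  .loop 6 (.seq (.sample 5) (.seq (.const 8 ℓ) (.seq (.add 5 5 8) (.seq (.const 8 1) (.sub 6 6 8)))))

/-- The `i`-th word of a corpus. -/
def corpusWord {ℓ n : ℕ} (X : ℕ → Fin ℓ → Fin n) (i : ℕ) : ℕ :=
  if h : 0 < ℓ then X (i / ℓ) ⟨i % ℓ, Nat.mod_lt i h⟩ else 0

lemma RAMProgram.exec_sampleLoop {ℓ n : ℕ} (hℓ : 0 < ℓ) (X : ℕ → Fin ℓ → Fin n) {W N : ℕ}
    (hW : 9 ≤ W) {s : RAMState} {x : RAMEnv} (hs : x.HeldBy W s) (hdr : s.drawn = 0)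
    (h5 : x.reg 5 = W) (h6 : x.reg 6 = N) :
    ∃ t s', RAMProgram.Exec X (sampleLoop ℓ) s t s' ∧ t ≤ N * (ℓ + 6) + 1 ∧ s'.drawn = N ∧
      RAMEnv.HeldBy W s' ⟨fun i => if i < N * ℓ then corpusWord X i else x.mem i,
        Function.update (Function.update x.reg 5 (W + N * ℓ)) 6 0⟩ := by
  let Inv : ℕ → RAMState → Prop := fun i s' => s'.mem 6 = N - i ∧ s'.drawn = i ∧
    RAMEnv.HeldBy W s' ⟨fun j => if j < i * ℓ then corpusWord X j else x.mem j,
        Function.update (Function.update x.reg 5 (W + i * ℓ)) 6 (N - i)⟩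
  obtain ⟨t, s', he, ht, h, hd, hh⟩ := RAMProgram.exec_loop (X := X) (c := 6) (G := N) (T := ℓ + 5)
    (p := .seq (.sample 5) (.seq (.const 8 ℓ) (.seq (.add 5 5 8) (.seq (.const 8 1) (.sub 6 6 8)))))
    Inv (fun i s h => h.1) (fun i s' hi hinv => by
      obtain ⟨h6, hd, hheld⟩ := hinv
      have hr : ∀ v < 8, s'.mem v = Function.update (Function.update x.reg 5 (W + i * ℓ)) 6 (N - i) v :=
        fun v hv => hheld.1 v hv
      have h5' : s'.mem 5 = W + i * ℓ := by rw [hr 5 (by omega)]; simp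
      have hdm : ∀ v, (s'.draw X (s'.mem 5)).mem v = if h : W + i * ℓ ≤ v ∧ v - (W + i * ℓ) < ℓ then
          ((X i ⟨v - (W + i * ℓ), h.2⟩ : Fin n) : ℕ) else s'.mem v := by
        intro v
        simp only [RAMState.draw, h5', hd]
      have hlow : ∀ v < 8, (s'.draw X (s'.mem 5)).mem v = s'.mem v := by
        intro v hv
        rw [hdm, dif_neg]
        omega
      refine ⟨_, _, .seq (.sample 5 s') (.seq (.const 8 ℓ _) (.seq (.add 5 5 8 _)
        (.seq (.const 8 1 _) (.sub 6 6 8 _)))), by omega, ?_, ?_, fun v hv => ?_, fun j => ?_⟩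
      · simp [RAMState.write_mem, hlow, h6]
        omega
      · simp [RAMState.write_drawn, RAMState.draw, hd]
      · have hv : v < 8 := hv
        have h8 : v ≠ 8 := by omega
        change _ = Function.update (Function.update x.reg 5 (W + (i + 1) * ℓ)) 6 (N - (i + 1)) v
        by_cases hv6 : v = 6
        · subst hv6
          simp [RAMState.write_mem, hlow, h6]
          omega
        by_cases hv5 : v = 5
        · subst hv5
          have e5 := hlow 5 (by omega)
          rw [h5'] at e5
          simp [RAMState.write_mem, e5, h5', Nat.succ_mul]
          omega
        · simp [RAMState.write_mem, hlow v hv, hv5, hv6, h8, hr v hv]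
      · have c1 : W + j ≠ 8 := by omega
        have c2 : W + j ≠ 5 := by omega
        have c3 : W + j ≠ 6 := by omega
        have hj : s'.mem (W + j) = if j < i * ℓ then corpusWord X j else x.mem j := hheld.2 j
        change _ = if j < (i + 1) * ℓ then corpusWord X j else x.mem j
        simp only [RAMState.write_mem, c1, c2, c3, if_false]
        rw [hdm, hj]
        have hexp : (i + 1) * ℓ = i * ℓ + ℓ := Nat.succ_mul i ℓ
        split_ifs with k1 k2 k3 k4
        · have e1 : j = ℓ * i + (W + j - (W + i * ℓ)) := by rw [mul_comm]; omega
          have e2 : j / ℓ = i := by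
            rw [e1, Nat.mul_add_div hℓ, Nat.div_eq_of_lt k1.2, Nat.add_zero]
          have e3 : j % ℓ = W + j - (W + i * ℓ) := by
            conv_lhs => rw [e1, Nat.mul_add_mod, Nat.mod_eq_of_lt k1.2]
          rw [corpusWord, dif_pos hℓ]
          simp only [e2, e3]
        · omega
        · rfl
        · omega
        · omega
        · rfl)
    (s := s) (by
      refine ⟨?_, hdr, fun v hv => ?_, fun j => ?_⟩
      · have : s.mem 6 = x.reg 6 := hs.1 6 (by decide)
        rw [this, h6, Nat.sub_zero]
      · have h := hs.1 v hv
        change s.mem v = x.reg v at h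
        change s.mem v = Function.update (Function.update x.reg 5 (W + 0 * ℓ)) 6 (N - 0) v
        rw [Nat.zero_mul, Nat.add_zero, Nat.sub_zero, ← h5, Function.update_eq_self, ← h6,
          Function.update_eq_self, h]
      · have h := hs.2 j
        change s.mem (W + j) = x.mem j at h
        change s.mem (W + j) = if j < 0 * ℓ then _ else x.mem j
        rw [if_neg (by omega), h])
  refine ⟨t, s', he, ht, hd, ?_⟩
  rw [Nat.sub_self] at hh
  exact hh

/-- Load the cells that begin at the one that the cell `0` points to into the cells `0, …, m`. -/
def RAMProgram.gather : ℕ → RAMProgram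
  | 0 => .load 0 0
  | m + 1 => .seq (.const (m + 1) (m + 1)) (.seq (.add (m + 1) (m + 1) 0)
      (.seq (.load (m + 1) (m + 1)) (gather m)))

lemma RAMProgram.exec_gather {ℓ n : ℕ} (X : ℕ → Fin ℓ → Fin n) (m : ℕ) :
    ∀ s : RAMState, m < s.mem 0 → ∃ s', RAMProgram.Exec X (gather m) s (3 * m + 1) s' ∧
      s'.drawn = s.drawn ∧ (∀ j ≤ m, s'.mem j = s.mem (s.mem 0 + j)) ∧
      ∀ j, m < j → s'.mem j = s.mem j := by
  induction m with
  | zero =>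
    intro s hs
    refine ⟨_, .load 0 0 s, rfl, fun j hj => ?_, fun j hj => ?_⟩
    · have : j = 0 := by omega
      subst this
      simp [RAMState.write_mem]
    · rw [RAMState.write_mem, if_neg (by omega)]
  | succ m ih =>
    intro s hs
    set s₁ := ((s.write (m + 1) (m + 1)).write (m + 1) (m + 1 + s.mem 0)).write (m + 1)
      (s.mem (m + 1 + s.mem 0)) with hs₁
    have hmem : ∀ j, s₁.mem j = if j = m + 1 then s.mem (m + 1 + s.mem 0) else s.mem j := by
      intro j
      simp only [hs₁, RAMState.write_mem]
      split_ifs <;> rfl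
    have h0 : s₁.mem 0 = s.mem 0 := by rw [hmem, if_neg (by omega)]
    obtain ⟨s', he, hd, h1, h2⟩ := ih s₁ (by rw [h0]; omega)
    refine ⟨s', ?_, hd, fun j hj => ?_, fun j hj => ?_⟩
    · have e : 3 * (m + 1) + 1 = 1 + (1 + (1 + (3 * m + 1))) := by ring
      rw [e]
      refine .seq (.const _ _ s) (.seq (.add _ _ _ _) (.seq (.load _ _ _) ?_))
      convert he using 1
      rw [hs₁]
      simp only [RAMState.write_mem, if_true]
      rw [if_neg (by omega : (0 : ℕ) ≠ m + 1), if_neg (by omega), if_neg (by omega)]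
    · rcases Nat.lt_or_ge j (m + 1) with h | h
      · rw [h1 j (by omega), h0, hmem, if_neg (by omega)]
      · have : j = m + 1 := by omega
        subst this
        rw [h2 _ (by omega), hmem, if_pos rfl, add_comm]
    · rw [h2 j (by omega), hmem, if_neg (by omega)]

/-- The data that the recovery program works with after sampling from the corpus `X`: the documents
and a table of powers of the radix. -/
def corpusData (ℓ c : ℕ) {n : ℕ} (R E G T : ℕ) (X : ℕ → Fin ℓ → Fin n) : RecoveryData :=
  let I : RecoveryData := ⟨n, R, E, G, T, fun _ => 0⟩
  ⟨n, R, E, G, T, fun i => if i < I.docs ℓ c * ℓ then corpusWord X i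
    else if i ≤ I.docs ℓ c * ℓ + I.len ℓ then I.radix ℓ c ^ (i - I.docs ℓ c * ℓ) else 0⟩

lemma corpusData_total (ℓ c : ℕ) {n : ℕ} (R E G T : ℕ) (X : ℕ → Fin ℓ → Fin n) :
    (corpusData ℓ c R E G T X).total ℓ c = (corpusData ℓ c R E G T X).radix ℓ c ^
      (corpusData ℓ c R E G T X).len ℓ := by
  set I := corpusData ℓ c R E G T X
  change (if I.docs ℓ c * ℓ + I.len ℓ < I.docs ℓ c * ℓ then _ else
    if I.docs ℓ c * ℓ + I.len ℓ ≤ I.docs ℓ c * ℓ + I.len ℓ then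
      I.radix ℓ c ^ (I.docs ℓ c * ℓ + I.len ℓ - I.docs ℓ c * ℓ) else 0) = _
  rw [if_neg (by omega), if_pos le_rfl, Nat.add_sub_cancel_left]

namespace RAMEnv

lemma data_eq_of_eq {ℓ c : ℕ} {x y : RAMEnv} (hr : ∀ v < 5, y.reg v = x.reg v)
    (hm : ∀ i < x.dataEnd ℓ c, y.mem i = x.mem i) : y.data ℓ c = x.data ℓ c := by
  have hs : y.sizes = x.sizes := by
    simp only [sizes, hr 0 (by decide), hr 1 (by decide), hr 2 (by decide), hr 3 (by decide),
      hr 4 (by decide)]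
  have hd : y.dataEnd ℓ c = x.dataEnd ℓ c := by rw [dataEnd, dataEnd, hs]
  simp only [data, hr 0 (by decide), hr 1 (by decide), hr 2 (by decide), hr 3 (by decide),
      hr 4 (by decide), hd]
  congr 1
  funext i
  split_ifs with h
  · rfl
  · exact hm i (by omega)

lemma sizes_eq {x y : RAMEnv} (hr : ∀ v < 5, y.reg v = x.reg v) : y.sizes = x.sizes := by
  simp only [sizes, hr 0 (by decide), hr 1 (by decide), hr 2 (by decide), hr 3 (by decide),
    hr 4 (by decide)]

lemma implementable_recover (ℓ c : ℕ) : ∃ q need : ℕ, ∀ W, need ≤ W → ∃ p : RAMProgram,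
    ∀ (n R E G T : ℕ) (X : ℕ → Fin ℓ → Fin n) (s : RAMState) (x : RAMEnv) (B : ℕ), 2 ≤ B →
      x.HeldBy W s → x.sizes = ⟨n, R, E, G, T, fun _ => 0⟩ → x.reg 7 = W →
      (∀ i, x.mem i = if i < x.sizes.docs ℓ c * ℓ then corpusWord X i else 0) →
      RAMContext.BoundedBy x B → x.sizes.len ℓ + 1 ≤ B → n * R + R + 1 ≤ B →
      1 ≤ x.sizes.radix ℓ c → x.sizes.radix ℓ c ^ x.sizes.len ℓ ≤ B →
      ∃ t s', RAMProgram.Exec X p s t s' ∧ t ≤ B ^ q ∧ s'.drawn = s.drawn ∧ W ≤ s'.mem 0 ∧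
        ∀ j ≤ n * R + R,
          s'.mem (if j < W then s'.mem 0 + j else j) = (corpusData ℓ c R E G T X).output ℓ c
            ((corpusData ℓ c R E G T X).select ℓ c) j := by
  obtain ⟨qo, -, hqo, hout, -⟩ := (readable_data ℓ c).output ℓ c
    (polyComputable_reg (v := 6) (by decide)) (polyComputable_reg (v := 5) (by decide))
  obtain ⟨q, need, h⟩ := ((((implementable_writePowers ℓ c).comp
    (implementable_setReg ((readable_data ℓ c).select ℓ c) (v := 6) (by decide))).comp
    (implementable_writeOutput ℓ c)).comp (implementable_copyOutput ℓ c)).comp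
    (implementable_setReg ((polyComputable_outStart ℓ c).add
      (polyComputable_reg (v := 7) (by decide))) (v := 0) (by decide))
  refine ⟨qo * q, need, fun W hW => ?_⟩
  obtain ⟨p, hp⟩ := h W hW
  refine ⟨p, fun n R E G T X s x B hB hs hsz h7 hmem hx hlenB hoB hrad hradB => ?_⟩
  set I := corpusData ℓ c R E G T X with hI
  have hmono : B ≤ B ^ qo := Nat.le_self_pow (by omega) B
  have hr0 : x.reg 0 = n := congrArg RecoveryData.n hsz
  have hr1 : x.reg 1 = R := congrArg RecoveryData.R hsz
  have hr2 : x.reg 2 = E := congrArg RecoveryData.E hsz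
  have hr3 : x.reg 3 = G := congrArg RecoveryData.G hsz
  have hr4 : x.reg 4 = T := congrArg RecoveryData.T hsz
  have hdocs : x.sizes.docs ℓ c = I.docs ℓ c := by rw [hsz]; rfl
  have hlen : x.sizes.len ℓ = I.len ℓ := by rw [hsz]; rfl
  have hradix : x.sizes.radix ℓ c = I.radix ℓ c := by rw [hsz]; rfl
  have hend : x.dataEnd ℓ c = I.docs ℓ c * ℓ + I.len ℓ + 1 := by rw [dataEnd, hdocs, hlen]
  -- powers of the radix
  have hP₁ : (x.setReg 5 0).sizes.len ℓ + 1 = I.len ℓ + 1 := by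
    rw [sizes_eq (x := x) (fun v hv => by simp [setReg, show v ≠ 5 by omega]), hlen]
  have hP₂ : ∀ i < I.len ℓ + 1, ∀ y : RAMEnv,
      y = ⟨fun j => if I.docs ℓ c * ℓ ≤ j ∧ j < I.docs ℓ c * ℓ + i
        then I.radix ℓ c ^ (j - I.docs ℓ c * ℓ) else x.mem j, Function.update x.reg 5 i⟩ →
      y.sizes.docs ℓ c * ℓ + y.reg 5 = I.docs ℓ c * ℓ + i ∧
      (if y.reg 5 = 0 then 1 else y.mem (y.sizes.docs ℓ c * ℓ + y.reg 5 - 1) * y.sizes.radix ℓ c)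
        = I.radix ℓ c ^ i := by
    intro i hi y hy
    have h1 : y.sizes = x.sizes :=
      sizes_eq fun v hv => by simp [hy, show v ≠ 5 by omega]
    have h2 : y.reg 5 = i := by simp [hy]
    rw [h1, h2, hdocs, hradix]
    refine ⟨rfl, ?_⟩
    rcases i with _ | i
    · simp
    · rw [if_neg (by omega), hy]
      dsimp only
      rw [if_pos (by omega), pow_succ]
      congr 2
      omega
  have hPe := putLoop_eq (g := fun x => x.sizes.len ℓ + 1)
    (addr := fun x => x.sizes.docs ℓ c * ℓ + x.reg 5) (val := fun x => if x.reg 5 = 0 then 1 else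
      x.mem (x.sizes.docs ℓ c * ℓ + x.reg 5 - 1) * x.sizes.radix ℓ c) hP₁ hP₂
  have hPb := putLoop_boundedBy (g := fun x => x.sizes.len ℓ + 1)
    (addr := fun x => x.sizes.docs ℓ c * ℓ + x.reg 5) (val := fun x => if x.reg 5 = 0 then 1 else
      x.mem (x.sizes.docs ℓ c * ℓ + x.reg 5 - 1) * x.sizes.radix ℓ c) hP₁ hP₂ hx (by omega)
      (fun i hi => by
        rw [← hradix]
        exact (Nat.pow_le_pow_right hrad (by omega)).trans hradB)
  set x₁ := writePowers ℓ c x with hx₁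
  change x₁ = _ at hPe
  have hx₁b : RAMContext.BoundedBy x₁ B := by
    have := hPb _ le_rfl
    exact this
  have hx₁r : ∀ v, v ≠ 5 → x₁.reg v = x.reg v := fun v hv => by simp [hPe, hv]
  have hdata₁ : x₁.data ℓ c = I := by
    have hd : x₁.dataEnd ℓ c = x.dataEnd ℓ c := by
      rw [dataEnd, dataEnd, sizes_eq (x := x) (fun v hv => hx₁r v (by omega))]
    rw [data, hd, hend, hx₁r 0 (by decide), hx₁r 1 (by decide), hx₁r 2 (by decide),
      hx₁r 3 (by decide), hx₁r 4 (by decide), hr0, hr1, hr2, hr3, hr4, hPe]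
    simp only [hI, corpusData]
    congr 1
    funext i
    rw [hmem, hdocs]
    simp only [hI, corpusData]
    change (if I.docs ℓ c * ℓ + I.len ℓ + 1 ≤ i then 0 else
      if I.docs ℓ c * ℓ ≤ i ∧ i < I.docs ℓ c * ℓ + (I.len ℓ + 1) then
        I.radix ℓ c ^ (i - I.docs ℓ c * ℓ) else if i < I.docs ℓ c * ℓ then corpusWord X i else 0)
      = if i < I.docs ℓ c * ℓ then corpusWord X i else if i ≤ I.docs ℓ c * ℓ + I.len ℓ then
        I.radix ℓ c ^ (i - I.docs ℓ c * ℓ) else 0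
    split_ifs <;> first | rfl | omega
  -- selection
  set z := I.select ℓ c with hz
  have hzB : z ≤ B := by
    refine le_trans ?_ hradB
    rw [hz, hradix, hlen, RecoveryData.select]
    refine (Finset.sum_le_card_nsmul _ _ 1 fun i _ => by split_ifs <;> omega).trans ?_
    rw [Finset.card_range, hI, corpusData_total, smul_eq_mul, mul_one]
  set x₂ := x₁.setReg 6 ((x₁.data ℓ c).select ℓ c) with hx₂
  rw [hdata₁] at hx₂
  have hx₂b : RAMContext.BoundedBy x₂ B := by rw [hx₂]; exact boundedBy_setReg hx₁b hzB
  have hx₂r : ∀ v, v ≠ 5 → v ≠ 6 → x₂.reg v = x.reg v := fun v hv hv' => by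
    rw [hx₂, ← hx₁r v hv]; simp [setReg, hv']
  have hx₂6 : x₂.reg 6 = z := by rw [hx₂]; simp [setReg, hz]
  have hend₂ : x₂.dataEnd ℓ c = x.dataEnd ℓ c := by
    rw [dataEnd, dataEnd, sizes_eq (x := x) (fun v hv => hx₂r v (by omega) (by omega))]
  have hdata₂ : x₂.data ℓ c = I := by
    rw [← hdata₁]
    refine data_eq_of_eq (fun v hv => ?_) fun i _ => ?_
    · rw [hx₁r v (by omega), hx₂r v (by omega) (by omega)]
    · rw [hx₂]; rfl
  -- output
  set O := n * R + R + 1 with hO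
  have hOl : ∀ y : RAMEnv, y.reg 0 = n → y.reg 1 = R → y.outLen = O := fun y h0 h1 => by
    rw [outLen, h0, h1]
  set S := x₂.outStart ℓ c with hS
  have hS' : S = x₂.dataEnd ℓ c + O := by
    rw [hS, outStart, hOl x₂ (by rw [hx₂r 0 (by decide) (by decide), hr0])
      (by rw [hx₂r 1 (by decide) (by decide), hr1])]
  have hSy : ∀ y : RAMEnv, (∀ v < 5, y.reg v = x₂.reg v) → y.outStart ℓ c = S := fun y hy => by
    rw [hS, outStart, outStart, dataEnd, dataEnd, sizes_eq hy, outLen, outLen, hy 0 (by decide),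
      hy 1 (by decide)]
  have hO₁ : (x₂.setReg 5 0).outLen = O := hOl _
    (by simp [setReg, hx₂r 0 (by decide) (by decide), hr0])
    (by simp [setReg, hx₂r 1 (by decide) (by decide), hr1])
  have hOd : ∀ i < O, ∀ y : RAMEnv,
      y = ⟨fun j => if S ≤ j ∧ j < S + i then I.output ℓ c z (j - S) else x₂.mem j,
        Function.update x₂.reg 5 i⟩ → y.data ℓ c = I := by
    intro i hi y hy
    rw [← hdata₂]
    refine data_eq_of_eq (fun v hv => by simp [hy, show v ≠ 5 by omega]) fun j hj => ?_
    rw [hy]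
    dsimp only
    rw [if_neg (by omega)]
  have hO₂ : ∀ i < O, ∀ y : RAMEnv,
      y = ⟨fun j => if S ≤ j ∧ j < S + i then I.output ℓ c z (j - S) else x₂.mem j,
        Function.update x₂.reg 5 i⟩ → y.outStart ℓ c + y.reg 5 = S + i ∧
        (y.data ℓ c).output ℓ c (y.reg 6) (y.reg 5) = I.output ℓ c z i := by
    intro i hi y hy
    have h5 : y.reg 5 = i := by simp [hy]
    have h6 : y.reg 6 = z := by simp [hy, hx₂6]
    rw [hOd i hi y hy, h5, h6, hSy y (fun v hv => by simp [hy, show v ≠ 5 by omega])]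
    exact ⟨rfl, rfl⟩
  have hOv : ∀ i < O, I.output ℓ c z i ≤ B ^ qo := by
    intro i hi
    have h1 := hout (x₂.setReg 5 i) B hB (boundedBy_setReg hx₂b (by omega))
    have h2 : (x₂.setReg 5 i).data ℓ c = I := by
      rw [← hdata₂]
      exact data_eq_of_eq (fun v hv => by simp [setReg, show v ≠ 5 by omega]) fun _ _ => rfl
    dsimp only at h1
    rw [h2] at h1
    simpa [setReg, hx₂6] using h1
  have hOe := putLoop_eq (g := outLen) (addr := fun x => x.outStart ℓ c + x.reg 5)
    (val := fun x => (x.data ℓ c).output ℓ c (x.reg 6) (x.reg 5)) hO₁ hO₂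
  have hOb := putLoop_boundedBy (g := outLen) (addr := fun x => x.outStart ℓ c + x.reg 5)
    (val := fun x => (x.data ℓ c).output ℓ c (x.reg 6) (x.reg 5)) hO₁ hO₂ (hx₂b.mono hmono)
    (by omega) hOv
  set x₃ := writeOutput ℓ c x₂ with hx₃
  change x₃ = _ at hOe
  have hx₃b : RAMContext.BoundedBy x₃ (B ^ qo) := hOb _ le_rfl
  have hx₃r : ∀ v, v ≠ 5 → x₃.reg v = x₂.reg v := fun v hv => by simp [hOe, hv]
  have hx₃m : ∀ j < O, x₃.mem (S + j) = I.output ℓ c z j := fun j hj => by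
    rw [hOe]
    dsimp only
    rw [if_pos (by omega), Nat.add_sub_cancel_left]
  -- the copy
  have hx₃7 : x₃.reg 7 = W := by
    rw [hx₃r 7 (by decide), hx₂r 7 (by decide) (by decide), h7]
  have hx₃0 : x₃.reg 0 = n := by
    rw [hx₃r 0 (by decide), hx₂r 0 (by decide) (by decide), hr0]
  have hx₃1 : x₃.reg 1 = R := by
    rw [hx₃r 1 (by decide), hx₂r 1 (by decide) (by decide), hr1]
  have hC₁ : (x₃.setReg 5 0).outLen - (x₃.setReg 5 0).reg 7 = O - W := by
    rw [hOl _ (by simp [setReg, hx₃0]) (by simp [setReg, hx₃1])]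
    simp [setReg, hx₃7]
  have hC₂ : ∀ i < O - W, ∀ y : RAMEnv,
      y = ⟨fun j => if 0 ≤ j ∧ j < 0 + i then x₃.mem (S + W + (j - 0)) else x₃.mem j,
        Function.update x₃.reg 5 i⟩ → y.reg 5 = 0 + i ∧
        y.mem (y.outStart ℓ c + y.reg 7 + y.reg 5) = x₃.mem (S + W + i) := by
    intro i hi y hy
    have h5 : y.reg 5 = i := by simp [hy]
    have h7' : y.reg 7 = W := by simp [hy, hx₃7]
    rw [h5, h7', hSy y (fun v hv => by simp [hy, show v ≠ 5 by omega, hx₃r]), hy]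
    dsimp only
    rw [if_neg (by omega), Nat.zero_add]
    exact ⟨rfl, rfl⟩
  have hCe := putLoop_eq (g := fun x => x.outLen - x.reg 7) (addr := fun x => x.reg 5)
    (val := fun x => x.mem (x.outStart ℓ c + x.reg 7 + x.reg 5)) (v := fun i => x₃.mem (S + W + i))
    hC₁ hC₂
  have hCb := putLoop_boundedBy (g := fun x => x.outLen - x.reg 7) (addr := fun x => x.reg 5)
    (val := fun x => x.mem (x.outStart ℓ c + x.reg 7 + x.reg 5)) (v := fun i => x₃.mem (S + W + i))
    hC₁ hC₂ hx₃b (by omega) (fun i hi => hx₃b.1 _)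
  set x₄ := copyOutput ℓ c x₃ with hx₄
  change x₄ = _ at hCe
  have hx₄b : RAMContext.BoundedBy x₄ (B ^ qo) := hCb _ le_rfl
  have hx₄7 : x₄.reg 7 = W := by simp [hCe, hx₃7]
  have hx₄S : x₄.outStart ℓ c = S :=
    hSy _ fun v hv => by simp [hCe, show v ≠ 5 by omega, hx₃r]
  obtain ⟨t, s', he, ht, hd, hh⟩ := hp ℓ n X s x (B ^ qo) (hB.trans hmono)
    ⟨⟨⟨⟨fun i hi => (hPb i hi).mono hmono, hx₁b.mono hmono⟩, hOb⟩, hCb⟩, hx₄b⟩ hs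
  change RAMEnv.HeldBy W s' (x₄.setReg 0 (x₄.outStart ℓ c + x₄.reg 7)) at hh
  rw [hx₄7, hx₄S] at hh
  have h0 : s'.mem 0 = S + W := (hh.1 0 (by decide)).trans (by simp [RAMContext.var, setReg])
  have hm : ∀ i, s'.mem (W + i) = x₄.mem i := fun i => hh.2 i
  refine ⟨t, s', he, by rwa [pow_mul], hd, by omega, fun j hj => ?_⟩
  split_ifs with hjW
  · have h1 : s'.mem 0 + j = W + (S + j) := by omega
    rw [h1, hm, hCe, ← hx₃m j (by omega)]
    dsimp only
    rw [if_neg (by omega)]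
  · have h1 : j = W + (j - W) := by omega
    rw [h1, hm, hCe, ← h1, ← hx₃m j (by omega)]
    dsimp only
    rw [if_pos (by omega)]
    congr 1
    omega

end RAMEnv

/-- The recovery program. -/
theorem exists_recoveryProgram (ℓ c : ℕ) (hℓ : 1 ≤ ℓ) : ∃ (p : RAMProgram) (K q : ℕ),
    ∀ (n R E G T : ℕ), 1 ≤ n → 1 ≤ R → 1 ≤ E → 1 ≤ G → 1 ≤ T → ∀ (X : ℕ → Fin ℓ → Fin n)
      (s : RAMState), s.drawn = 0 → (∀ a, s.mem a = if a = 0 then n else if a = 1 then R else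
        if a = 2 then E else if a = 3 then G else if a = 4 then T else 0) →
      ∃ t s', RAMProgram.Exec X p s t s' ∧ s'.drawn = (corpusData ℓ c R E G T X).docs ℓ c ∧
        t ≤ (K * ((corpusData ℓ c R E G T X).docs ℓ c *
          (corpusData ℓ c R E G T X).radix ℓ c ^ (corpusData ℓ c R E G T X).len ℓ)) ^ q ∧
        ∀ j ≤ n * R + R, s'.mem j = (corpusData ℓ c R E G T X).output ℓ c
            ((corpusData ℓ c R E G T X).select ℓ c) j := by
  obtain ⟨q₁, m₁, h₁⟩ := (RAMEnv.implementable_setReg (v := 6)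
    (RAMEnv.readable_sizes.docs ℓ c) (by decide)).comp
    (RAMEnv.implementable_setReg (v := 5)
      (RAMEnv.polyComputable_reg (v := 7) (by decide)) (by decide))
  obtain ⟨q₂, m₂, h₂⟩ := RAMEnv.implementable_recover ℓ c
  set W := m₁ + m₂ + 9 with hW
  obtain ⟨p₁, hp₁⟩ := h₁ W (by omega)
  obtain ⟨p₂, hp₂⟩ := h₂ W (by omega)
  refine ⟨.seq (.const 7 W) (.seq p₁ (.seq (.sampleLoop ℓ) (.seq p₂ (.gather (W - 1))))),
    W * (ℓ + 7) * 4, q₁ + 1 + q₂ + 3, fun n R E G T hn hR hE hG hT X s hsd hsm => ?_⟩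
  set I := corpusData ℓ c R E G T X with hI
  set B := W * (ℓ + 7) * 4 * (I.docs ℓ c * I.radix ℓ c ^ I.len ℓ) with hB
  have hprod : 1 ≤ n * R * E * G * T := by
    simp only [Nat.one_le_iff_ne_zero] at *
    simp [*]
  have hbase2 : 2 * (n * R * E * G * T) ≤ I.base ℓ c := by
    refine Nat.mul_le_mul_right _ ?_
    calc 2 = 2 ^ 1 * 1 := rfl
      _ ≤ _ := Nat.mul_le_mul (Nat.pow_le_pow_right (by omega) (by omega)) (by omega)
  have hdle : I.base ℓ c ≤ I.docs ℓ c := Nat.le_self_pow (by omega) _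
  have hrle : I.base ℓ c ≤ I.radix ℓ c := Nat.le_self_pow (by omega) _
  have hrad1 : 1 ≤ I.radix ℓ c ^ I.len ℓ := Nat.one_le_pow _ _ (by omega)
  have hBd : 4 * (I.docs ℓ c * (ℓ + 7)) * W ≤ B := by
    calc 4 * (I.docs ℓ c * (ℓ + 7)) * W = W * (ℓ + 7) * 4 * (I.docs ℓ c * 1) := by ring
      _ ≤ B := Nat.mul_le_mul_left _ (Nat.mul_le_mul_left _ hrad1)
  have hBW : 4 * (I.docs ℓ c * (ℓ + 7)) + 2 * W ≤ B + 8 := by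
    have h1 : 4 * 7 ≤ 4 * (I.docs ℓ c * (ℓ + 7)) := by
      refine Nat.mul_le_mul_left _ ?_
      calc 7 = 1 * 7 := rfl
        _ ≤ _ := Nat.mul_le_mul (by omega) (by omega)
    have h2 : 9 ≤ W := by omega
    generalize 4 * (I.docs ℓ c * (ℓ + 7)) = u at h1 hBd ⊢
    nlinarith
  have hBB : 4 * (I.docs ℓ c * (ℓ + 7)) + W ≤ B := by
    have h1 : 4 * 7 ≤ 4 * (I.docs ℓ c * (ℓ + 7)) := by
      refine Nat.mul_le_mul_left _ ?_
      calc 7 = 1 * 7 := rfl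
        _ ≤ _ := Nat.mul_le_mul (by omega) (by omega)
    omega
  have hdocsB : 4 * (I.docs ℓ c * ℓ) + 28 * I.docs ℓ c + W ≤ B := by
    rw [mul_add] at hBB
    omega
  have hBr : I.radix ℓ c ^ I.len ℓ ≤ B := by
    calc I.radix ℓ c ^ I.len ℓ = 1 * (1 * I.radix ℓ c ^ I.len ℓ) := by ring
      _ ≤ B := Nat.mul_le_mul (by rw [hW]; nlinarith) (Nat.mul_le_mul_right _ (by omega))
  have hprodle : ∀ a ∈ ({n, R, E, G, T, n * R} : Finset ℕ), a ≤ n * R * E * G * T := by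
    intro a ha
    simp only [Finset.mem_insert, Finset.mem_singleton] at ha
    refine Nat.le_of_dvd hprod ?_
    rcases ha with rfl | rfl | rfl | rfl | rfl | rfl
    · exact ⟨R * E * G * T, by ring⟩
    · exact ⟨n * E * G * T, by ring⟩
    · exact ⟨n * R * G * T, by ring⟩
    · exact ⟨n * R * E * T, by ring⟩
    · exact ⟨n * R * E * G, by ring⟩
    · exact ⟨E * G * T, by ring⟩
  have hn' := hprodle n (by simp)
  have hR' := hprodle R (by simp)
  have hE' := hprodle E (by simp)
  have hG' := hprodle G (by simp)
  have hT' := hprodle T (by simp)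
  have hnR' := hprodle (n * R) (by simp)
  -- initialization
  let x₀ : RAMEnv := ⟨fun _ => 0, fun v => if v = 7 then W else s.mem v⟩
  have hs₀ : x₀.HeldBy W (s.write 7 W) := by
    refine ⟨fun v _ => by rw [RAMState.write_mem]; rfl, fun i => ?_⟩
    rw [RAMState.write_mem, if_neg (by omega), hsm, if_neg (by omega), if_neg (by omega),
      if_neg (by omega), if_neg (by omega), if_neg (by omega)]
    rfl
  have hsz₀ : x₀.sizes = ⟨n, R, E, G, T, fun _ => 0⟩ := by
    simp [RAMEnv.sizes, x₀, hsm]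
  have hx₀b : RAMContext.BoundedBy x₀ B := by
    refine ⟨fun i => Nat.zero_le _, fun v hv => ?_⟩
    change (if v = 7 then W else s.mem v) ≤ B
    rw [hsm]
    split_ifs <;> omega
  have hdx₀ : x₀.sizes.docs ℓ c = I.docs ℓ c := by rw [hsz₀]; rfl
  obtain ⟨t₁, s₁, he₁, ht₁, hd₁, hs₁⟩ := hp₁ ℓ n X _ x₀ B (by omega)
    ⟨hx₀b, RAMEnv.boundedBy_setReg hx₀b (by rw [hdx₀]; omega)⟩ hs₀
  dsimp only at hs₁
  rw [hdx₀] at hs₁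
  obtain ⟨t₂, s₂, he₂, ht₂, hd₂, hs₂⟩ := RAMProgram.exec_sampleLoop hℓ X (N := I.docs ℓ c)
    (W := W) (by omega) hs₁ (hd₁.trans hsd) (by simp [RAMEnv.setReg, x₀]) (by simp [RAMEnv.setReg])
  set x₂ : RAMEnv := ⟨_, _⟩ with hx₂
  change x₂.HeldBy W s₂ at hs₂
  have hx₂r : ∀ v, v ≠ 5 → v ≠ 6 → x₂.reg v = x₀.reg v := fun v h5 h6 => by
    simp [hx₂, RAMEnv.setReg, h5, h6]
  have hsz₂ : x₂.sizes = ⟨n, R, E, G, T, fun _ => 0⟩ := by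
    rw [RAMEnv.sizes_eq (x := x₀) (fun v hv => hx₂r v (by omega) (by omega)), hsz₀]
  have hdx₂ : x₂.sizes.docs ℓ c = I.docs ℓ c := by rw [hsz₂]; rfl
  have hlx₂ : x₂.sizes.len ℓ = I.len ℓ := by rw [hsz₂]; rfl
  have hrx₂ : x₂.sizes.radix ℓ c = I.radix ℓ c := by rw [hsz₂]; rfl
  have hx₂m : ∀ i, x₂.mem i = if i < I.docs ℓ c * ℓ then corpusWord X i else 0 := fun i => rfl
  have hx₂b : RAMContext.BoundedBy x₂ B := by
    refine ⟨fun i => ?_, fun v hv => ?_⟩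
    · change x₂.mem i ≤ B
      rw [hx₂m]
      split_ifs
      · rw [corpusWord, dif_pos (by omega)]
        exact (Fin.is_lt _).le.trans (by omega)
      · omega
    · change x₂.reg v ≤ B
      by_cases h6 : v = 6
      · subst h6; simp [hx₂]
      by_cases h5 : v = 5
      · subst h5; simp [hx₂]; omega
      · rw [hx₂r v h5 h6]; exact hx₀b.2 v hv
  obtain ⟨t₃, s₃, he₃, ht₃, hd₃, h0, hout⟩ := hp₂ n R E G T X s₂ x₂ B (by omega) hs₂ hsz₂
    (by rw [hx₂r 7 (by decide) (by decide)]; rfl) (by rw [hdx₂]; exact hx₂m) hx₂b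
    (by
      rw [hlx₂]
      refine le_trans ?_ hBr
      exact (Nat.lt_two_pow_self (n := I.len ℓ)).trans_le (Nat.pow_le_pow_left (by omega) _))
    (by omega) (by rw [hrx₂]; omega) (by rw [hrx₂, hlx₂]; exact hBr)
  obtain ⟨s₄, he₄, hd₄, hlo, hhi⟩ := RAMProgram.exec_gather X (W - 1) s₃ (by omega)
  refine ⟨_, s₄, .seq (.const 7 W s) (.seq he₁ (.seq he₂ (.seq he₃ he₄))), ?_, ?_, fun j hj => ?_⟩
  · rw [hd₄, hd₃, hd₂]
  · have hB2 : 2 ≤ B := by omega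
    have e1 : I.docs ℓ c * (ℓ + 6) + 1 + 3 * W ≤ 3 * B := by rw [mul_add]; omega
    have hpow : ∀ i, i ≤ q₁ + 1 + q₂ → B ^ i ≤ B ^ (q₁ + 1 + q₂) := fun i hi =>
      Nat.pow_le_pow_right (by omega) hi
    have h1 := hpow q₁ (by omega)
    have h2 := hpow q₂ (by omega)
    have h3 := hpow 1 (by omega)
    rw [pow_one] at h3
    have h4 : 5 * B ^ (q₁ + 1 + q₂) ≤ B ^ (q₁ + 1 + q₂ + 3) := by
      rw [pow_add _ _ 3, mul_comm]
      exact Nat.mul_le_mul_left _ ((by norm_num : 5 ≤ 2 ^ 3).trans (Nat.pow_le_pow_left hB2 3))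
    omega
  · have h := hout j hj
    split_ifs at h with hjW
    · rw [hlo j (by omega), h]
    · rw [hhi j (by omega), h]

section Acceptance

variable {ℓ n R : ℕ}

/-- The tests that the recovery program performs on a candidate with word distributions `v` and
weights `w`, for the empirical tensor `S`. -/
structure Accepted (S : (Fin ℓ → Fin n) → ℝ) (δ T : ℝ) (k H : ℕ) (v : Fin R → Fin n → ℝ)
    (w : Fin R → ℝ) : Prop where
  tensor : ∀ i, |∑ s, w s * ∏ a, v s (i a) - S i| ≤ δ
  sum : ∀ s, |∑ i, v s i - 1| ≤ δ
  rank : ∀ z : Fin R → ℤ, (∀ j, |z j| ≤ H) → (Finset.univ.filter fun j => z j ≠ 0).card ≤ k →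
    ∀ j, |(z j : ℝ)| ≤ 2 * T * ∑ i, |∑ s, v s i * z s|

lemma accepted_of_close {S : (Fin ℓ → Fin n) → ℝ} {u v : Fin R → Fin n → ℝ} {w w' : Fin R → ℝ}
    {δ₁ δ ε T : ℝ} {k H : ℕ} (hu0 : ∀ s i, 0 ≤ u s i) (hu1 : ∀ s, ∑ i, u s i = 1)
    (hw0 : ∀ s, 0 ≤ w s) (hw1 : ∀ s, w s ≤ 1) (hvu : ∀ s i, |v s i - u s i| ≤ δ₁)
    (hw' : ∀ s, |w' s - w s| ≤ δ₁) (hδ₁ : 0 ≤ δ₁) (hδ₁1 : δ₁ ≤ 1)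
    (hS : ∀ i, |S i - ∑ s, w s * ∏ a, u s (i a)| ≤ ε)
    (hδ : R * ((ℓ + 1) * 2 ^ ℓ * δ₁) + ε ≤ δ) (hnδ : n * δ₁ ≤ δ) (hT0 : 0 ≤ T)
    (hT : 2 * T * n * R * δ₁ ≤ 1)
    (hu : RobustIndep T k fun s => (WithLp.toLp 2 (u s) : EuclideanSpace ℝ (Fin n))) :
    Accepted S δ T k H v w' := by
  have hu1' : ∀ s i, |u s i| ≤ 2 := fun s i => by
    rw [abs_of_nonneg (hu0 s i)]
    have := Finset.single_le_sum (fun i _ => hu0 s i) (Finset.mem_univ i)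
    rw [hu1] at this
    linarith
  have hv2 : ∀ s i, |v s i| ≤ 2 := fun s i => by
    have h1 := Finset.single_le_sum (fun i _ => hu0 s i) (Finset.mem_univ i)
    rw [hu1] at h1
    have h2 := abs_le.1 (hvu s i)
    have h3 := hu0 s i
    rw [abs_le]
    constructor <;> linarith
  refine ⟨fun i => ?_, fun s => ?_, fun z _ hz j => ?_⟩
  · have h1 : |∑ s, w' s * ∏ a, v s (i a) - ∑ s, w s * ∏ a, u s (i a)|
        ≤ R * ((ℓ + 1) * 2 ^ ℓ * δ₁) := by
      rw [← Finset.sum_sub_distrib]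
      refine (Finset.abs_sum_le_sum_abs _ _).trans ((Finset.sum_le_card_nsmul _ _
        ((ℓ + 1) * 2 ^ ℓ * δ₁) fun s _ => ?_).trans_eq (by simp))
      have h2 : |∏ a, v s (i a)| ≤ 2 ^ ℓ := by
        rw [Finset.abs_prod]
        refine (Finset.prod_le_prod (fun _ _ => abs_nonneg _) fun a _ => hv2 s (i a)).trans_eq ?_
        simp
      have h3 := abs_prod_sub_prod_le (Finset.univ : Finset (Fin ℓ)) (x := fun a => v s (i a))
        (y := fun a => u s (i a)) (B := 2) (by norm_num) hδ₁ (fun a _ => hv2 s (i a))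
        (fun a _ => hu1' s (i a)) (fun a _ => hvu s (i a))
      rw [Finset.card_univ, Fintype.card_fin] at h3
      calc |w' s * ∏ a, v s (i a) - w s * ∏ a, u s (i a)|
          = |(w' s - w s) * ∏ a, v s (i a) + w s * (∏ a, v s (i a) - ∏ a, u s (i a))| := by
            congr 1; ring
        _ ≤ |w' s - w s| * |∏ a, v s (i a)| + w s * |∏ a, v s (i a) - ∏ a, u s (i a)| := by
            refine (abs_add_le _ _).trans_eq ?_
            rw [abs_mul, abs_mul, abs_of_nonneg (hw0 s)]
        _ ≤ δ₁ * 2 ^ ℓ + 1 * (ℓ * 2 ^ ℓ * δ₁) :=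
            add_le_add (mul_le_mul (hw' s) h2 (abs_nonneg _) hδ₁)
              (mul_le_mul (hw1 s) h3 (abs_nonneg _) zero_le_one)
        _ = _ := by ring
    have h4 := hS i
    rw [abs_sub_comm] at h4
    exact (abs_sub_le _ _ _).trans ((add_le_add h1 h4).trans hδ)
  · rw [← hu1 s, ← Finset.sum_sub_distrib]
    refine (Finset.abs_sum_le_sum_abs _ _).trans ((Finset.sum_le_card_nsmul _ _ δ₁
      fun i _ => hvu s i).trans ?_)
    simpa using hnδ
  · obtain ⟨m, -, hm⟩ := Finset.exists_max_image Finset.univ (fun j => |(z j : ℝ)|)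
      ⟨j, Finset.mem_univ j⟩
    refine (hm j (Finset.mem_univ j)).trans ?_
    by_cases hz0 : z m = 0
    · rw [hz0, Int.cast_zero, abs_zero]; positivity
    have h1 := hu _ hz (fun s => (z s : ℝ)) m (by simpa using hz0)
    set y := ∑ s ∈ Finset.univ.filter (fun j => z j ≠ 0),
      (z s : ℝ) • (WithLp.toLp 2 (u s) : EuclideanSpace ℝ (Fin n)) with hy
    have hyi : ∀ i, y i = ∑ s, u s i * z s := by
      intro i
      rw [hy, Finset.sum_filter_of_ne]
      · simp [mul_comm]
      · intro s _ h hs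
        exact h (by rw [hs, Int.cast_zero, zero_smul])
    have h2 : ‖y‖ ≤ ∑ i, |∑ s, v s i * z s| + n * (R * (δ₁ * |(z m : ℝ)|)) := by
      refine (norm_le_sum_abs y).trans ?_
      calc ∑ i, |y i| ≤ ∑ i, (|∑ s, v s i * z s| + R * (δ₁ * |(z m : ℝ)|)) := by
            refine Finset.sum_le_sum fun i _ => ?_
            rw [hyi]
            have h3 : |∑ s, u s i * z s - ∑ s, v s i * z s| ≤ R * (δ₁ * |(z m : ℝ)|) := by
              rw [← Finset.sum_sub_distrib]
              refine (Finset.abs_sum_le_sum_abs _ _).trans ((Finset.sum_le_card_nsmul _ _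
                (δ₁ * |(z m : ℝ)|) fun s _ => ?_).trans_eq (by simp))
              rw [← sub_mul, abs_mul, abs_sub_comm]
              exact mul_le_mul (hvu s i) (hm s (Finset.mem_univ s)) (abs_nonneg _) hδ₁
            have h4 := abs_sub_abs_le_abs_sub (∑ s, u s i * (z s : ℝ)) (∑ s, v s i * (z s : ℝ))
            linarith
        _ = _ := by rw [Finset.sum_add_distrib]; simp
    have h3 : |(z m : ℝ)| ≤ T * (∑ i, |∑ s, v s i * z s| + n * (R * (δ₁ * |(z m : ℝ)|))) :=
      h1.trans (mul_le_mul_of_nonneg_left h2 hT0)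
    have h5 := mul_le_mul_of_nonneg_right hT (abs_nonneg (z m : ℝ))
    nlinarith

lemma abs_max_zero_sub_le {x y : ℝ} (hy : 0 ≤ y) : |max x 0 - y| ≤ |x - y| := by
  have h := abs_max_sub_max_le_abs x y 0
  rwa [max_eq_left hy] at h

lemma exists_nat_near {x Q : ℝ} {H : ℕ} (hQ : 0 < Q) (h : |x| * Q + 1 ≤ H) :
    ∃ d : ℕ, d ≤ 2 * H ∧ |((d : ℝ) - H) / Q - x| ≤ 1 / Q := by
  have h1 : |x * Q| + 1 ≤ H := by rwa [abs_mul, abs_of_pos hQ]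
  have h2 := abs_le.1 (by linarith : |x * Q| ≤ H - 1)
  refine ⟨⌊x * Q + H⌋₊, ?_, ?_⟩
  · have : (⌊x * Q + H⌋₊ : ℝ) ≤ 2 * H := (Nat.floor_le (by linarith)).trans (by linarith)
    exact_mod_cast this
  · have h3 := Nat.floor_le (by linarith : 0 ≤ x * Q + H)
    have h4 := Nat.lt_floor_add_one (x * Q + H)
    have e : ((⌊x * Q + H⌋₊ : ℝ) - H) / Q - x = ((⌊x * Q + H⌋₊ : ℝ) - H - x * Q) / Q := by
      field_simp
    rw [e, abs_div, abs_of_pos hQ]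
    refine div_le_div_of_nonneg_right ?_ hQ.le
    rw [abs_le]
    constructor <;> linarith

/-- The word distributions of a candidate, for the empirical tensor `S`, fibres `f` and coefficients
`x`. -/
noncomputable def candidateWord (S : (Fin (ℓ + 1) → Fin n) → ℝ) (f : Fin R → Fin ℓ → Fin n)
    (x : Fin R → Fin R → ℝ) (s : Fin R) (i : Fin n) : ℝ :=
  max (∑ j, S (Fin.cons i (f j)) * x s j) 0

lemma exists_candidate {k : ℕ} {u : Fin R → Fin n → ℝ} {w : Fin R → ℝ} {κ γ ε Q : ℝ} {H : ℕ}
    {S : (Fin (ℓ + 1) → Fin n) → ℝ} (hκ : 0 ≤ κ) (hγ : 0 < γ) (hw : ∀ r, γ ≤ w r)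
    (hw1 : ∀ r, w r ≤ 1) (hu0 : ∀ s i, 0 ≤ u s i)
    (hu : RobustIndep κ k fun s => (WithLp.toLp 2 (u s) : EuclideanSpace ℝ (Fin n))) (hk : 1 ≤ k)
    (hR : R ≤ ℓ * (k - 1) + 1) (hQ : 0 < Q) (hε : 0 ≤ ε)
    (hH : 1 / γ * ((n : ℝ) ^ ℓ * κ ^ ℓ) * Q + 1 ≤ H)
    (hεQ : ε * (1 / γ * ((n : ℝ) ^ ℓ * κ ^ ℓ)) ≤ 1 / Q) (hQH : Q ≤ H) (hS1 : ∀ i, |S i| ≤ 1)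
    (hS : ∀ i, |S i - ∑ s, w s * ∏ a, u s (i a)| ≤ ε) :
    ∃ (f : Fin R → Fin ℓ → Fin n) (d : Fin R → Fin R → ℕ) (e : Fin R → ℕ),
      (∀ s j, d s j ≤ 2 * H) ∧ (∀ s, e s ≤ H) ∧ (∀ s, |(e s : ℝ) / Q - w s| ≤ 1 / Q) ∧
      ∀ s i, |candidateWord S f (fun s j => ((d s j : ℝ) - H) / Q) s i - u s i| ≤ R * (2 / Q) := by
  obtain ⟨f, X, hX, hfX⟩ := exists_fibres (ℓ := ℓ) hκ hγ hw hu hk hR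
  have hd : ∀ s j, ∃ d : ℕ, d ≤ 2 * H ∧ |((d : ℝ) - H) / Q - X j s| ≤ 1 / Q := fun s j =>
    exists_nat_near hQ (le_trans (by
      have := mul_le_mul_of_nonneg_right (hX j s) hQ.le
      linarith) hH)
  choose d hd1 hd2 using hd
  refine ⟨f, d, fun s => ⌊w s * Q⌋₊, hd1, fun s => ?_, fun s => ?_, fun s i => ?_⟩
  · have h0 : 0 ≤ w s := hγ.le.trans (hw s)
    have h1 : (⌊w s * Q⌋₊ : ℝ) ≤ H := (Nat.floor_le (by positivity)).trans
      ((mul_le_of_le_one_left hQ.le (hw1 s)).trans hQH)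
    exact_mod_cast h1
  · have h0 : 0 ≤ w s := hγ.le.trans (hw s)
    have h3 := Nat.floor_le (by positivity : 0 ≤ w s * Q)
    have h4 := Nat.lt_floor_add_one (w s * Q)
    have e : (⌊w s * Q⌋₊ : ℝ) / Q - w s = ((⌊w s * Q⌋₊ : ℝ) - w s * Q) / Q := by
      field_simp
    rw [e, abs_div, abs_of_pos hQ]
    refine div_le_div_of_nonneg_right ?_ hQ.le
    rw [abs_le]
    constructor <;> linarith
  · refine (abs_max_zero_sub_le (hu0 s i)).trans ?_
    have h1 : u s i = _ := hfX s i
    rw [h1, ← Finset.sum_sub_distrib]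
    refine (Finset.abs_sum_le_sum_abs _ _).trans ((Finset.sum_le_card_nsmul _ _
      (2 / Q) fun j _ => ?_).trans_eq (by simp))
    have h2 := hS (Fin.cons i (f j))
    simp only [Fin.prod_univ_succ, Fin.cons_zero, Fin.cons_succ] at h2
    set A := ∑ s, w s * (u s i * ∏ a, u s (f j a)) with hA
    change |S (Fin.cons i (f j)) * (((d s j : ℝ) - H) / Q) - X j s * A| ≤ 2 / Q
    calc |S (Fin.cons i (f j)) * (((d s j : ℝ) - H) / Q) - X j s * A|
        = |S (Fin.cons i (f j)) * (((d s j : ℝ) - H) / Q - X j s)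
          + (S (Fin.cons i (f j)) - A) * X j s| := by congr 1; ring
      _ ≤ |S (Fin.cons i (f j))| * |((d s j : ℝ) - H) / Q - X j s|
          + |S (Fin.cons i (f j)) - A| * |X j s| := by
          refine (abs_add_le _ _).trans_eq ?_
          rw [abs_mul, abs_mul]
      _ ≤ 1 * (1 / Q) + ε * (1 / γ * ((n : ℝ) ^ ℓ * κ ^ ℓ)) :=
          add_le_add (mul_le_mul (hS1 _) (hd2 s j) (abs_nonneg _) zero_le_one)
            (mul_le_mul h2 (hX j s) (abs_nonneg _) hε)
      _ ≤ 1 * (1 / Q) + 1 / Q := by gcongr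
      _ = 2 / Q := by ring

end Acceptance

lemma exists_digits {D L : ℕ} (y : ℕ → ℕ) (hy : ∀ i < L, y i < D) :
    ∃ z < D ^ L, ∀ i < L, z / D ^ i % D = y i := by
  let f : Fin L → Fin D := fun i => ⟨y i, hy i i.2⟩
  refine ⟨finFunctionFinEquiv f, (finFunctionFinEquiv f).2, fun i hi => ?_⟩
  have h := congrFun (finFunctionFinEquiv.symm_apply_apply f) ⟨i, hi⟩
  exact congrArg Fin.val h

lemma Nat.cast_dist_real (a b : ℕ) : ((Nat.dist a b : ℕ) : ℝ) = |(a : ℝ) - b| := by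
  rcases le_total a b with h | h
  · rw [Nat.dist_eq_sub_of_le h, Nat.cast_sub h, abs_sub_comm, abs_of_nonneg]
    exact sub_nonneg.2 (by exact_mod_cast h)
  · rw [Nat.dist_eq_sub_of_le_right h, Nat.cast_sub h, abs_of_nonneg]
    exact sub_nonneg.2 (by exact_mod_cast h)

lemma Nat.cast_sub_real (a b : ℕ) : ((a - b : ℕ) : ℝ) = max ((a : ℝ) - b) 0 := by
  rcases le_total a b with h | h
  · rw [Nat.sub_eq_zero_of_le h, max_eq_right (sub_nonpos.2 (by exact_mod_cast h)), Nat.cast_zero]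
  · rw [Nat.cast_sub h, max_eq_left (sub_nonneg.2 (by exact_mod_cast h))]

lemma mul_dist_le_iff {a b t M : ℕ} {x y : ℝ} (ha : (a : ℝ) = M * x) (hb : (b : ℝ) = M * y)
    (hM : 0 < M) (ht : 0 < t) : t * Nat.dist a b ≤ M ↔ |x - y| ≤ 1 / t := by
  have hM' : (0 : ℝ) < M := by exact_mod_cast hM
  have ht' : (0 : ℝ) < t := by exact_mod_cast ht
  rw [← Nat.cast_le (α := ℝ), Nat.cast_mul, Nat.cast_dist_real, ha, hb, ← mul_sub, abs_mul,
    abs_of_pos hM', le_div_iff₀ ht']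
  constructor
  · intro h
    refine le_of_mul_le_mul_left ?_ hM'
    linarith
  · intro h
    have := mul_le_mul_of_nonneg_left h hM'.le
    linarith

namespace RecoveryData

variable (ℓ c : ℕ) (I : RecoveryData)

/-- The relative frequency of a document. -/
noncomputable def frequency (i : Fin ℓ → Fin I.n) : ℝ :=
  (I.count ℓ c fun a => if h : a < ℓ then i ⟨a, h⟩ else 0 : ℕ) / (I.docs ℓ c : ℝ)

/-- The word distributions of a candidate. -/
noncomputable def wordVec (z : ℕ) (s : Fin I.R) (i : Fin I.n) : ℝ :=
  (I.wordNum ℓ c z i s : ℝ) / I.den ℓ c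

/-- The weights of a candidate. -/
noncomputable def weight (z : ℕ) (s : Fin I.R) : ℝ := (I.weightNum ℓ c z s : ℝ) / I.den ℓ c

variable {ℓ c I}

lemma count_congr {w w' : ℕ → ℕ} (h : ∀ a < ℓ, w a = w' a) : I.count ℓ c w = I.count ℓ c w' :=
  Finset.sum_congr rfl fun _ _ => Finset.prod_congr rfl fun a ha => by rw [h a (Finset.mem_range.1 ha)]

lemma docs_pos (hb : 0 < I.base ℓ c) : 0 < I.docs ℓ c := pow_pos hb _

lemma grid_pos (hb : 0 < I.base ℓ c) : 0 < I.grid ℓ c := pow_pos hb _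

lemma den_pos (hb : 0 < I.base ℓ c) : 0 < I.den ℓ c := Nat.mul_pos (docs_pos hb) (grid_pos hb)

lemma wordNum_eq (hb : 0 < I.base ℓ c) (z : ℕ) (s : Fin I.R) (i : Fin I.n) :
    (I.wordNum ℓ c z i s : ℝ) = I.den ℓ c * I.wordVec ℓ c z s i := by
  have : (I.den ℓ c : ℝ) ≠ 0 := by exact_mod_cast (den_pos hb).ne'
  rw [wordVec, mul_div_cancel₀ _ this]

lemma weightNum_eq (hb : 0 < I.base ℓ c) (z : ℕ) (s : Fin I.R) :
    (I.weightNum ℓ c z s : ℝ) = I.den ℓ c * I.weight ℓ c z s := by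
  have : (I.den ℓ c : ℝ) ≠ 0 := by exact_mod_cast (den_pos hb).ne'
  rw [weight, mul_div_cancel₀ _ this]

lemma wordVec_nonneg (z : ℕ) (s : Fin I.R) (i : Fin I.n) : 0 ≤ I.wordVec ℓ c z s i := by
  unfold wordVec; positivity

lemma weight_nonneg (z : ℕ) (s : Fin I.R) : 0 ≤ I.weight ℓ c z s := by
  unfold weight; positivity

lemma weight_eq (hb : 0 < I.base ℓ c) (z : ℕ) (s : Fin I.R) :
    I.weight ℓ c z s = I.digit ℓ c z (I.R * I.R + s) / I.grid ℓ c := by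
  have h1 : (I.docs ℓ c : ℝ) ≠ 0 := by exact_mod_cast (docs_pos hb).ne'
  have h2 : (I.grid ℓ c : ℝ) ≠ 0 := by exact_mod_cast (grid_pos hb).ne'
  rw [weight, weightNum, den, Nat.cast_mul, Nat.cast_mul]
  field_simp

lemma tensor_test_iff (hb : 0 < I.base ℓ c) (z : ℕ) (i : Fin ℓ → Fin I.n) {x : ℕ}
    (hx : ∀ a : Fin ℓ, x / I.n ^ (a : ℕ) % I.n = i a) :
    I.tolInv ℓ c * Nat.dist
      (∑ s ∈ Finset.range I.R, I.weightNum ℓ c z s *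
        ∏ a ∈ Finset.range ℓ, I.wordNum ℓ c z (x / I.n ^ a % I.n) s)
      (I.count ℓ c (fun a => x / I.n ^ a % I.n) * I.grid ℓ c * I.den ℓ c ^ ℓ)
      ≤ I.den ℓ c ^ (ℓ + 1) ↔
    |∑ s, I.weight ℓ c z s * ∏ a, I.wordVec ℓ c z s (i a) - I.frequency ℓ c i|
      ≤ 1 / I.tolInv ℓ c := by
  refine mul_dist_le_iff ?_ ?_ (pow_pos (den_pos hb) _) (pow_pos hb _)
  · rw [Finset.sum_range, Nat.cast_sum, Finset.mul_sum]
    refine Finset.sum_congr rfl fun s _ => ?_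
    rw [Finset.prod_range, Nat.cast_mul, Nat.cast_prod, weightNum_eq hb]
    have : ∀ a : Fin ℓ, (I.wordNum ℓ c z (x / I.n ^ (a : ℕ) % I.n) s : ℝ)
        = I.den ℓ c * I.wordVec ℓ c z s (i a) := fun a => by rw [hx, wordNum_eq hb]
    simp only [this, Finset.prod_mul_distrib]
    simp only [Finset.prod_const, Finset.card_univ, Fintype.card_fin]
    push_cast
    ring
  · have h1 : (I.docs ℓ c : ℝ) ≠ 0 := by exact_mod_cast (docs_pos hb).ne'
    rw [frequency, count_congr (w := fun a => x / I.n ^ a % I.n)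
      (w' := fun a => if h : a < ℓ then i ⟨a, h⟩ else 0) fun a ha => by
        rw [dif_pos ha]; exact hx ⟨a, ha⟩]
    rw [pow_succ]
    push_cast
    rw [den]
    push_cast
    field_simp

lemma sum_test_iff (hb : 0 < I.base ℓ c) (z : ℕ) (s : Fin I.R) :
    I.tolInv ℓ c * Nat.dist (∑ i ∈ Finset.range I.n, I.wordNum ℓ c z i s) (I.den ℓ c)
      ≤ I.den ℓ c ↔ |∑ i, I.wordVec ℓ c z s i - 1| ≤ 1 / I.tolInv ℓ c := by
  refine mul_dist_le_iff ?_ (by rw [mul_one]) (den_pos hb) (pow_pos hb _)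
  rw [Finset.sum_range, Nat.cast_sum, Finset.mul_sum]
  exact Finset.sum_congr rfl fun i _ => wordNum_eq hb z s i

lemma rank_test_iff (hb : 0 < I.base ℓ c) (z : ℕ) (d : ℕ → ℕ) (s : Fin I.R) :
    Nat.dist (d s) (I.offset ℓ c) * I.den ℓ c ≤ 2 * I.T * ∑ i ∈ Finset.range I.n,
      Nat.dist (∑ j ∈ Finset.range I.R, I.wordNum ℓ c z i j * d j)
        (∑ j ∈ Finset.range I.R, I.wordNum ℓ c z i j * I.offset ℓ c) ↔
    |((((d s : ℤ) - I.offset ℓ c : ℤ)) : ℝ)| ≤ 2 * I.T * ∑ i, |∑ j, I.wordVec ℓ c z j i *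
      (((d j : ℤ) - I.offset ℓ c : ℤ) : ℝ)| := by
  have hd : (0 : ℝ) < I.den ℓ c := by exact_mod_cast den_pos hb
  have h1 : ∀ i : Fin I.n, ((Nat.dist (∑ j ∈ Finset.range I.R, I.wordNum ℓ c z i j * d j)
      (∑ j ∈ Finset.range I.R, I.wordNum ℓ c z i j * I.offset ℓ c) : ℕ) : ℝ)
      = I.den ℓ c * |∑ j, I.wordVec ℓ c z j i * (((d j : ℤ) - I.offset ℓ c : ℤ) : ℝ)| := by
    intro i
    rw [Nat.cast_dist_real, Finset.sum_range, Finset.sum_range, Nat.cast_sum, Nat.cast_sum,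
      ← Finset.sum_sub_distrib, ← abs_of_pos hd, ← abs_mul, Finset.mul_sum]
    congr 1
    refine Finset.sum_congr rfl fun j _ => ?_
    rw [Nat.cast_mul, Nat.cast_mul, wordNum_eq hb]
    push_cast
    ring
  rw [← Nat.cast_le (α := ℝ), Finset.sum_range]
  push_cast
  simp only [h1]
  rw [Nat.cast_dist_real, ← Finset.mul_sum]
  push_cast
  constructor
  · intro h
    refine le_of_mul_le_mul_right ?_ hd
    linarith
  · intro h
    have := mul_le_mul_of_nonneg_right h hd.le
    linarith

variable (ℓ c I) in
/-- The array holds the powers of the radix. -/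
def HasPowers : Prop := ∀ i ≤ I.len ℓ, I.mem (I.docs ℓ c * ℓ + i) = I.radix ℓ c ^ i

lemma HasPowers.exists_digits (h : I.HasPowers ℓ c) (y : ℕ → ℕ)
    (hy : ∀ i < I.len ℓ, y i < I.radix ℓ c) :
    ∃ z < I.total ℓ c, ∀ i < I.len ℓ, I.digit ℓ c z i = y i := by
  obtain ⟨z, hz, hd⟩ := _root_.exists_digits y hy
  refine ⟨z, by rw [total, h _ le_rfl]; exact hz, fun i hi => ?_⟩
  rw [digit, h i hi.le]
  exact hd i hi

lemma digit_lt (hb : 0 < I.base ℓ c) (z i : ℕ) : I.digit ℓ c z i < I.radix ℓ c :=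
  Nat.mod_lt _ (pow_pos hb _)

lemma card_support (d : ℕ → ℕ) (H : ℕ) :
    ∑ j ∈ Finset.range I.R, (if d j = H then 0 else 1)
      = (Finset.univ.filter fun j : Fin I.R => ((d j : ℤ) - H : ℤ) ≠ 0).card := by
  rw [Finset.sum_range, Finset.card_filter]
  refine Finset.sum_congr rfl fun j _ => ?_
  by_cases h : d j = H
  · simp [h]
  · rw [if_neg h, if_pos]
    intro h'
    exact h (by omega)

lemma accepted_of_bad_eq_zero (hb : 0 < I.base ℓ c) (hI : I.HasPowers ℓ c) {z : ℕ}
    (hz : I.bad ℓ c z = 0) (hr : 2 * I.offset ℓ c < I.radix ℓ c) :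
    Accepted (I.frequency ℓ c) (1 / I.tolInv ℓ c) I.T (I.rank ℓ) (I.offset ℓ c) (I.wordVec ℓ c z)
      (I.weight ℓ c z) := by
  have h1 : I.badTensor ℓ c z = 0 := by rw [bad] at hz; omega
  have h2 : I.badSum ℓ c z = 0 := by rw [bad] at hz; omega
  have h3 : I.badRank ℓ c z = 0 := by rw [bad] at hz; omega
  rw [badTensor, Finset.sum_eq_zero_iff] at h1
  rw [badSum, Finset.sum_eq_zero_iff] at h2
  rw [badRank, Finset.sum_eq_zero_iff] at h3
  refine ⟨fun i => ?_, fun s => ?_, fun v hv hk s => ?_⟩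
  · have hx : ∀ a : Fin ℓ, (finFunctionFinEquiv i : ℕ) / I.n ^ (a : ℕ) % I.n = i a := fun a =>
      congrArg Fin.val (congrFun (finFunctionFinEquiv.symm_apply_apply i) a)
    rw [← tensor_test_iff hb z i hx]
    have := h1 (finFunctionFinEquiv i) (Finset.mem_range.2 (finFunctionFinEquiv i).2)
    by_contra hne
    rw [if_neg hne] at this
    exact one_ne_zero this
  · rw [← sum_test_iff hb z s]
    have := h2 s (Finset.mem_range.2 s.2)
    by_contra hne
    rw [if_neg hne] at this
    exact one_ne_zero this
  · have hoff : 0 < I.offset ℓ c := pow_pos hb _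
    set d : ℕ → ℕ := fun j => if h : j < I.R then (v ⟨j, h⟩ + I.offset ℓ c).toNat else 0 with hd
    have hdv : ∀ j : Fin I.R, (d j : ℤ) - I.offset ℓ c = v j := by
      intro j
      have := abs_le.1 (hv j)
      simp only [hd, Fin.is_lt, dif_pos, Fin.eta]
      omega
    obtain ⟨y, hy, hyd⟩ := hI.exists_digits d (fun i hi => by
      by_cases h : i < I.R
      · have := abs_le.1 (hv ⟨i, h⟩)
        have h' := hdv ⟨i, h⟩
        dsimp only at h'
        omega
      · simp only [hd, h, dif_neg, not_false_eq_true]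
        omega)
    have hlen : I.R ≤ I.len ℓ := by
      rw [len, add_right_comm]; exact Nat.le_add_left _ _
    have hyd' : ∀ j : Fin I.R, ((I.digit ℓ c y j : ℕ) : ℤ) - I.offset ℓ c = v j := fun j => by
      rw [hyd j (j.2.trans_le hlen), hdv]
    have h4 := h3 y (Finset.mem_range.2 hy)
    rw [card_support (fun j => I.digit ℓ c y j)] at h4
    simp only [hyd'] at h4
    rw [if_pos hk, Finset.sum_eq_zero_iff] at h4
    have h5 := h4 s (Finset.mem_range.2 s.2)
    have h6 := rank_test_iff hb z (fun j => I.digit ℓ c y j) s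
    simp only [hyd'] at h6
    rw [← h6]
    by_contra hne
    rw [if_neg hne] at h5
    exact one_ne_zero h5

lemma bad_eq_zero_of_accepted (hb : 0 < I.base ℓ c) {z : ℕ} (hn : 0 < I.n)
    (h : Accepted (I.frequency ℓ c) (1 / I.tolInv ℓ c) I.T (I.rank ℓ) (I.radix ℓ c)
      (I.wordVec ℓ c z) (I.weight ℓ c z)) (hr : I.offset ℓ c ≤ I.radix ℓ c) :
    I.bad ℓ c z = 0 := by
  have h1 : I.badTensor ℓ c z = 0 := by
    refine Finset.sum_eq_zero fun x _ => if_pos ?_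
    rw [tensor_test_iff hb z (fun a => ⟨x / I.n ^ (a : ℕ) % I.n, Nat.mod_lt _ hn⟩) fun a => rfl]
    exact h.tensor _
  have h2 : I.badSum ℓ c z = 0 := by
    refine Finset.sum_eq_zero fun s hs => if_pos ?_
    have := sum_test_iff hb z ⟨s, Finset.mem_range.1 hs⟩
    exact this.2 (h.sum _)
  have h3 : I.badRank ℓ c z = 0 := by
    refine Finset.sum_eq_zero fun y _ => ?_
    split_ifs with hk
    · refine Finset.sum_eq_zero fun s hs => if_pos ?_
      rw [card_support (fun j => I.digit ℓ c y j)] at hk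
      have := rank_test_iff hb z (fun j => I.digit ℓ c y j) ⟨s, Finset.mem_range.1 hs⟩
      refine this.2 (h.rank (fun j => (I.digit ℓ c y j : ℤ) - I.offset ℓ c) (fun j => ?_) hk _)
      have := digit_lt hb y j
      rw [abs_le]
      omega
    · rfl
  rw [bad, h1, h2, h3]

lemma select_spec {z : ℕ} (hz : z < I.total ℓ c) (hbad : I.bad ℓ c z = 0) :
    I.bad ℓ c (I.select ℓ c) = 0 := by
  classical
  have hex : ∃ z, I.bad ℓ c z = 0 := ⟨z, hbad⟩
  have hle : Nat.find hex ≤ z := Nat.find_min' hex hbad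
  have : I.select ℓ c = Nat.find hex := by
    rw [select]
    have h1 : ∀ y, (∑ z ∈ Finset.range (y + 1), (if I.bad ℓ c z = 0 then 1 else 0) = 0)
        ↔ y < Nat.find hex := by
      intro y
      rw [Finset.sum_eq_zero_iff, Nat.lt_find_iff]
      refine ⟨fun h m hm hm0 => ?_, fun h m hm => if_neg (h m ?_)⟩
      · have := h m (Finset.mem_range.2 (by omega))
        rw [if_pos hm0] at this
        exact one_ne_zero this
      · have := Finset.mem_range.1 hm; omega
    simp only [h1]
    rw [← Finset.card_filter]
    have : (Finset.range (I.total ℓ c)).filter (fun y => y < Nat.find hex)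
        = Finset.range (Nat.find hex) := by
      ext y
      simp only [Finset.mem_filter, Finset.mem_range]
      omega
    rw [this, Finset.card_range]
  rw [this]
  exact Nat.find_spec hex

lemma wordVec_eq_candidateWord {m : ℕ} (hb : 0 < I.base (m + 1) c) {z : ℕ}
    {f : Fin I.R → Fin m → Fin I.n} {d : Fin I.R → Fin I.R → ℕ}
    (hf : ∀ (j : Fin I.R) (a : Fin m),
      I.digit (m + 1) c z (I.R * I.R + I.R + j * (m + 1) + (a + 1)) = f j a)
    (hd : ∀ s j : Fin I.R, I.digit (m + 1) c z (s * I.R + j) = d s j) (s : Fin I.R) (i : Fin I.n) :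
    I.wordVec (m + 1) c z s i = candidateWord (I.frequency (m + 1) c) f
      (fun s j => ((d s j : ℝ) - I.offset (m + 1) c) / I.grid (m + 1) c) s i := by
  have h1 : (0 : ℝ) < I.docs (m + 1) c := by exact_mod_cast docs_pos hb
  have h2 : (0 : ℝ) < I.grid (m + 1) c := by exact_mod_cast grid_pos hb
  have hc : ∀ j : Fin I.R, (I.count (m + 1) c (I.fibre (m + 1) c z i j) : ℝ)
      = I.docs (m + 1) c * I.frequency (m + 1) c (Fin.cons i (f j)) := by
    intro j
    rw [frequency, mul_div_cancel₀ _ h1.ne']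
    congr 1
    refine count_congr fun a ha => ?_
    rw [dif_pos ha]
    rcases a with _ | a
    · rfl
    · rw [fibre, if_neg (by omega), hf j ⟨a, by omega⟩]
      rfl
  rw [wordVec, wordNum, Nat.cast_sub_real, candidateWord, Finset.sum_range, Finset.sum_range,
    Nat.cast_sum, Nat.cast_sum, ← Finset.sum_sub_distrib, ← max_div_div_right (by positivity),
    zero_div, Finset.sum_div, den]
  congr 1
  refine Finset.sum_congr rfl fun j _ => ?_
  rw [Nat.cast_mul, Nat.cast_mul, hc, hd]
  push_cast
  field_simp

lemma HasPowers.exists_candidate_digits {m : ℕ} (h : I.HasPowers (m + 1) c)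
    (f : Fin I.R → Fin m → Fin I.n) (d : Fin I.R → Fin I.R → ℕ) (e : Fin I.R → ℕ)
    (hn : I.n ≤ I.radix (m + 1) c)
    (hd : ∀ s j, d s j < I.radix (m + 1) c) (he : ∀ s, e s < I.radix (m + 1) c) :
    ∃ z < I.total (m + 1) c, (∀ (j : Fin I.R) (a : Fin m),
      I.digit (m + 1) c z (I.R * I.R + I.R + j * (m + 1) + (a + 1)) = f j a) ∧
      (∀ s j : Fin I.R, I.digit (m + 1) c z (s * I.R + j) = d s j) ∧
      ∀ s : Fin I.R, I.digit (m + 1) c z (I.R * I.R + s) = e s := by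
  rcases Nat.eq_zero_or_pos I.R with hR | hR
  · have : IsEmpty (Fin I.R) := by rw [hR]; infer_instance
    obtain ⟨z, hz, -⟩ := h.exists_digits (fun _ => 0) (fun i hi => by simp [len, hR] at hi)
    exact ⟨z, hz, isEmptyElim, isEmptyElim, isEmptyElim⟩
  have hrad : 0 < I.radix (m + 1) c := (Nat.zero_le _).trans_lt (hd ⟨0, hR⟩ ⟨0, hR⟩)
  set y : ℕ → ℕ := fun x =>
    if x < I.R * I.R then if h : x / I.R < I.R then d ⟨x / I.R, h⟩ ⟨x % I.R, Nat.mod_lt _ hR⟩ else 0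
    else if h : x - I.R * I.R < I.R then e ⟨x - I.R * I.R, h⟩
    else if h : (x - I.R * I.R - I.R) / (m + 1) < I.R ∧ (x - I.R * I.R - I.R) % (m + 1) - 1 < m then
      (f ⟨_, h.1⟩ ⟨_, h.2⟩ : ℕ) else 0 with hy
  obtain ⟨z, hz, hzd⟩ := h.exists_digits y (fun x _ => by
    simp only [hy]
    split_ifs
    · exact hd _ _
    · exact hrad
    · exact he _
    · exact (Fin.is_lt _).trans_le hn
    · exact hrad)
  refine ⟨z, hz, fun j a => ?_, fun s j => ?_, fun s => ?_⟩
  · have h1 : (j : ℕ) * (m + 1) + (a + 1) < I.R * (m + 1) := by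
      calc (j : ℕ) * (m + 1) + (a + 1) < j * (m + 1) + (m + 1) := by omega
        _ = (j + 1) * (m + 1) := by ring
        _ ≤ _ := Nat.mul_le_mul_right _ j.2
    rw [hzd _ (by rw [len]; omega)]
    have e1 : I.R * I.R + I.R + j * (m + 1) + (a + 1) - I.R * I.R - I.R
        = (m + 1) * j + (a + 1) := by rw [mul_comm (m + 1)]; omega
    have e2 : ((m + 1) * (j : ℕ) + (a + 1)) / (m + 1) = j := by
      rw [Nat.mul_add_div (by omega), Nat.div_eq_of_lt (by omega), Nat.add_zero]
    have e3 : ((m + 1) * (j : ℕ) + (a + 1)) % (m + 1) = a + 1 := by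
      rw [Nat.mul_add_mod, Nat.mod_eq_of_lt (by omega)]
    simp only [hy]
    rw [if_neg (by omega), dif_neg (by omega)]
    simp only [e1, e2, e3, Nat.add_sub_cancel]
    rw [dif_pos ⟨j.2, a.2⟩]
  · have h1 : (s : ℕ) * I.R + j < I.R * I.R := by
      calc (s : ℕ) * I.R + j < s * I.R + I.R := by omega
        _ = (s + 1) * I.R := by ring
        _ ≤ _ := Nat.mul_le_mul_right _ s.2
    rw [hzd _ (by rw [len]; omega)]
    have e2 : ((s : ℕ) * I.R + j) / I.R = s := by
      rw [mul_comm, Nat.mul_add_div hR, Nat.div_eq_of_lt j.2, Nat.add_zero]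
    have e3 : ((s : ℕ) * I.R + j) % I.R = j := by
      rw [mul_comm, Nat.mul_add_mod, Nat.mod_eq_of_lt j.2]
    simp only [hy]
    rw [if_pos h1]
    simp only [e2, e3]
    rw [dif_pos s.2]
  · rw [hzd _ (by rw [len]; omega)]
    simp only [hy]
    rw [if_neg (by omega), dif_pos (by omega)]
    simp only [Nat.add_sub_cancel_left]

end RecoveryData

lemma corpusData_hasPowers (ℓ c : ℕ) {n : ℕ} (R E G T : ℕ) (X : ℕ → Fin ℓ → Fin n) :
    (corpusData ℓ c R E G T X).HasPowers ℓ c := by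
  intro i hi
  set I := corpusData ℓ c R E G T X
  change (if I.docs ℓ c * ℓ + i < I.docs ℓ c * ℓ then _ else
    if I.docs ℓ c * ℓ + i ≤ I.docs ℓ c * ℓ + I.len ℓ then
      I.radix ℓ c ^ (I.docs ℓ c * ℓ + i - I.docs ℓ c * ℓ) else 0) = _
  rw [if_neg (by omega), if_pos (by omega), Nat.add_sub_cancel_left]

lemma corpusData_frequency (ℓ c : ℕ) {n : ℕ} (R E G T : ℕ) (X : ℕ → Fin ℓ → Fin n)
    (i : Fin ℓ → Fin n) : (corpusData ℓ c R E G T X).frequency ℓ c i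
      = TopicModel.docCount X ((corpusData ℓ c R E G T X).docs ℓ c) i
        / ((corpusData ℓ c R E G T X).docs ℓ c : ℝ) := by
  set I := corpusData ℓ c R E G T X with hI
  change ((I.count ℓ c fun a => if h : a < ℓ then (i ⟨a, h⟩ : ℕ) else 0 : ℕ) : ℝ) / _ = _
  rw [RecoveryData.count, TopicModel.docCount, Finset.card_filter]
  congr 2
  refine Finset.sum_congr rfl fun j hj => ?_
  have hj := Finset.mem_range.1 hj
  have hmem : ∀ a (ha : a < ℓ), I.mem (j * ℓ + a) = (X j ⟨a, ha⟩ : ℕ) := by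
    intro a ha
    have hlt : j * ℓ + a < I.docs ℓ c * ℓ := by
      calc j * ℓ + a < j * ℓ + ℓ := by omega
        _ = (j + 1) * ℓ := by ring
        _ ≤ _ := Nat.mul_le_mul_right _ hj
    change (if j * ℓ + a < I.docs ℓ c * ℓ then corpusWord X (j * ℓ + a) else _) = _
    rw [if_pos hlt, corpusWord, dif_pos (by omega)]
    have e2 : (j * ℓ + a) / ℓ = j := by
      rw [mul_comm, Nat.mul_add_div (by omega), Nat.div_eq_of_lt ha, Nat.add_zero]
    have e3 : (j * ℓ + a) % ℓ = a := by rw [mul_comm, Nat.mul_add_mod, Nat.mod_eq_of_lt ha]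
    simp only [e2, e3]
  split_ifs with h
  · refine Finset.prod_eq_one fun a ha => ?_
    have ha := Finset.mem_range.1 ha
    rw [if_pos]
    rw [hmem a ha, dif_pos ha, h]
  · have : ∃ a, X j a ≠ i a := by
      by_contra hne
      push Not at hne
      exact h (funext hne)
    obtain ⟨a, ha⟩ := this
    refine Finset.prod_eq_zero (Finset.mem_range.2 a.2) ?_
    rw [if_neg]
    rw [hmem a a.2, dif_pos a.2]
    exact fun h => ha (Fin.ext h)

namespace TopicModel

variable {n R : ℕ}

lemma weight_nonneg (𝓜 : TopicModel n R) (r : Fin R) : 0 ≤ 𝓜.weight r := ENNReal.toReal_nonneg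

lemma sum_weight (𝓜 : TopicModel n R) : ∑ r, 𝓜.weight r = 1 := by
  have h := 𝓜.topic.tsum_coe
  rw [tsum_fintype] at h
  unfold weight
  rw [← ENNReal.toReal_sum fun r _ => PMF.apply_ne_top _ _, h, ENNReal.toReal_one]

lemma weight_le_one (𝓜 : TopicModel n R) (r : Fin R) : 𝓜.weight r ≤ 1 := by
  rw [← 𝓜.sum_weight]
  exact Finset.single_le_sum (fun s _ => 𝓜.weight_nonneg s) (Finset.mem_univ r)

lemma wordMatrix_nonneg (𝓜 : TopicModel n R) (i : Fin n) (r : Fin R) : 0 ≤ 𝓜.wordMatrix i r :=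
  ENNReal.toReal_nonneg

lemma sum_wordMatrix (𝓜 : TopicModel n R) (r : Fin R) : ∑ i, 𝓜.wordMatrix i r = 1 := by
  have h := (𝓜.word r).tsum_coe
  rw [tsum_fintype] at h
  simp only [wordMatrix, Matrix.of_apply]
  rw [← ENNReal.toReal_sum fun r _ => PMF.apply_ne_top _ _, h, ENNReal.toReal_one]

/-- The word distribution of a topic as a vector. -/
noncomputable def wordVector (𝓜 : TopicModel n R) (r : Fin R) : EuclideanSpace ℝ (Fin n) :=
  WithLp.toLp 2 fun i => 𝓜.wordMatrix i r

lemma norm_wordVector_le (𝓜 : TopicModel n R) (r : Fin R) : ‖𝓜.wordVector r‖ ≤ 1 := by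
  refine (norm_le_sum_abs _).trans_eq ?_
  rw [← 𝓜.sum_wordMatrix r]
  exact Finset.sum_congr rfl fun i _ => abs_of_nonneg (𝓜.wordMatrix_nonneg i r)

lemma robustKruskalRank_le (τ : ℝ) (M : Matrix (Fin n) (Fin R) ℝ) : robustKruskalRank τ M ≤ R := by
  rcases Set.eq_empty_or_nonempty {k : ℕ | k ≤ R ∧ ∀ S : Finset (Fin R), S.card = k →
    1 / τ ≤ sigmaK (M.submatrix id (fun j : S => (j : Fin R))) k} with h | h
  · rw [robustKruskalRank, h]; simp
  · exact csSup_le h fun k hk => hk.1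

/-- The consequences of the rank condition. -/
lemma rank_condition {ℓ : ℕ} (𝓜 : TopicModel n R) {γ τ : ℝ} (hℓ : 1 ≤ ℓ) (hτ : 0 < τ)
    (hw : ∀ r, γ < 𝓜.weight r)
    (hM : 2 * (R : ℝ) / (ℓ : ℝ) + 1 ≤ (robustKruskalRank τ 𝓜.wordMatrix : ℝ)) :
    2 ≤ R ∧ 2 ≤ n ∧ 1 ≤ τ ∧ γ < 1 / 2 ∧ 2 ≤ (2 * R + ℓ - 1) / ℓ + 1 ∧
      (2 * R + ℓ - 1) / ℓ + 1 ≤ R ∧ 2 * R ≤ ℓ * ((2 * R + ℓ - 1) / ℓ) ∧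
      RobustIndep τ ((2 * R + ℓ - 1) / ℓ + 1) 𝓜.wordVector := by
  set k := robustKruskalRank τ 𝓜.wordMatrix with hk
  have hkR : k ≤ R := robustKruskalRank_le _ _
  have hℓ' : (0 : ℝ) < ℓ := by exact_mod_cast hℓ
  have h1 : 2 * R + ℓ ≤ ℓ * k := by
    have : (2 * R + ℓ : ℝ) ≤ ℓ * k := by
      have := mul_le_mul_of_nonneg_left hM hℓ'.le
      rw [mul_add, mul_div_cancel₀ _ hℓ'.ne'] at this
      linarith
    exact_mod_cast this
  have hk1 : 1 ≤ k := by
    by_contra h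
    have : k = 0 := by omega
    rw [this] at h1
    omega
  have hRpos : 0 < R := by omega
  have hm2 : 2 * R ≤ ℓ * ((2 * R + ℓ - 1) / ℓ) := by
    have := Nat.div_add_mod (2 * R + ℓ - 1) ℓ
    have := Nat.mod_lt (2 * R + ℓ - 1) (by omega : ℓ > 0)
    omega
  have hm1 : (2 * R + ℓ - 1) / ℓ + 1 ≤ k := by
    have : (2 * R + ℓ - 1) / ℓ < k := by
      rw [Nat.div_lt_iff_lt_mul (by omega), mul_comm k ℓ]
      omega
    omega
  have hm0 : 1 ≤ (2 * R + ℓ - 1) / ℓ := by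
    rw [Nat.one_le_div_iff (by omega)]
    omega
  have hR2 : 2 ≤ R := by omega
  have hind : RobustIndep τ ((2 * R + ℓ - 1) / ℓ + 1) 𝓜.wordVector :=
    robustIndep_of_le_robustKruskalRank hτ (by omega) hm1
  set r₀ : Fin R := ⟨0, by omega⟩
  set r₁ : Fin R := ⟨1, by omega⟩
  have h01 : r₀ ≠ r₁ := by simp [r₀, r₁]
  refine ⟨hR2, ?_, ?_, ?_, by omega, hm1.trans hkR, hm2, hind⟩
  · by_contra hn
    have hcard : Subsingleton (Fin n) := by
      rw [Fin.subsingleton_iff_le_one]; omega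
    have heq : 𝓜.wordVector r₀ = 𝓜.wordVector r₁ := by
      have hone : ∀ (r : Fin R) (i : Fin n), 𝓜.wordMatrix i r = 1 := by
        intro r i
        rw [← 𝓜.sum_wordMatrix r, Finset.sum_eq_single i]
        · intro j _ hj; exact absurd (Subsingleton.elim j i) hj
        · simp
      unfold wordVector
      congr 1
      funext i
      rw [hone, hone]
    have h := hind {r₀, r₁} (by rw [Finset.card_pair h01]; omega)
      (fun r => if r = r₀ then 1 else -1) r₀ (by simp)
    rw [Finset.sum_pair h01, if_pos rfl, if_neg h01.symm, heq] at h
    simp at h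
    linarith
  · have h := hind {r₀} (by simp) (fun _ => 1) r₀ (by simp)
    simp only [Finset.sum_singleton, one_smul, abs_one] at h
    nlinarith [𝓜.norm_wordVector_le r₀]
  · have h2 : 𝓜.weight r₀ + 𝓜.weight r₁ ≤ 1 := by
      rw [← 𝓜.sum_weight, ← Finset.sum_pair h01]
      exact Finset.sum_le_sum_of_subset_of_nonneg (Finset.subset_univ _)
        fun s _ _ => 𝓜.weight_nonneg s
    have h3 := hw r₀
    have h4 := hw r₁
    linarith

end TopicModel

namespace RecoveryData

lemma offset_pos {ℓ c : ℕ} {I : RecoveryData} (hb : 0 < I.base ℓ c) : 0 < I.offset ℓ c :=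
  pow_pos hb _

/-- The lower bounds for the base that the analysis uses. -/
lemma le_base {ℓ c : ℕ} {I : RecoveryData} (hn : 1 ≤ I.n) (hR : 1 ≤ I.R) (hE : 1 ≤ I.E)
    (hG : 1 ≤ I.G) (hT : 1 ≤ I.T) {x y : ℕ} (hx : x ≤ 2 ^ (ℓ + 4) * (ℓ + c + 8))
    (hy : y ∣ I.n * I.R * I.E * I.G * I.T) : x * y ≤ I.base ℓ c :=
  Nat.mul_le_mul hx (Nat.le_of_dvd (by positivity) hy)

set_option maxHeartbeats 400000 in
/-- A candidate that passes the tests exists. -/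
lemma exists_bad_eq_zero {m c : ℕ} {I : RecoveryData} (hI : I.HasPowers (m + 1) c)
    (𝓜 : TopicModel I.n I.R) {γ τ : ℝ} (hn : 1 ≤ I.n) (hR : 1 ≤ I.R) (hE : 1 ≤ I.E)
    (hG : 1 ≤ I.G) (hT : 1 ≤ I.T) (hγ : 0 < γ) (hγG : 1 / γ ≤ I.G) (hτT : τ ≤ I.T)
    (hw : ∀ r, γ ≤ 𝓜.weight r) (hRk : I.R ≤ m * (I.rank (m + 1) - 1) + 1)
    (hind : RobustIndep τ (I.rank (m + 1)) 𝓜.wordVector)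
    (hS1 : ∀ i, |I.frequency (m + 1) c i| ≤ 1)
    (hS : ∀ i, |I.frequency (m + 1) c i - 𝓜.tensor (m + 1) i| ≤ 1 / I.offset (m + 1) c) :
    I.bad (m + 1) c (I.select (m + 1) c) = 0 := by
  have hle := @le_base (m + 1) c I hn hR hE hG hT
  have hpow1 : 1 ≤ 2 ^ (m + 1) := Nat.one_le_two_pow
  have hpow : 2 ^ (m + 1 + 4) * (m + 1 + c + 8) = 16 * 2 ^ (m + 1) * (m + c + 9) := by ring
  have h16 : ∀ x ≤ 16, x ≤ 2 ^ (m + 1 + 4) * (m + 1 + c + 8) := fun x hx => by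
    rw [hpow]
    calc x ≤ 16 * 1 := hx
      _ ≤ _ := Nat.mul_le_mul (by omega) (by omega)
  have hb3 : 3 ≤ I.base (m + 1) c := by
    have := hle (x := 3) (y := 1) (h16 _ (by norm_num)) (one_dvd _)
    omega
  have hb0 : 0 < I.base (m + 1) c := by omega
  set b : ℝ := (I.base (m + 1) c : ℝ) with hb
  have hbR3 : (3 : ℝ) ≤ b := by rw [hb]; exact_mod_cast hb3
  have hbpos : 0 < b := by linarith
  have hb1 : 1 ≤ b := by linarith
  have hcast : ∀ {x : ℕ}, x ≤ I.base (m + 1) c → (x : ℝ) ≤ b := fun h => by rw [hb]; exact_mod_cast h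
  have h2R : (2 * I.R : ℝ) ≤ b := by
    have := hcast (hle (x := 2) (y := I.R) (h16 _ (by norm_num))
      ⟨I.n * I.E * I.G * I.T, by ring⟩)
    exact_mod_cast this
  have hLR : (((m + 1 : ℕ) + 1) * 2 ^ (m + 1) * I.R : ℝ) ≤ b := by
    have := hcast (hle (x := (m + 1 + 1) * 2 ^ (m + 1)) (y := I.R) (by
      rw [hpow, mul_comm (m + 1 + 1)]
      exact Nat.mul_le_mul (by omega) (by omega))
      ⟨I.n * I.E * I.G * I.T, by ring⟩)
    exact_mod_cast this
  have h2nR : (2 * (I.n * I.R) : ℝ) ≤ b := by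
    have := hcast (hle (x := 2) (y := I.n * I.R) (h16 _ (by norm_num))
      ⟨I.E * I.G * I.T, by ring⟩)
    exact_mod_cast this
  have h2TnR : (2 * (I.T * I.n * I.R) : ℝ) ≤ b := by
    have := hcast (hle (x := 2) (y := I.T * I.n * I.R) (h16 _ (by norm_num))
      ⟨I.E * I.G, by ring⟩)
    exact_mod_cast this
  have h2G : (2 * I.G : ℝ) ≤ b := by
    have := hcast (hle (x := 2) (y := I.G) (h16 _ (by norm_num))
      ⟨I.n * I.R * I.E * I.T, by ring⟩)
    exact_mod_cast this
  have hnT : (I.n * I.T : ℝ) ≤ b := by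
    have := hcast (hle (x := 1) (y := I.n * I.T) (h16 _ (by norm_num))
      ⟨I.R * I.E * I.G, by ring⟩)
    rw [one_mul] at this
    exact_mod_cast this
  have hT0 : (1 : ℝ) ≤ I.T := by exact_mod_cast hT
  have hR0 : (1 : ℝ) ≤ I.R := by exact_mod_cast hR
  set A : ℝ := (I.tolInv (m + 1) c : ℝ) with hA
  set Q : ℝ := (I.grid (m + 1) c : ℝ) with hQ
  set H : ℝ := (I.offset (m + 1) c : ℝ) with hH
  have hApos : 0 < A := by
    rw [hA]; exact_mod_cast pow_pos hb0 _
  have hA1 : 1 ≤ A := by rw [hA]; exact_mod_cast Nat.one_le_pow _ _ hb0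
  have hQA : Q = A * b ^ 4 := by
    rw [hQ, hA, grid, tolInv, Nat.cast_pow, Nat.cast_pow, ← pow_add]
  have hHQ : H = Q * b ^ (m + 1) := by
    rw [hH, hQ, grid, offset, Nat.cast_pow, Nat.cast_pow, ← pow_add]
    congr 1; ring
  have hQpos : 0 < Q := by rw [hQA]; positivity
  have hbm : 1 ≤ b ^ (m + 1) := one_le_pow₀ hb1
  have hHpos : 0 < H := by rw [hHQ]; positivity
  have hQH : Q ≤ H := by rw [hHQ]; exact le_mul_of_one_le_right hQpos.le hbm
  have hb2 : 1 ≤ b ^ 2 := one_le_pow₀ hb1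
  have hb4Q : b ^ 4 ≤ Q := by rw [hQA]; exact le_mul_of_one_le_left (by positivity) hA1
  have hbb4 : b ^ 2 * 9 ≤ b ^ 4 := by
    have h1 : b ^ 4 = b ^ 2 * b ^ 2 := by ring
    rw [h1]
    exact mul_le_mul_of_nonneg_left (by
      have := mul_self_le_mul_self (by norm_num) hbR3
      rw [pow_two]; linarith) (by positivity)
  have hQ2 : 2 ≤ Q := by linarith
  have hbb : b ≤ b ^ 2 := le_self_pow₀ hb1 (by norm_num)
  -- the size of the coefficients
  have hX : 2 * (1 / γ * ((I.n : ℝ) ^ m * (I.T : ℝ) ^ m)) ≤ b ^ (m + 1) := by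
    calc 2 * (1 / γ * ((I.n : ℝ) ^ m * (I.T : ℝ) ^ m)) ≤ 2 * (I.G * (I.n * I.T) ^ m) := by
          rw [mul_pow]; gcongr
      _ = (2 * I.G) * (I.n * I.T) ^ m := by ring
      _ ≤ b * b ^ m := by gcongr
      _ = _ := by ring
  set Y := 1 / γ * ((I.n : ℝ) ^ m * (I.T : ℝ) ^ m) with hY
  have hγ1 : 0 < 1 / γ := by positivity
  have hY0 : 0 ≤ Y := by positivity
  have hindT : RobustIndep (I.T : ℝ) (I.rank (m + 1)) 𝓜.wordVector := hind.mono hτT le_rfl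
  obtain ⟨f, d, e, hd, he, hew, hdv⟩ := exists_candidate (ℓ := m) (κ := I.T) (γ := γ)
    (ε := 1 / H) (Q := Q) (H := I.offset (m + 1) c) (S := I.frequency (m + 1) c)
    (u := fun r i => 𝓜.wordMatrix i r) (by linarith) hγ hw 𝓜.weight_le_one
    (fun s i => 𝓜.wordMatrix_nonneg i s) hindT (Nat.le_add_left 1 _) hRk hQpos (by positivity)
    (by
      rw [← hY, ← hH, hHQ]
      have h1 := mul_le_mul_of_nonneg_left hX hQpos.le
      have h2 := mul_le_mul hQ2 hbm zero_le_one hQpos.le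
      linarith)
    (by
      rw [← hY, div_mul_eq_mul_div, one_mul, div_le_div_iff₀ hHpos hQpos, hHQ]
      have h1 := mul_le_mul_of_nonneg_left hX hQpos.le
      have h2 := mul_nonneg hQpos.le hY0
      linarith) hQH hS1 hS
  have hoff : 2 * I.offset (m + 1) c < I.radix (m + 1) c := by
    have h1 : I.radix (m + 1) c = I.offset (m + 1) c * I.base (m + 1) c := pow_succ _ _
    have h2 : 0 < I.offset (m + 1) c := offset_pos hb0
    rw [h1]
    have := Nat.mul_le_mul_left (I.offset (m + 1) c) hb3
    omega
  obtain ⟨z, hz, hz1, hz2, hz3⟩ := hI.exists_candidate_digits f d e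
    (by
      have h1 := hle (x := 1) (y := I.n) (h16 _ (by norm_num))
        ⟨I.R * I.E * I.G * I.T, by ring⟩
      rw [one_mul] at h1
      exact h1.trans (Nat.le_self_pow (by omega) _))
    (fun s j => (hd s j).trans_lt hoff) (fun s => (he s).trans_lt (by omega))
  refine select_spec hz (bad_eq_zero_of_accepted hb0 (by omega) ?_ (by omega))
  have hQinv : ∀ x : ℝ, x ≤ b ^ 4 → x / Q ≤ 1 / A := fun x hx => by
    rw [div_le_div_iff₀ hQpos hApos, hQA]
    have := mul_le_mul_of_nonneg_left hx hApos.le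
    linarith
  refine accepted_of_close (u := fun r i => 𝓜.wordMatrix i r) (w := 𝓜.weight)
    (δ₁ := I.R * (2 / Q)) (ε := 1 / H) (fun s i => 𝓜.wordMatrix_nonneg i s) 𝓜.sum_wordMatrix
    𝓜.weight_nonneg 𝓜.weight_le_one (fun s i => ?_) (fun s => ?_) (by positivity) ?_ hS ?_ ?_
    (by linarith) ?_ hindT
  · rw [wordVec_eq_candidateWord hb0 hz1 hz2]
    exact hdv s i
  · rw [weight_eq hb0, hz3]
    refine (hew s).trans ?_
    rw [mul_div_assoc']
    exact div_le_div_of_nonneg_right (by linarith) hQpos.le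
  · rw [mul_div_assoc', div_le_one hQpos]
    linarith
  · have h1 : 1 / H ≤ 1 / Q := one_div_le_one_div_of_le hQpos hQH
    calc (I.R : ℝ) * (((m + 1 : ℕ) + 1) * 2 ^ (m + 1) * (I.R * (2 / Q))) + 1 / H
        ≤ (((m + 1 : ℕ) + 1) * 2 ^ (m + 1) * I.R) * (2 * I.R) / Q + 1 / Q := by
          refine add_le_add (le_of_eq ?_) h1
          ring
      _ = ((((m + 1 : ℕ) + 1) * 2 ^ (m + 1) * I.R) * (2 * I.R) + 1) / Q := by ring
      _ ≤ 1 / A := by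
          refine hQinv _ ?_
          have := mul_le_mul hLR h2R (by positivity) hbpos.le
          linarith
  · calc (I.n : ℝ) * (I.R * (2 / Q)) = (2 * (I.n * I.R)) / Q := by ring
      _ ≤ 1 / A := hQinv _ (by linarith)
  · calc 2 * (I.T : ℝ) * I.n * I.R * (I.R * (2 / Q))
        = (2 * (I.T * I.n * I.R)) * (2 * I.R) / Q := by ring
      _ ≤ 1 := by
          rw [div_le_one hQpos]
          have := mul_le_mul h2TnR h2R (by positivity) hbpos.le
          linarith

set_option maxHeartbeats 400000 in
/-- A candidate that passes the tests is close to the truth. -/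
lemma exists_perm_of_bad_eq_zero {ℓ c : ℕ} {I : RecoveryData} (hI : I.HasPowers ℓ c)
    (𝓜 : TopicModel I.n I.R) {γ τ : ℝ} (hn : 1 ≤ I.n) (hR : 1 ≤ I.R) (hE : 1 ≤ I.E)
    (hG : 1 ≤ I.G) (hT : 1 ≤ I.T) (hγ : 0 < γ) (hγG : 1 / γ ≤ I.G) (hτT : τ ≤ I.T)
    (hw : ∀ r, γ ≤ 𝓜.weight r) (hk : 2 ≤ I.rank ℓ) (hkR : I.rank ℓ ≤ I.R)
    (hRk : 2 * I.R ≤ ℓ * (I.rank ℓ - 1)) (hind : RobustIndep τ (I.rank ℓ) 𝓜.wordVector)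
    (hS : ∀ i, |I.frequency ℓ c i - 𝓜.tensor ℓ i| ≤ 1 / I.offset ℓ c) {z : ℕ}
    (hz : I.bad ℓ c z = 0) :
    ∃ π : Equiv.Perm (Fin I.R), ∀ r,
      ‖𝓜.wordVector r - WithLp.toLp 2 (I.wordVec ℓ c z (π r))‖ ≤ 1 / (I.base ℓ c : ℝ) ^ 4 ∧
        |𝓜.weight r - I.weight ℓ c z (π r)| ≤ 1 / (I.base ℓ c : ℝ) ^ 4 := by
  have hle := @le_base ℓ c I hn hR hE hG hT
  have hpow1 : 1 ≤ 2 ^ ℓ := Nat.one_le_two_pow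
  have hpow : 2 ^ (ℓ + 4) * (ℓ + c + 8) = 16 * 2 ^ ℓ * (ℓ + c + 8) := by ring
  have h16 : ∀ x ≤ 16, x ≤ 2 ^ (ℓ + 4) * (ℓ + c + 8) := fun x hx => by
    rw [hpow]
    calc x ≤ 16 * 1 := hx
      _ ≤ _ := Nat.mul_le_mul (by omega) (by omega)
  have hb8 : 8 ≤ I.base ℓ c := by
    have := hle (x := 8) (y := 1) (h16 _ (by norm_num)) (one_dvd _)
    omega
  have hb0 : 0 < I.base ℓ c := by omega
  set b : ℝ := (I.base ℓ c : ℝ) with hb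
  have hbR8 : (8 : ℝ) ≤ b := by rw [hb]; exact_mod_cast hb8
  have hbpos : 0 < b := by linarith
  have hb1 : 1 ≤ b := by linarith
  have hcast : ∀ {x : ℕ}, x ≤ I.base ℓ c → (x : ℝ) ≤ b := fun h => by rw [hb]; exact_mod_cast h
  have hnb : (I.n : ℝ) ≤ b := by
    have := hcast (hle (x := 1) (y := I.n) (h16 _ (by norm_num))
      ⟨I.R * I.E * I.G * I.T, by ring⟩)
    rwa [one_mul] at this
  have h8RT : (8 * (I.R * I.T) : ℝ) ≤ b := by
    have := hcast (hle (x := 8) (y := I.R * I.T) (h16 _ (by norm_num))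
      ⟨I.n * I.E * I.G, by ring⟩)
    exact_mod_cast this
  have hℓb : (ℓ : ℝ) ≤ b := by
    have := hcast (hle (x := ℓ) (y := 1) (by
      rw [hpow]
      calc ℓ = 1 * ℓ := (one_mul ℓ).symm
        _ ≤ _ := Nat.mul_le_mul (by omega) (by omega)) (one_dvd _))
    rwa [mul_one] at this
  have hGb : (I.G : ℝ) ≤ b := by
    have := hcast (hle (x := 1) (y := I.G) (h16 _ (by norm_num))
      ⟨I.n * I.R * I.E * I.T, by ring⟩)
    rwa [one_mul] at this
  have h4nT : (4 * (I.T * I.n) : ℝ) ≤ b := by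
    have := hcast (hle (x := 4) (y := I.T * I.n) (h16 _ (by norm_num))
      ⟨I.R * I.E * I.G, by ring⟩)
    exact_mod_cast this
  have hT1 : (1 : ℝ) ≤ I.T := by exact_mod_cast hT
  have hR1 : (1 : ℝ) ≤ I.R := by exact_mod_cast hR
  set A : ℝ := (I.tolInv ℓ c : ℝ) with hA
  have hAb : A = b ^ (4 * ℓ + 24) := by rw [hA, tolInv, Nat.cast_pow]
  have hA1 : 1 ≤ A := by rw [hAb]; exact one_le_pow₀ hb1
  have hApos : 0 < A := by linarith
  have hHA : A ≤ I.offset ℓ c := by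
    rw [hAb, offset, Nat.cast_pow]
    exact pow_le_pow_right₀ hb1 (by omega)
  have hHb : b ≤ I.offset ℓ c := by
    refine le_trans ?_ hHA
    rw [hAb]
    exact le_self_pow₀ hb1 (by omega)
  have hoff : 2 * I.offset ℓ c < I.radix ℓ c := by
    have h1 : I.radix ℓ c = I.offset ℓ c * I.base ℓ c := pow_succ _ _
    have h2 : 0 < I.offset ℓ c := offset_pos hb0
    rw [h1]
    have := Nat.mul_le_mul_left (I.offset ℓ c) hb8
    omega
  have hacc := accepted_of_bad_eq_zero hb0 hI hz hoff
  have hA1' : 1 / A ≤ 1 := by rw [div_le_one hApos]; exact hA1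
  have hv : RobustIndep (4 * I.T * I.n) (I.rank ℓ)
      fun s => (WithLp.toLp 2 (I.wordVec ℓ c z s) : EuclideanSpace ℝ (Fin I.n)) := by
    refine robustIndep_of_grid (H := I.offset ℓ c) (by linarith) (fun s => ?_) ?_ (offset_pos hb0) hacc.rank
    · have h1 := (abs_le.1 (hacc.sum s)).2
      have h2 : ∑ i, |I.wordVec ℓ c z s i| = ∑ i, I.wordVec ℓ c z s i :=
        Finset.sum_congr rfl fun i _ => abs_of_nonneg (wordVec_nonneg z s i)
      change ∑ i, |I.wordVec ℓ c z s i| ≤ 2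
      rw [h2]
      linarith
    · exact le_trans (by linarith) hHb
  have hcomm : 4 * (I.T : ℝ) * I.n ≤ b := by linarith
  have hRb : (I.R : ℝ) ≤ b := by
    have := le_mul_of_one_le_right (by linarith : (0 : ℝ) ≤ I.R) hT1
    linarith
  have h2T : 2 * (I.T : ℝ) ≤ b := by
    have := le_mul_of_one_le_left (by linarith : (0 : ℝ) ≤ I.T) hR1
    linarith
  refine exists_perm_near (u := 𝓜.wordVector) (w := 𝓜.weight) (w' := I.weight ℓ c z)
    (v := fun s => WithLp.toLp 2 (I.wordVec ℓ c z s)) (b := b) (κ := I.T) (κ' := 4 * I.T * I.n)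
    (γ := γ) (δ₀ := 2 / A) (ℓ := ℓ) (k := I.rank ℓ) hbR8 hnb hRb hℓb hT1 h2T (by positivity) hcomm hγ (hγG.trans hGb)
    (by positivity) ?_ (hind.mono hτT le_rfl) hv hk hkR hRk hw (weight_nonneg z) (fun s => ?_)
    (fun r i => 𝓜.wordMatrix_nonneg i r) 𝓜.sum_wordMatrix (fun s i => wordVec_nonneg z s i)
    (fun s => ?_) (fun i => ?_)
  · have : A = b ^ (4 * ℓ + 21) * b ^ 3 := by rw [hAb, ← pow_add]
    rw [div_mul_eq_mul_div, div_le_one hApos, this]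
    have h1 : 0 < b ^ (4 * ℓ + 21) := by positivity
    have h2 : 2 ≤ b ^ 3 := by
      calc (2 : ℝ) ≤ b := by linarith
        _ ≤ b ^ 3 := le_self_pow₀ hb1 (by omega)
    have := mul_le_mul_of_nonneg_left h2 h1.le
    linarith
  · rw [weight_eq hb0]
    have h1 : (I.digit ℓ c z (I.R * I.R + s) : ℝ) ≤ I.radix ℓ c := by
      exact_mod_cast (digit_lt hb0 z _).le
    have hg : (0 : ℝ) < I.grid ℓ c := by exact_mod_cast grid_pos hb0
    rw [div_le_iff₀ hg]
    refine h1.trans ?_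
    rw [radix, grid, Nat.cast_pow, Nat.cast_pow, ← pow_add]
    exact pow_le_pow_right₀ hb1 (by omega)
  · refine (hacc.sum s).trans ?_
    exact div_le_div_of_nonneg_right (by norm_num) hApos.le
  · have h1 := hacc.tensor i
    have h2 := hS i
    have h3 : 1 / (I.offset ℓ c : ℝ) ≤ 1 / A := one_div_le_one_div_of_le hApos hHA
    rw [abs_sub_comm] at h1 h2
    refine (abs_sub_le _ (I.frequency ℓ c i) _).trans ?_
    have : (2 : ℝ) / A = 1 / A + 1 / A := by ring
    rw [this]
    exact add_le_add (h2.trans h3) h1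

end RecoveryData

section Conclusion

variable {ℓ c n R : ℕ}

open scoped Matrix.Norms.Frobenius in
lemma frobenius_norm_le {A : Matrix (Fin n) (Fin R) ℝ} {d : ℝ} (hd : 0 ≤ d)
    (h : ∀ r, ‖(WithLp.toLp 2 fun i => A i r : EuclideanSpace ℝ (Fin n))‖ ≤ d) :
    ‖A‖ ≤ R * d := by
  rw [Matrix.frobenius_norm_def, ← Real.sqrt_eq_rpow]
  refine Real.sqrt_le_iff.2 ⟨by positivity, ?_⟩
  rw [Finset.sum_comm]
  have h1 : ∀ r, ∑ i, ‖A i r‖ ^ (2 : ℝ) ≤ d ^ 2 := by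
    intro r
    have h2 := pow_le_pow_left₀ (norm_nonneg _) (h r) 2
    rw [EuclideanSpace.norm_sq_eq] at h2
    simpa [Real.rpow_two] using h2
  refine (Finset.sum_le_card_nsmul _ _ _ fun r _ => h1 r).trans ?_
  rw [Finset.card_univ, Fintype.card_fin, nsmul_eq_mul, mul_pow]
  refine mul_le_mul_of_nonneg_right ?_ (by positivity)
  have : R ≤ R ^ 2 := Nat.le_self_pow (by norm_num) R
  exact_mod_cast this

lemma recoveredBy_of_close (hℓ : 1 ≤ ℓ) {𝓜 : TopicModel n R} {γ τ η : ℝ} (hγ : 0 < γ) (hτ : 0 < τ)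
    (hη : 0 < η) (hw : ∀ r, γ < 𝓜.weight r)
    (hM : 2 * (R : ℝ) / (ℓ : ℝ) + 1 ≤ (robustKruskalRank τ 𝓜.wordMatrix : ℝ))
    {X : ℕ → Fin ℓ → Fin n} {I : RecoveryData}
    (hI : I = corpusData ℓ c R ⌈1 / η⌉₊ ⌈1 / γ⌉₊ ⌈τ⌉₊ X)
    (hX : ∀ i, |(TopicModel.docCount X (I.docs ℓ c) i : ℝ) / I.docs ℓ c - 𝓜.tensor ℓ i|
      ≤ 1 / I.offset ℓ c) {s : RAMState}
    (hs : ∀ j ≤ n * R + R, s.mem j = I.output ℓ c (I.select ℓ c) j) :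
    𝓜.RecoveredBy η (s.outMatrix n R) (s.outWeight n R) := by
  subst hI
  set I := corpusData ℓ c R ⌈1 / η⌉₊ ⌈1 / γ⌉₊ ⌈τ⌉₊ X with hI
  obtain ⟨hR2, hn2, hτ1, hγ2, hk2, hkR, hRk, hind⟩ := 𝓜.rank_condition hℓ hτ hw hM
  have hE : 1 ≤ I.E := Nat.one_le_ceil_iff.2 (by positivity)
  have hG : 1 ≤ I.G := Nat.one_le_ceil_iff.2 (by positivity)
  have hT : 1 ≤ I.T := Nat.one_le_ceil_iff.2 hτ
  have hn1 : 1 ≤ I.n := by change 1 ≤ n; omega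
  have hR1 : 1 ≤ I.R := by change 1 ≤ R; omega
  have hγG : 1 / γ ≤ I.G := Nat.le_ceil _
  have hτT : τ ≤ I.T := Nat.le_ceil _
  have hηE : 1 / η ≤ I.E := Nat.le_ceil _
  have hpow := corpusData_hasPowers ℓ c R ⌈1 / η⌉₊ ⌈1 / γ⌉₊ ⌈τ⌉₊ X
  have hle := @RecoveryData.le_base ℓ c I hn1 hR1 hE hG hT
  have hc8 : 8 ≤ 2 ^ (ℓ + 4) * (ℓ + c + 8) := by
    calc 8 = 1 * 8 := rfl
      _ ≤ _ := Nat.mul_le_mul Nat.one_le_two_pow (by omega)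
  have hb8 := hle hc8 (one_dvd _)
  have hbR := hle ((by norm_num : 1 ≤ 8).trans hc8) (y := I.R) ⟨I.n * I.E * I.G * I.T, by ring⟩
  have hbE := hle ((by norm_num : 2 ≤ 8).trans hc8) (y := I.E) ⟨I.n * I.R * I.G * I.T, by ring⟩
  have hb0 : 0 < I.base ℓ c := by omega
  have hfreq : ∀ i : Fin ℓ → Fin n, I.frequency ℓ c i
      = TopicModel.docCount X (I.docs ℓ c) i / (I.docs ℓ c : ℝ) := corpusData_frequency ℓ c R _ _ _ X
  have hS1 : ∀ i : Fin ℓ → Fin n, |I.frequency ℓ c i| ≤ 1 := by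
    intro i
    rw [hfreq, abs_of_nonneg (by positivity)]
    refine div_le_one_of_le₀ ?_ (by positivity)
    have : TopicModel.docCount X (I.docs ℓ c) i ≤ I.docs ℓ c :=
      (Finset.card_filter_le _ _).trans_eq (Finset.card_range _)
    exact_mod_cast this
  have hS : ∀ i : Fin ℓ → Fin n, |I.frequency ℓ c i - 𝓜.tensor ℓ i| ≤ 1 / I.offset ℓ c := by
    intro i
    rw [hfreq]
    exact hX i
  have hRm : R ≤ (ℓ - 1) * ((2 * R + ℓ - 1) / ℓ) + 1 := by
    rw [Nat.sub_mul, one_mul]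
    omega
  have hsel : I.bad ℓ c (I.select ℓ c) = 0 := by
    obtain ⟨m, rfl⟩ := Nat.exists_eq_add_of_le' hℓ
    exact RecoveryData.exists_bad_eq_zero (I := I) hpow 𝓜 hn1 hR1 hE hG hT hγ hγG hτT
      (fun r => (hw r).le) hRm hind hS1 hS
  obtain ⟨π, hπ⟩ := RecoveryData.exists_perm_of_bad_eq_zero (I := I) hpow 𝓜 hn1 hR1 hE hG hT hγ hγG
    hτT (fun r => (hw r).le) hk2 hkR hRk hind hS hsel
  set b : ℝ := (I.base ℓ c : ℝ) with hb
  have hb8' : (8 : ℝ) ≤ b := by rw [hb]; exact_mod_cast (by omega : 8 ≤ I.base ℓ c)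
  have hbR' : (R : ℝ) ≤ b := by
    rw [hb]
    have h1 : R ≤ I.base ℓ c := by rw [one_mul] at hbR; exact hbR
    exact_mod_cast h1
  have hbE' : 2 * (I.E : ℝ) ≤ b := by rw [hb]; exact_mod_cast hbE
  have hbpos : 0 < b := by linarith
  have hEpos : (1 : ℝ) ≤ I.E := by exact_mod_cast hE
  have hbη : 2 / b ≤ η := by
    rw [div_le_iff₀ hbpos]
    have h1 : 1 ≤ I.E * η := by rwa [div_le_iff₀ hη] at hηE
    nlinarith
  have hword : ∀ (i : Fin n) (r : Fin R), s.outMatrix n R i r = I.wordVec ℓ c (I.select ℓ c) r i := by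
    intro i r
    have h1 : (i : ℕ) * R + r < n * R := by
      calc (i : ℕ) * R + r < i * R + R := by omega
        _ = (i + 1) * R := by ring
        _ ≤ _ := Nat.mul_le_mul_right _ i.2
    have h0 : s.mem 0 = I.den ℓ c := (hs 0 (Nat.zero_le _)).trans (if_pos rfl)
    have h2 : s.mem (1 + i * R + r) = I.wordNum ℓ c (I.select ℓ c) i r := by
      rw [hs _ (by omega), RecoveryData.output, if_neg (by omega), if_pos (by
        change 1 + i * R + r ≤ n * R; omega)]
      have e1 : 1 + (i : ℕ) * R + r - 1 = R * i + r := by rw [mul_comm R]; omega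
      change I.wordNum ℓ c _ ((1 + (i : ℕ) * R + r - 1) / R) ((1 + (i : ℕ) * R + r - 1) % R) = _
      rw [e1, Nat.mul_add_div (by omega), Nat.div_eq_of_lt r.2, Nat.add_zero, Nat.mul_add_mod,
        Nat.mod_eq_of_lt r.2]
    rw [RAMState.outMatrix, Matrix.of_apply, h0, h2]
    rfl
  have hweight : ∀ r : Fin R, s.outWeight n R r = I.weight ℓ c (I.select ℓ c) r := by
    intro r
    have h0 : s.mem 0 = I.den ℓ c := (hs 0 (Nat.zero_le _)).trans (if_pos rfl)
    have h2 : s.mem (1 + n * R + r) = I.weightNum ℓ c (I.select ℓ c) r := by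
      rw [hs _ (by omega), RecoveryData.output, if_neg (by omega), if_neg (by
        change ¬ (1 + n * R + r ≤ n * R); omega)]
      have e1 : 1 + n * R + (r : ℕ) - 1 - n * R = r := by omega
      change I.weightNum ℓ c _ (1 + n * R + (r : ℕ) - 1 - n * R) = _
      rw [e1]
    rw [RAMState.outWeight, h0, h2]
    rfl
  have hbb : 1 / b ^ 4 ≤ 1 / b ^ 2 :=
    one_div_le_one_div_of_le (by positivity) (pow_le_pow_right₀ (by linarith) (by norm_num))
  refine ⟨π, ?_, fun r => ?_⟩
  · refine (frobenius_norm_le (d := 1 / b ^ 2) (by positivity) fun r => ?_).trans ?_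
    · refine le_trans (le_of_eq ?_) ((hπ r).1.trans hbb)
      congr 1
      ext i
      exact congrArg (𝓜.wordMatrix i r - ·) (hword i (π r))
    · refine le_trans ?_ hbη
      rw [mul_one_div, div_le_div_iff₀ (by positivity) hbpos]
      nlinarith
  · rw [hweight]
    refine ((hπ r).2.trans hbb).trans_lt (lt_of_lt_of_le ?_ hbη)
    rw [div_lt_div_iff₀ (by positivity) hbpos]
    nlinarith

lemma pow_mul_exp_le (hn : 1 ≤ n) {b : ℝ} (hb : ((ℓ + c + 8 : ℕ) : ℝ) * n ≤ b) :
    (n : ℝ) ^ ℓ * (2 * Real.exp (-(2 * b))) ≤ 1 / (n : ℝ) ^ c := by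
  have hn' : (1 : ℝ) ≤ n := by exact_mod_cast hn
  have hnpos : (0 : ℝ) < n := by linarith
  have h1 : (n : ℝ) ^ (ℓ + c) ≤ Real.exp b := by
    have h2 : (n : ℝ) ≤ Real.exp n := by linarith [Real.add_one_le_exp (n : ℝ)]
    calc (n : ℝ) ^ (ℓ + c) ≤ Real.exp n ^ (ℓ + c) := pow_le_pow_left₀ hnpos.le h2 _
      _ = Real.exp ((ℓ + c : ℕ) * n) := (Real.exp_nat_mul _ _).symm
      _ ≤ Real.exp b := by
          refine Real.exp_le_exp.2 (le_trans ?_ hb)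
          refine mul_le_mul_of_nonneg_right ?_ hnpos.le
          exact_mod_cast Nat.le_add_right _ 8
  have hb8 : 1 ≤ b := by
    have : (1 : ℝ) * 1 ≤ ((ℓ + c + 8 : ℕ) : ℝ) * n :=
      mul_le_mul (by exact_mod_cast (by omega : 1 ≤ ℓ + c + 8)) hn' zero_le_one (by positivity)
    linarith
  have h3 : 2 ≤ Real.exp b := by linarith [Real.add_one_le_exp b]
  rw [Real.exp_neg, le_div_iff₀ (by positivity), two_mul b, Real.exp_add]
  have h4 : 0 < Real.exp b := Real.exp_pos b
  have e : (n : ℝ) ^ ℓ * (2 * (Real.exp b * Real.exp b)⁻¹) * (n : ℝ) ^ c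
      = (n : ℝ) ^ (ℓ + c) * 2 / (Real.exp b * Real.exp b) := by
    rw [pow_add]; field_simp
  rw [e, div_le_one (by positivity)]
  exact mul_le_mul h1 h3 (by norm_num) h4.le

lemma ceil_one_div_le {η : ℝ} (hη : 0 < η) : (⌈1 / η⌉₊ : ℝ) ≤ 2 / min η 1 := by
  have h1 : (⌈1 / η⌉₊ : ℝ) ≤ 1 / η + 1 := (Nat.ceil_lt_add_one (by positivity)).le
  refine h1.trans ?_
  rcases le_total η 1 with h | h
  · rw [min_eq_left h]
    have : 1 ≤ 1 / η := by rwa [le_div_iff₀ hη, one_mul]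
    have e : 2 / η = 1 / η + 1 / η := by ring
    linarith
  · rw [min_eq_right h]
    have : 1 / η ≤ 1 := by rwa [div_le_one hη]
    linarith

/-- The base in terms of the parameters of the model. -/
lemma base_corpusData_le {γ τ η : ℝ} (hγ : 0 < γ) (hγ1 : γ ≤ 1) (hτ : 1 ≤ τ) (hη : 0 < η)
    (X : ℕ → Fin ℓ → Fin n) :
    ((corpusData ℓ c R ⌈1 / η⌉₊ ⌈1 / γ⌉₊ ⌈τ⌉₊ X).base ℓ c : ℝ) ≤
      (2 ^ (ℓ + 4) * (ℓ + c + 8) : ℕ) * 8 * (n * R * (1 / (min η 1 * γ)) * τ) := by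
  have hη1 : 0 < min η 1 := lt_min hη one_pos
  have h1 := ceil_one_div_le hη
  have h2 := ceil_one_div_le hγ
  rw [min_eq_left hγ1] at h2
  have h3 : (⌈τ⌉₊ : ℝ) ≤ 2 * τ := (Nat.ceil_lt_add_one (by linarith)).le.trans (by linarith)
  change (((2 ^ (ℓ + 4) * (ℓ + c + 8)) * (n * R * ⌈1 / η⌉₊ * ⌈1 / γ⌉₊ * ⌈τ⌉₊) : ℕ) : ℝ) ≤ _
  rw [Nat.cast_mul, mul_assoc _ (8 : ℝ)]
  refine mul_le_mul_of_nonneg_left ?_ (Nat.cast_nonneg _)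
  push_cast
  calc (n : ℝ) * R * ⌈1 / η⌉₊ * ⌈1 / γ⌉₊ * ⌈τ⌉₊ ≤ n * R * (2 / min η 1) * (2 / γ) * (2 * τ) := by
        gcongr
    _ = _ := by field_simp; ring

lemma docs_bound {b K x y : ℝ} (hℓ : 1 ≤ ℓ) (hb0 : 0 ≤ b) (hK : 0 ≤ K) (hx : 1 ≤ x) (hy : 1 ≤ y)
    (hb : b ≤ K * (x * y)) :
    b ^ (10 * ℓ + 57) ≤ K ^ (10 * ℓ + 57) * x ^ (67 * 2 ^ ℓ) * y ^ (67 * ℓ) := by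
  have h1 : ℓ < 2 ^ ℓ := Nat.lt_two_pow_self
  calc b ^ (10 * ℓ + 57) ≤ (K * (x * y)) ^ (10 * ℓ + 57) := pow_le_pow_left₀ hb0 hb _
    _ = K ^ (10 * ℓ + 57) * x ^ (10 * ℓ + 57) * y ^ (10 * ℓ + 57) := by
        rw [mul_pow, mul_pow, mul_assoc]
    _ ≤ _ := by
        have h2 := pow_le_pow_right₀ hx (by omega : 10 * ℓ + 57 ≤ 67 * 2 ^ ℓ)
        have h3 := pow_le_pow_right₀ hy (by omega : 10 * ℓ + 57 ≤ 67 * ℓ)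
        gcongr

/-- The exponent in the running time. -/
lemma time_bound {b K₁ z L : ℝ} {d : ℕ} (hn : 2 ≤ n) (hb1 : 1 ≤ b) (hK₁ : 1 ≤ K₁) (hz : 2 ≤ z)
    (hb : b ≤ K₁ * (n : ℝ) ^ (d + 1) * z ^ 2) (hL : L = Real.log z) (m : ℕ) :
    b ^ (m * R ^ 2) ≤
      (n : ℝ) ^ (m * (4 * Real.log K₁ + 2 * (d + 1) + 4) * (R : ℝ) ^ 2 * L) := by
  have hn' : (2 : ℝ) ≤ n := by exact_mod_cast hn
  have hnpos : (0 : ℝ) < n := by linarith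
  have hbpos : 0 < b := by linarith
  have hlog2 : (1 / 2 : ℝ) ≤ Real.log 2 := by linarith [Real.log_two_gt_d9]
  have hln : 1 / 2 ≤ Real.log n := hlog2.trans (Real.log_le_log (by norm_num) hn')
  have hlz : 1 / 2 ≤ L := by rw [hL]; exact hlog2.trans (Real.log_le_log (by norm_num) hz)
  have hlK : 0 ≤ Real.log K₁ := Real.log_nonneg hK₁
  have h1 : Real.log b ≤ Real.log K₁ + (d + 1) * Real.log n + 2 * L := by
    refine (Real.log_le_log hbpos hb).trans_eq ?_
    rw [Real.log_mul (by positivity) (by positivity), Real.log_mul (by positivity) (by positivity),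
      Real.log_pow, Real.log_pow, hL]
    push_cast
    ring
  have h2 : Real.log b ≤ (4 * Real.log K₁ + 2 * (d + 1) + 4) * (Real.log n * L) := by
    refine h1.trans ?_
    have h3 : 1 / 4 ≤ Real.log n * L := by nlinarith
    have h4 := mul_le_mul_of_nonneg_left h3 hlK
    have h5 : (d + 1 : ℝ) * (Real.log n * (1 / 2)) ≤ (d + 1) * (Real.log n * L) := by gcongr
    have h6 : L * (1 / 2) ≤ Real.log n * L := by
      rw [mul_comm (Real.log n)]; gcongr
    linarith
  rw [Real.rpow_def_of_pos hnpos, ← Real.exp_log (pow_pos hbpos (m * R ^ 2)), Real.log_pow]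
  refine Real.exp_le_exp.2 ?_
  have h7 := mul_le_mul_of_nonneg_left h2 (by positivity : (0 : ℝ) ≤ m * (R : ℝ) ^ 2)
  push_cast
  linarith

end Conclusion

theorem mainTheorem10 :
    ∃ C : ℕ, ∀ ℓ : ℕ, 1 ≤ ℓ → ∀ c : ℕ, ∃ (A : RAMProgram) (K : ℝ) (D : ℕ → ℝ),
      ∀ (n R : ℕ) (𝓜 : TopicModel n R) (γ τ η : ℝ), 0 < γ → 0 < τ → 0 < η →
        (∀ r : Fin R, γ < 𝓜.weight r) →
        2 * (R : ℝ) / (ℓ : ℝ) + 1 ≤ (robustKruskalRank τ 𝓜.wordMatrix : ℝ) →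
        -- number of documents and running time
        (∀ X : ℕ → Fin ℓ → Fin n, ∃ (t : ℕ) (s : RAMState),
          RAMProgram.Exec X A (RAMState.input n R η γ τ) t s ∧
          (s.drawn : ℝ) ≤ K * ((R : ℝ) * n / (γ * min η 1)) ^ (C * 2 ^ ℓ) *
            ((n : ℝ) * τ / γ) ^ (C * ℓ) ∧
          ∀ d : ℕ, τ ≤ (n : ℝ) ^ d →
            (t : ℝ) ≤ (n : ℝ) ^ (D d * (R : ℝ) ^ 2 * Real.log (1 / (min η 1 * γ))) *
              ((n : ℝ) * τ / γ) ^ (C * ℓ)) ∧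
        -- correctness with high probability
        1 - 1 / (n : ℝ) ^ c ≤
          (𝓜.corpusLaw ℓ).real {X | ∃ (t : ℕ) (s : RAMState),
            RAMProgram.Exec X A (RAMState.input n R η γ τ) t s ∧
            𝓜.RecoveredBy η (s.outMatrix n R) (s.outWeight n R)} := by
  refine ⟨67, fun ℓ hℓ c => ?_⟩
  obtain ⟨A, K, q, hA⟩ := exists_recoveryProgram ℓ c hℓ
  set K₂ : ℕ := 2 ^ (ℓ + 4) * (ℓ + c + 8) with hK₂
  set m : ℕ := q * (K + (10 * ℓ + 57) + (5 * ℓ + 29) * (ℓ + 2)) with hm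
  refine ⟨A, ((K₂ : ℝ) * 8) ^ (10 * ℓ + 57), fun d => m * (4 * Real.log (K₂ * 8) + 2 * (d + 1) + 4),
    fun n R 𝓜 γ τ η hγ hτ hη hw hM => ?_⟩
  obtain ⟨hR2, hn2, hτ1, hγ2, -⟩ := 𝓜.rank_condition hℓ hτ hw hM
  have hE : 1 ≤ ⌈1 / η⌉₊ := Nat.one_le_ceil_iff.2 (by positivity)
  have hG : 1 ≤ ⌈1 / γ⌉₊ := Nat.one_le_ceil_iff.2 (by positivity)
  have hT : 1 ≤ ⌈τ⌉₊ := Nat.one_le_ceil_iff.2 hτ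
  have hex := fun X : ℕ → Fin ℓ → Fin n => hA n R ⌈1 / η⌉₊ ⌈1 / γ⌉₊ ⌈τ⌉₊ (by omega) (by omega) hE hG
    hT X (RAMState.input n R η γ τ) rfl (fun a => rfl)
  have hn' : (2 : ℝ) ≤ n := by exact_mod_cast hn2
  have hR' : (2 : ℝ) ≤ R := by exact_mod_cast hR2
  have hη1 : 0 < min η 1 := lt_min hη one_pos
  have hη1' : min η 1 ≤ 1 := min_le_right _ _
  have hγη : γ * min η 1 ≤ 1 / 2 := by nlinarith
  have hz : 2 ≤ 1 / (min η 1 * γ) := by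
    rw [le_div_iff₀ (by positivity), mul_comm (min η 1)]; linarith
  have hx : 1 ≤ (R : ℝ) * n / (γ * min η 1) := by
    rw [one_le_div (by positivity)]; nlinarith
  have hy : 1 ≤ (n : ℝ) * τ / γ := by
    rw [one_le_div hγ]; nlinarith
  have hK8 : (1 : ℝ) ≤ K₂ * 8 := by
    have : 1 ≤ K₂ * 8 := by
      have : 0 < K₂ := by positivity
      omega
    exact_mod_cast this
  constructor
  · intro X
    obtain ⟨t, s, he, hd, ht, -⟩ := hex X
    set I := corpusData ℓ c R ⌈1 / η⌉₊ ⌈1 / γ⌉₊ ⌈τ⌉₊ X with hI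
    have hbase : (I.base ℓ c : ℝ) ≤ K₂ * 8 * (n * R * (1 / (min η 1 * γ)) * τ) :=
      base_corpusData_le hγ (by linarith) hτ1 hη X
    have hb2 : 2 ≤ I.base ℓ c := by
      have h1 := RecoveryData.le_base (ℓ := ℓ) (c := c) (I := I) (x := 2) (y := 1)
        (by change 1 ≤ n; omega) (by change 1 ≤ R; omega) hE hG hT (by
          calc 2 = 1 * 2 := rfl
            _ ≤ _ := Nat.mul_le_mul Nat.one_le_two_pow (by omega)) (one_dvd _)
      omega
    refine ⟨t, s, he, ?_, fun d hτd => ?_⟩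
    · rw [hd, RecoveryData.docs, Nat.cast_pow]
      refine docs_bound hℓ (Nat.cast_nonneg _) (by linarith) hx hy (hbase.trans ?_)
      refine mul_le_mul_of_nonneg_left ?_ (by linarith)
      have e : (n : ℝ) * R * (1 / (min η 1 * γ)) * τ = (R * n / (γ * min η 1)) * τ := by
        field_simp
      rw [e]
      refine mul_le_mul_of_nonneg_left ?_ (by linarith)
      rw [le_div_iff₀ hγ]
      nlinarith
    · have hRγ : (R : ℝ) ≤ 1 / (min η 1 * γ) := by
        rw [le_div_iff₀ (by positivity)]
        have h1 : (R : ℝ) * γ ≤ 1 := by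
          rw [← 𝓜.sum_weight]
          refine le_trans (by simp) (Finset.card_nsmul_le_sum Finset.univ _ γ fun r _ => (hw r).le)
        nlinarith
      have hb : (I.base ℓ c : ℝ) ≤ K₂ * 8 * (n : ℝ) ^ (d + 1) * (1 / (min η 1 * γ)) ^ 2 := by
        refine hbase.trans ?_
        calc (K₂ : ℝ) * 8 * (n * R * (1 / (min η 1 * γ)) * τ)
            ≤ K₂ * 8 * (n * (1 / (min η 1 * γ)) * (1 / (min η 1 * γ)) * n ^ d) := by gcongr
          _ = _ := by ring
      have hb1 : (1 : ℝ) ≤ I.base ℓ c := by exact_mod_cast (by omega : 1 ≤ I.base ℓ c)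
      refine le_trans ?_ (le_mul_of_one_le_right (by positivity) (one_le_pow₀ hy))
      refine le_trans ?_ (time_bound (R := R) hn2 hb1 hK8 hz hb rfl m)
      have h1 : t ≤ I.base ℓ c ^ (m * R ^ 2) := by
        refine ht.trans ?_
        have h2 : K ≤ I.base ℓ c ^ K :=
          Nat.lt_two_pow_self.le.trans (Nat.pow_le_pow_left hb2 K)
        calc (K * (I.docs ℓ c * I.radix ℓ c ^ I.len ℓ)) ^ q
            ≤ (I.base ℓ c ^ K * (I.docs ℓ c * I.radix ℓ c ^ I.len ℓ)) ^ q :=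
              Nat.pow_le_pow_left (Nat.mul_le_mul_right _ h2) q
          _ = I.base ℓ c ^ ((K + ((10 * ℓ + 57) + (5 * ℓ + 29) * I.len ℓ)) * q) := by
              rw [RecoveryData.docs, RecoveryData.radix, ← pow_mul, ← pow_add, ← pow_add, ← pow_mul]
          _ ≤ I.base ℓ c ^ (m * R ^ 2) := by
              refine Nat.pow_le_pow_right (by omega) ?_
              have h3 : I.len ℓ ≤ (ℓ + 2) * R ^ 2 := by
                change R * R + R + R * ℓ ≤ _
                nlinarith [Nat.mul_le_mul_left (1 + ℓ) (Nat.mul_le_mul_left R (by omega : 1 ≤ R))]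
              have h4 : 1 ≤ R ^ 2 := Nat.one_le_pow _ _ (by omega)
              have h5 : K + ((10 * ℓ + 57) + (5 * ℓ + 29) * I.len ℓ)
                  ≤ (K + (10 * ℓ + 57) + (5 * ℓ + 29) * (ℓ + 2)) * R ^ 2 := by
                have h6 := Nat.mul_le_mul_left (5 * ℓ + 29) h3
                have h7 := Nat.mul_le_mul_left (K + (10 * ℓ + 57)) h4
                have e : (K + (10 * ℓ + 57) + (5 * ℓ + 29) * (ℓ + 2)) * R ^ 2
                    = (K + (10 * ℓ + 57)) * R ^ 2 + (5 * ℓ + 29) * ((ℓ + 2) * R ^ 2) := by ring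
                rw [e]
                omega
              calc _ ≤ (K + (10 * ℓ + 57) + (5 * ℓ + 29) * (ℓ + 2)) * R ^ 2 * q :=
                    Nat.mul_le_mul_right _ h5
                _ = m * R ^ 2 := by rw [hm]; ring
      exact_mod_cast h1
  · rcases isEmpty_or_nonempty (ℕ → Fin ℓ → Fin n) with hemp | ⟨⟨X₀⟩⟩
    · exact absurd (⟨fun _ _ => ⟨0, by omega⟩⟩ : Nonempty (ℕ → Fin ℓ → Fin n)) (not_nonempty_iff.2 hemp)
    set I := corpusData ℓ c R ⌈1 / η⌉₊ ⌈1 / γ⌉₊ ⌈τ⌉₊ X₀ with hI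
    have hbn : (ℓ + c + 8) * n ≤ I.base ℓ c :=
      RecoveryData.le_base (ℓ := ℓ) (c := c) (I := I) (x := ℓ + c + 8) (y := n)
        (by change 1 ≤ n; omega) (by change 1 ≤ R; omega) hE hG hT
        (Nat.le_mul_of_pos_left _ (by positivity))
        ⟨R * ⌈1 / η⌉₊ * ⌈1 / γ⌉₊ * ⌈τ⌉₊, by
          change n * R * ⌈1 / η⌉₊ * ⌈1 / γ⌉₊ * ⌈τ⌉₊ = _; ring⟩
    have hb0 : 0 < I.base ℓ c := by
      refine lt_of_lt_of_le ?_ hbn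
      exact Nat.mul_pos (by omega) (by omega)
    have hbpos : (0 : ℝ) < I.base ℓ c := by exact_mod_cast hb0
    have hoff : (0 : ℝ) < I.offset ℓ c := by exact_mod_cast RecoveryData.offset_pos hb0
    have hP : IsProbabilityMeasure (𝓜.corpusLaw ℓ) := by
      unfold TopicModel.corpusLaw; infer_instance
    refine le_trans ?_ ((𝓜.corpusLaw_real_close ℓ (N := I.docs ℓ c)
      (RecoveryData.docs_pos hb0) (ε := 1 / I.offset ℓ c) (by positivity)).trans
      (measureReal_mono (fun X hX => ?_)))
    · have e : 2 * (I.docs ℓ c : ℝ) * (1 / I.offset ℓ c) ^ 2 = 2 * I.base ℓ c := by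
        rw [RecoveryData.docs, RecoveryData.offset, Nat.cast_pow, Nat.cast_pow, div_pow, one_pow,
          ← pow_mul, mul_one_div, div_eq_iff (by positivity)]
        ring
      rw [e]
      refine sub_le_sub_left (pow_mul_exp_le (by omega) ?_) 1
      exact_mod_cast hbn
    · obtain ⟨t, s, he, -, -, hs⟩ := hex X
      exact ⟨t, s, he, recoveredBy_of_close (c := c) hℓ hγ hτ hη hw hM rfl hX hs⟩
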